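/- Let $G$ be a finite-dimensional semisimple modular Hopf algebra over $\mathbb C$: a semisimple ribbon Hopf algebra with coproduct $\Delta$, counit $\varepsilon$, antipode $S$, universal $R$-matrix $R=\sum r^1\otimes r^2\in G\otimes G$ ($R\Delta(\xi)=\Delta'(\xi)R$, $(\mathrm{id}\otimes\Delta)(R)=R_{13}R_{12}$, $(\Delta\otimes\mathrm{id})(R)=R_{13}R_{23}$; a prime denotes the flip of the two factors) and central ribbon element $v$ ($R'R=(v\otimes v)\Delta(v^{-1})$), such that the matrix $S_{IJ}=(\mathrm{tr}_q^I\otimes\mathrm{tr}_q^J)(R'R)$ is invertible. Here $I,J$ run over the equivalence classes of irreducible representations of $G$, with chosen representatives $\tau^I$ on $V^I$, $\mathrm{tr}^I_q(X)=\mathrm{Tr}(X\tau^I(g))$, and $g^{-1}=v^{-1}\sum S(r^2)r^1$. The label $0$ is the class of the trivial representation $\varepsilon$. *The algebras.* For $N\ge1$ let $K_N$ be the algebra generated by elements $\iota_n(\xi)$ ($n\in\mathbb Z/N$, $\xi\in G$) and the components of invertible elements $J_n\in G\otimes K_N$ ($n\in\mathbb Z/N$). Each $\iota_n$ is a unital homomorphism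 and the images of $\iota_n,\iota_m$ commute for $n\neq m$. Put $\Delta_n(\xi)=(\mathrm{id}\otimes\iota_n)\Delta(\xi)$; in $G\otimes G\otimes K_N$ let $J^1$, $J^2$ denote $J$ placed in factors $1,3$, resp. $2,3$, and $\Delta_a=\Delta\otimes\mathrm{id}$. For $N\ge2$ the further relations are: $\iota_n(\xi)J_n=J_n\Delta_n(\xi)$, $\Delta_{n-1}(\xi)J_n=J_n\iota_{n-1}(\xi)$, $\iota_m(\xi)J_n=J_n\iota_m(\xi)$ for $m\ne n,n-1$; $J^1_nJ^2_n=R\,\Delta_a(J_n)$; and, if $N\ge3$, $J^1_nRJ^2_{n+1}=J^2_{n+1}J^1_n$ and $J^1_nJ^2_m=J^2_mJ^1_n$ for $n\neq m,m\pm1$, whereas, if $N=2$, $J^1_1RJ^2_2=J^2_2R'J^1_1$. For $N=1$ they are $J^1RJ^2=R\,\Delta_a(J)$ and $\Delta_0(\xi)J=J\Delta_0(\xi)$. Put $U_\nu=(v^{1-\nu}\otimes e)J_1\cdots J_\nu$ and $M=U_N$. *The representations.* Let $\Re=G^*$ with $U\in G\otimes\mathrm{End}(\Re)$, $\pi_1(U)\pi_2=(\pi_1\otimes\pi_2)(R\Delta(\cdot))$,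 and with actions of $G$ by $\iota_1(\xi)\pi=\pi(\,\cdot\,\xi)$ and $\iota_0(\xi)\pi=\pi(S(\xi)\,\cdot\,)$. On $W_N^{IJ}=\Re^{\otimes(N-1)}\otimes V^I\otimes V^J$ let $D_\nu$ denote the action on the $\nu$-th factor $\Re$, and let $\vartheta_\nu$ be the action of $G$ through the tensor product (formed with $\Delta$) of the $\iota_0$-actions on the first $\nu-1$ factors $\Re$ (so $\vartheta_1=\varepsilon$). Then $D_N^{IJ}:K_N\to\mathrm{End}(W_N^{IJ})$ is the representation with $$D_N^{IJ}(U_\nu)=(\mathrm{id}\otimes\vartheta_\nu)(R^{-1})\,D_\nu(U),\qquad D_N^{IJ}(\iota_\nu(\xi))=D_\nu(\iota_1(\xi))\qquad(1\le\nu\le N-1),$$ $$D_N^{IJ}(M)=(\mathrm{id}\otimes\vartheta_N)(R^{-1})\,\big[(\mathrm{id}\otimes\tau^I)(R'R)\big]\,(\mathrm{id}\otimes\vartheta_N)(R),\qquad D_N^{IJ}(\iota_0(\xi))=(\vartheta_N\otimes\tau^I\otimes\tau^J)\big((\mathrm{id}\otimes\Delta)\Delta(\xi)\big).$$ *The tensor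 product.* For $M,N\ge1$ let $\Lambda_{M,N}:K_{M+N-1}\to K_M\otimes K_N$ be the algebra homomorphism given as follows, where $\alpha$ and $\beta$ mark objects of $K_M$ and $K_N$ and $N^\alpha_-=(\mathrm{id}\otimes\iota_0^\alpha)(R^{-1})$. One has $J_\rho\mapsto J^\alpha_\rho$ for $\rho<M$, $J_M\mapsto J^\alpha_MN^\alpha_-J^\beta_1$ and $J_\rho\mapsto J^\beta_{\rho-M+1}$ for $M<\rho\le M+N-1$, the image of the last current $J_{M+N-1}$ being in addition multiplied by $(N^\alpha_-)^{-1}$ from the right. Moreover $\iota_\rho(\xi)\mapsto\iota^\alpha_\rho(\xi)\otimes e$ for $1\le\rho<M$, $\iota_\rho(\xi)\mapsto e\otimes\iota^\beta_{\rho-M+1}(\xi)$ for $M\le\rho\le M+N-2$, and $\iota_{M+N-1}(\xi)\mapsto(\iota_0^\alpha\otimes\iota_0^\beta)(\Delta(\xi))$. For representations $D$ of $K_M$ and $D'$ of $K_N$ let $D\boxtimes D'=(D\otimes D')\circ\Lambda_{M,N}$, a representation of $K_{M+N-1}$. **Proposition (tensoring with the vacuum).** The homomorphisms $\Lambda_{M,N}$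 and the representations $D_N^{IJ}$ exist and are uniquely determined by these formulas, and for all $M,N\ge1$ and all labels $I,J$ the following representations of $K_{M+N-1}$ are isomorphic: $$D^{IJ}_{M+N-1}\;\simeq\;D^{IJ}_M\boxtimes D^{00}_N\;\simeq\;D^{00}_N\boxtimes D^{IJ}_M .$$ -/

import Mathlib

open scoped TensorProduct

namespace LatticeCurrent

noncomputable section

universe u

section Hopf

variable (G : Type u) [Ring G] [HopfAlgebra ℂ G]

/-- The coproduct `Δ : G → G ⊗ G` as an algebra homomorphism. -/
abbrev Δ : G →ₐ[ℂ] G ⊗[ℂ] G := Bialgebra.comulAlgHom ℂ G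

/-- The counit `ε : G → ℂ` as an algebra homomorphism. -/
abbrev ε : G →ₐ[ℂ] ℂ := Bialgebra.counitAlgHom ℂ G

/-- The antipode of `G`. -/
abbrev antipode : G →ₗ[ℂ] G := HopfAlgebra.antipode ℂ

/-- The flip `σ : G ⊗ G → G ⊗ G`; the image of `X` is written `X'`. -/
abbrev flip : G ⊗[ℂ] G →ₐ[ℂ] G ⊗[ℂ] G :=
  (Algebra.TensorProduct.comm ℂ G G).toAlgHom

variable {G}

/-- Let `A` be an algebra. For `X ∈ G ⊗ A` this is `X` placed in the first and third factor of
`G ⊗ G ⊗ A` (with unit in the second). -/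
def leg13 {A : Type*} [Semiring A] [Algebra ℂ A] : G ⊗[ℂ] A →ₐ[ℂ] G ⊗[ℂ] (G ⊗[ℂ] A) :=
  Algebra.TensorProduct.map (AlgHom.id ℂ G) Algebra.TensorProduct.includeRight

/-- For `X ∈ G ⊗ A` this is `X` placed in the second and third factor of `G ⊗ G ⊗ A`. -/
def leg23 {A : Type*} [Semiring A] [Algebra ℂ A] : G ⊗[ℂ] A →ₐ[ℂ] G ⊗[ℂ] (G ⊗[ℂ] A) :=
  Algebra.TensorProduct.includeRight

/-- For `X ∈ G ⊗ G` this is `X ⊗ e` in `G ⊗ G ⊗ A`. -/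
def leg12 {A : Type*} [Semiring A] [Algebra ℂ A] : G ⊗[ℂ] G →ₐ[ℂ] G ⊗[ℂ] (G ⊗[ℂ] A) :=
  Algebra.TensorProduct.map (AlgHom.id ℂ G) Algebra.TensorProduct.includeLeft

/-- `Δ_a = Δ ⊗ id : G ⊗ A → G ⊗ G ⊗ A`. -/
def comulAux {A : Type*} [Semiring A] [Algebra ℂ A] : G ⊗[ℂ] A →ₐ[ℂ] G ⊗[ℂ] (G ⊗[ℂ] A) :=
  (Algebra.TensorProduct.assoc ℂ ℂ ℂ G G A).toAlgHom.comp
    (Algebra.TensorProduct.map (Δ G) (AlgHom.id ℂ A))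

/-- The element `∑ S(r²) r¹` attached to `X = ∑ r¹ ⊗ r²`. -/
def drinfeld (X : G ⊗[ℂ] G) : G :=
  LinearMap.mul' ℂ G (TensorProduct.map (antipode G) LinearMap.id (flip G X))

variable (G) in
/-- A ribbon structure on the Hopf algebra `G`: a universal `R`-matrix and a ribbon element. -/
structure RibbonStructure where
  /-- the universal `R`-matrix -/
  R : (G ⊗[ℂ] G)ˣ
  /-- the ribbon element -/
  v : Gˣ
  R_comul : ∀ ξ : G, (R : G ⊗[ℂ] G) * Δ G ξ = flip G (Δ G ξ) * R
  id_comul_R : Algebra.TensorProduct.map (AlgHom.id ℂ G) (Δ G) (R : G ⊗[ℂ] G)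
    = leg13 (R : G ⊗[ℂ] G) * leg12 (R : G ⊗[ℂ] G)
  comul_id_R : comulAux (R : G ⊗[ℂ] G)
    = leg13 (R : G ⊗[ℂ] G) * leg23 (R : G ⊗[ℂ] G)
  v_central : ∀ ξ : G, (v : G) * ξ = ξ * v
  v_factor : flip G R * (R : G ⊗[ℂ] G) = ((v : G) ⊗ₜ[ℂ] (v : G)) * Δ G (↑v⁻¹ : G)
  v_sq : (v : G) * v = drinfeld (R : G ⊗[ℂ] G) * antipode G (drinfeld (R : G ⊗[ℂ] G))
  antipode_v : antipode G (v : G) = v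
  counit_v : ε G (v : G) = 1

/-- Two representations of an algebra are isomorphic if a linear isomorphism intertwines them. -/
def RepIso {A : Type*} [Semiring A] [Algebra ℂ A]
    {V W : Type*} [AddCommMonoid V] [Module ℂ V] [AddCommMonoid W] [Module ℂ W]
    (D : A →ₐ[ℂ] Module.End ℂ V) (D' : A →ₐ[ℂ] Module.End ℂ W) : Prop :=
  ∃ e : V ≃ₗ[ℂ] W, ∀ (x : A) (w : V), e (D x w) = D' x (e w)

/-- Irreducibility: the space is nonzero and has no proper nonzero invariant subspace. -/
def IsIrrep {A : Type*} [Semiring A] [Algebra ℂ A]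
    {V : Type*} [AddCommGroup V] [Module ℂ V] (D : A →ₐ[ℂ] Module.End ℂ V) : Prop :=
  Nontrivial V ∧ ∀ p : Submodule ℂ V, (∀ x : A, ∀ w ∈ p, D x w ∈ p) → p = ⊥ ∨ p = ⊤

/-- The family `τ` picks exactly one representative of every equivalence class of irreducible
representations of `G`. -/
structure IsIrrepSystem {ι : Type*} {V : ι → Type*} [∀ i, AddCommGroup (V i)]
    [∀ i, Module ℂ (V i)] (τ : ∀ i, G →ₐ[ℂ] Module.End ℂ (V i)) : Prop where
  irreducible : ∀ i, IsIrrep (τ i)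
  distinct : ∀ i j, RepIso (τ i) (τ j) → i = j
  complete : ∀ (n : ℕ) (ρ : G →ₐ[ℂ] Module.End ℂ (Fin n → ℂ)), IsIrrep ρ → ∃ i, RepIso ρ (τ i)

/-- The trivial representation: every `ξ` acts as the scalar `ε(ξ)` on a line. -/
def IsTrivialRep {V : Type*} [AddCommGroup V] [Module ℂ V]
    (ρ : G →ₐ[ℂ] Module.End ℂ V) : Prop :=
  Module.finrank ℂ V = 1 ∧ ∀ (ξ : G) (w : V), ρ ξ w = ε G ξ • w

namespace RibbonStructure

variable (H : RibbonStructure G)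

/-- `R'R ∈ G ⊗ G`. -/
def monodromy : G ⊗[ℂ] G := flip G H.R * (H.R : G ⊗[ℂ] G)

/-- The grouplike element `g`, given by `g⁻¹ = v⁻¹ ∑ S(r²) r¹` (the right-hand side is always
invertible). -/
def grouplike : G := Ring.inverse ((↑H.v⁻¹ : G) * drinfeld (H.R : G ⊗[ℂ] G))

/-- The linear form `ξ ↦ tr_q(ρ(ξ)) = Tr(ρ(ξ) ρ(g))` on `G`. -/
def qTrace {V : Type*} [AddCommGroup V] [Module ℂ V]
    (ρ : G →ₐ[ℂ] Module.End ℂ V) : G →ₗ[ℂ] ℂ :=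
  LinearMap.trace ℂ V ∘ₗ LinearMap.mulRight ℂ (ρ H.grouplike) ∘ₗ ρ.toLinearMap

/-- The (unnormalised) `S`-matrix `S_{IJ} = (tr_q^I ⊗ tr_q^J)(R'R)`. -/
def sMatrix {ι : Type*} {V : ι → Type*} [∀ i, AddCommGroup (V i)] [∀ i, Module ℂ (V i)]
    (τ : ∀ i, G →ₐ[ℂ] Module.End ℂ (V i)) : Matrix ι ι ℂ :=
  fun i j => LinearMap.mul' ℂ ℂ
    (TensorProduct.map (H.qTrace (τ i)) (H.qTrace (τ j)) H.monodromy)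

end RibbonStructure

/-! ### The lattice current algebra -/

variable [Module.Finite ℂ G]

variable (G) in
/-- A basis of the finite-dimensional algebra `G`. -/
abbrev basis : Module.Basis (Fin (Module.finrank ℂ G)) ℂ G := Module.finBasis ℂ G

/-- The element `∑ bᵢ ⊗ aᵢ` of `G ⊗ A` whose components along the dual basis are the `aᵢ`. -/
def universal {A : Type*} [Semiring A] [Algebra ℂ A]
    (a : Fin (Module.finrank ℂ G) → A) : G ⊗[ℂ] A :=
  ∑ i, (basis G i) ⊗ₜ[ℂ] a i

/-- The component `π(X) = (π ⊗ id)(X)` of `X ∈ G ⊗ A`. -/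
def component {A : Type*} [Semiring A] [Algebra ℂ A] (π : Module.Dual ℂ G) :
    G ⊗[ℂ] A →ₗ[ℂ] A :=
  (TensorProduct.lid ℂ A).toLinearMap ∘ₗ LinearMap.rTensor A π

variable (G) in
/-- Names of generators: components of `J_n`, components of `J_n⁻¹`, and basis elements of the
copy `G_n` of `G`, for links and sites `n` in `ℤ/N`. -/
inductive Gen (N : ℕ) : Type
  | link (n : ZMod N) (i : Fin (Module.finrank ℂ G)) : Gen N
  | linkInv (n : ZMod N) (i : Fin (Module.finrank ℂ G)) : Gen N
  | site (n : ZMod N) (i : Fin (Module.finrank ℂ G)) : Gen N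

variable (G) in
/-- The free algebra on the generators. -/
abbrev Free (N : ℕ) : Type := FreeAlgebra ℂ (Gen G N)

namespace Free

variable {N : ℕ}

/-- The free version of `J_n ∈ G ⊗ K_N`. -/
def J (n : ZMod N) : G ⊗[ℂ] Free G N := universal fun i => FreeAlgebra.ι ℂ (Gen.link n i)

/-- The free version of `J_n⁻¹ ∈ G ⊗ K_N`. -/
def Jinv (n : ZMod N) : G ⊗[ℂ] Free G N := universal fun i => FreeAlgebra.ι ℂ (Gen.linkInv n i)

/-- The free version of `ι_n : G → K_N`. -/
def site (n : ZMod N) : G →ₗ[ℂ] Free G N :=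
  (basis G).constr ℂ fun i => FreeAlgebra.ι ℂ (Gen.site n i)

/-- `ι_n(ξ)` regarded as the element `e ⊗ ι_n(ξ)` of `G ⊗ K_N`. -/
def siteAux (n : ZMod N) (ξ : G) : G ⊗[ℂ] Free G N := 1 ⊗ₜ[ℂ] site n ξ

/-- `Δ_n(ξ) = (id ⊗ ι_n) Δ(ξ)`. -/
def comulSite (n : ZMod N) (ξ : G) : G ⊗[ℂ] Free G N := LinearMap.lTensor G (site n) (Δ G ξ)

end Free

namespace RibbonStructure

variable (H : RibbonStructure G)

/-- `R` if the link `m` follows the link `n`, i.e. `m = n + 1` mod `N`, and the unit otherwise. -/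
def adj {N : ℕ} (n m : ZMod N) : G ⊗[ℂ] G := if m = n + 1 then (H.R : G ⊗[ℂ] G) else 1

/-- The defining relations of `K_N`. Equalities in `G ⊗ K_N` and in `G ⊗ G ⊗ K_N` are imposed by
equating all components.

The factors `adj` and the case distinctions in `cov` treat all `N ≥ 1` at once.
* For `N ≥ 3` the relations say `J¹ₙ J²ₙ = R Δ_a(Jₙ)`, `J¹ₙ R J²ₙ₊₁ = J²ₙ₊₁ J¹ₙ`, and
  `J¹ₙ J²ₘ = J²ₘ J¹ₙ` for the other pairs of links, together with `ιₙ(ξ) Jₙ = Jₙ Δₙ(ξ)`,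
  `Δₙ₋₁(ξ) Jₙ = Jₙ ιₙ₋₁(ξ)` and `ιₘ(ξ) Jₙ = Jₙ ιₘ(ξ)` for the other sites.
* For `N = 2` the two links follow each other at both of their ends and the braid relation is
  `J¹₁ R J²₂ = J²₂ R' J¹₁`.
* For `N = 1` there is a single link, with `J¹ R J² = R Δ_a(J)` and `Δ(ξ) J = J Δ(ξ)`. -/
inductive Rel (N : ℕ) : Free G N → Free G N → Prop
  | site_one (n : ZMod N) : Rel N (Free.site n 1) 1
  | site_mul (n : ZMod N) (ξ η : G) : Rel N (Free.site n (ξ * η)) (Free.site n ξ * Free.site n η)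
  | site_comm (n m : ZMod N) (ξ η : G) : n ≠ m →
      Rel N (Free.site n ξ * Free.site m η) (Free.site m η * Free.site n ξ)
  | inv_right (n : ZMod N) (π : Module.Dual ℂ G) :
      Rel N (component π (Free.J n * Free.Jinv n)) (component π 1)
  | inv_left (n : ZMod N) (π : Module.Dual ℂ G) :
      Rel N (component π (Free.Jinv n * Free.J n)) (component π 1)
  | cov (n m : ZMod N) (ξ : G) (π : Module.Dual ℂ G) :
      Rel N
        (component π
          ((if m = n - 1 then Free.comulSite m ξ else Free.siteAux m ξ) * Free.J n))
        (component π
          (Free.J n * (if m = n then Free.comulSite m ξ else Free.siteAux m ξ)))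
  | funct (n : ZMod N) (π₁ π₂ : Module.Dual ℂ G) :
      Rel N
        (component π₂ (component π₁
          (leg13 (Free.J n) * leg12 (H.adj n n) * leg23 (Free.J n))))
        (component π₂ (component π₁
          (leg12 (H.R : G ⊗[ℂ] G) * comulAux (Free.J n))))
  | braid (n m : ZMod N) (π₁ π₂ : Module.Dual ℂ G) : n ≠ m →
      Rel N
        (component π₂ (component π₁
          (leg13 (Free.J n) * leg12 (H.adj n m) * leg23 (Free.J m))))
        (component π₂ (component π₁
          (leg23 (Free.J m) * leg12 (flip G (H.adj m n)) * leg13 (Free.J n))))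

/-- The lattice current algebra `K_N`. -/
def K (N : ℕ) : Type := RingQuot (H.Rel N)

instance (N : ℕ) : Ring (H.K N) := inferInstanceAs (Ring (RingQuot (H.Rel N)))

instance (N : ℕ) : Algebra ℂ (H.K N) := inferInstanceAs (Algebra ℂ (RingQuot (H.Rel N)))

/-- The quotient map onto `K_N`. -/
def proj (N : ℕ) : Free G N →ₐ[ℂ] H.K N := RingQuot.mkAlgHom ℂ (H.Rel N)

/-- The left current `J_n ∈ G ⊗ K_N`. -/
def J {N : ℕ} (n : ZMod N) : G ⊗[ℂ] H.K N :=
  Algebra.TensorProduct.map (AlgHom.id ℂ G) (H.proj N) (Free.J n)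

/-- The embedding `ι_n : G → K_N`. -/
def site {N : ℕ} (n : ZMod N) : G →ₐ[ℂ] H.K N :=
  AlgHom.ofLinearMap ((H.proj N).toLinearMap ∘ₗ Free.site n)
    (by
      have h := RingQuot.mkAlgHom_rel ℂ (Rel.site_one (H := H) n)
      rw [map_one (RingQuot.mkAlgHom ℂ (H.Rel N))] at h
      exact h)
    (by
      intro ξ η
      have h := RingQuot.mkAlgHom_rel ℂ (Rel.site_mul (H := H) n ξ η)
      rw [map_mul (RingQuot.mkAlgHom ℂ (H.Rel N))] at h
      exact h)

/-- The holonomy `U_ν = v_a^{1-ν} J_1 ⋯ J_ν` for `ν ≥ 1`. -/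
def U (N ν : ℕ) : G ⊗[ℂ] H.K N :=
  ((↑(H.v⁻¹ ^ (ν - 1)) : G) ⊗ₜ[ℂ] 1) *
    ((List.range ν).map fun k => H.J (((k + 1 : ℕ)) : ZMod N)).prod

/-- The (left) monodromy `M = v_a^{1-N} J_1 ⋯ J_N`. -/
def M (N : ℕ) : G ⊗[ℂ] H.K N := H.U N N

/-! ### The representation of the algebra generated by one holonomy -/

/-- The twisted product `(π₁ ∗ π₂)(ξ) = (π₁ ⊗ π₂)(R Δ(ξ))` of linear forms, which is also the
action `π₁(U)|π₂⟩` of the components of `U`. -/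
def starProd (π₁ : Module.Dual ℂ G) : Module.End ℂ (Module.Dual ℂ G) where
  toFun π₂ := LinearMap.mul' ℂ ℂ ∘ₗ TensorProduct.map π₁ π₂ ∘ₗ
    LinearMap.mulLeft ℂ (H.R : G ⊗[ℂ] G) ∘ₗ (Δ G).toLinearMap
  map_add' a b := by
    rw [TensorProduct.map_add_right, LinearMap.add_comp, LinearMap.comp_add]
  map_smul' c a := by
    rw [TensorProduct.map_smul_right, LinearMap.smul_comp, LinearMap.comp_smul, RingHom.id_apply]

/-- `D(U) ∈ G ⊗ End(ℜ)`. The carrier space `ℜ` of vectors `|π⟩` is the dual of `G`. -/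
def holonomyOp : G ⊗[ℂ] Module.End ℂ (Module.Dual ℂ G) :=
  universal fun i => H.starProd ((basis G).coord i)

end RibbonStructure

/-- The action of `ι_1` on `ℜ`: `ι_1(ξ)|π⟩ = |π(· ξ)⟩`. -/
def headOp : G →ₗ[ℂ] Module.End ℂ (Module.Dual ℂ G) where
  toFun ξ := Module.Dual.transpose (LinearMap.mulRight ℂ ξ)
  map_add' x y := by
    ext π z
    simp [Module.Dual.transpose_apply, mul_add]
  map_smul' c x := by
    ext π z
    simp [Module.Dual.transpose_apply]

/-- The action of `ι_0` on `ℜ`: `ι_0(ξ)|π⟩ = |π(S(ξ) ·)⟩`. -/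
def tailOp : G →ₗ[ℂ] Module.End ℂ (Module.Dual ℂ G) where
  toFun ξ := Module.Dual.transpose (LinearMap.mulLeft ℂ (antipode G ξ))
  map_add' x y := by
    ext π z
    simp [Module.Dual.transpose_apply, add_mul]
  map_smul' c x := by
    ext π z
    simp [Module.Dual.transpose_apply]

/-! ### The representations `D_N^{IJ}` -/

variable (G) in
/-- The carrier space `W_N^{IJ} = ℜ^{⊗(N-1)} ⊗ (V^I ⊗ V^J)`. -/
abbrev W (N : ℕ) (VI VJ : Type*) [AddCommGroup VI] [Module ℂ VI] [AddCommGroup VJ]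
    [Module ℂ VJ] : Type _ :=
  (⨂[ℂ] _ : Fin (N - 1), Module.Dual ℂ G) ⊗[ℂ] (VI ⊗[ℂ] VJ)

section Rep

variable {N : ℕ} {VI VJ : Type*} [AddCommGroup VI] [Module ℂ VI] [AddCommGroup VJ] [Module ℂ VJ]

variable (N VI VJ) in
/-- The operator on `W_N^{IJ}` which acts as `X` on one factor `ℜ` (the factors are numbered from
`0` here) and as the identity on all other tensor factors. -/
def onFactor (k : Fin (N - 1)) :
    Module.End ℂ (Module.Dual ℂ G) →ₗ[ℂ] Module.End ℂ (W G N VI VJ) :=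
  (Module.End.rTensorAlgHom ℂ (⨂[ℂ] _ : Fin (N - 1), Module.Dual ℂ G) (VI ⊗[ℂ] VJ)).toLinearMap ∘ₗ
    (PiTensorProduct.mapMultilinear ℂ (fun _ : Fin (N - 1) => Module.Dual ℂ G)
      (fun _ => Module.Dual ℂ G)).toLinearMap (fun _ => LinearMap.id) k

variable (N) in
/-- The operator on `W_N^{IJ}` which acts as `X` on the last factor `V^I ⊗ V^J`. -/
def onLast : Module.End ℂ (VI ⊗[ℂ] VJ) →ₐ[ℂ] Module.End ℂ (W G N VI VJ) :=
  Module.End.lTensorAlgHom ℂ (VI ⊗[ℂ] VJ) (⨂[ℂ] _ : Fin (N - 1), Module.Dual ℂ G)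

/-- For linear maps `f`, `h` on `G` with values in an algebra, the map
`ξ ↦ ∑ f(ξ¹) h(ξ²)`, where `Δ(ξ) = ∑ ξ¹ ⊗ ξ²`. -/
def convolve {A : Type*} [Semiring A] [Algebra ℂ A] (f h : G →ₗ[ℂ] A) : G →ₗ[ℂ] A :=
  LinearMap.mul' ℂ A ∘ₗ TensorProduct.map f h ∘ₗ (Δ G).toLinearMap

variable (N VI VJ) in
/-- The action of `G` on `W_N^{IJ}` through the tensor product of the first `k` copies of the
`ι_0`-action on `ℜ`; this is `ϑ_{k+1}`. -/
def theta : (k : ℕ) → k ≤ N - 1 → (G →ₗ[ℂ] Module.End ℂ (W G N VI VJ))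
  | 0, _ => Algebra.linearMap ℂ _ ∘ₗ (ε G).toLinearMap
  | k + 1, h => convolve (theta k (Nat.le_of_succ_le h)) (onFactor N VI VJ ⟨k, h⟩ ∘ₗ tailOp)

/-- The tensor product `τ^I ⊠ τ^J = (τ^I ⊗ τ^J) ∘ Δ` of representations of `G`. -/
def boxRep (τI : G →ₐ[ℂ] Module.End ℂ VI) (τJ : G →ₐ[ℂ] Module.End ℂ VJ) :
    G →ₐ[ℂ] Module.End ℂ (VI ⊗[ℂ] VJ) :=
  (Module.endTensorEndAlgHom (R := ℂ) (S := ℂ) (A := ℂ) (M := VI) (N := VJ)).comp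
    ((Algebra.TensorProduct.map τI τJ).comp (Δ G))

namespace RibbonStructure

variable (H : RibbonStructure G)

/-- `D^{IJ}(M) = (id ⊗ τ^I)(R'R)`, acting trivially on `V^J`. -/
def monodromyOp (τI : G →ₐ[ℂ] Module.End ℂ VI) : G ⊗[ℂ] Module.End ℂ (VI ⊗[ℂ] VJ) :=
  Algebra.TensorProduct.map (AlgHom.id ℂ G) ((Module.End.rTensorAlgHom ℂ VI VJ).comp τI)
    H.monodromy

/-- `D` is the representation `D_N^{IJ}` of `K_N` on `W_N^{IJ}`: the holonomies `U_ν`, the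
monodromy `M` and the elements of the site algebras act by
* `D(U_ν) = (id ⊗ ϑ_ν)(R⁻¹) D_ν(U)` for `1 ≤ ν ≤ N - 1`,
* `D(M) = (id ⊗ ϑ_N)(R⁻¹) D^{IJ}(M) (id ⊗ ϑ_N)(R)`,
* `D(ι_ν(ξ)) = D_ν(ι_1(ξ))` for `1 ≤ ν ≤ N - 1`,
* `D(ι_0(ξ)) = (ϑ_N ⊠ (τ^I ⊠ τ^J))(ξ)`. -/
structure IsLatticeRep (τI : G →ₐ[ℂ] Module.End ℂ VI) (τJ : G →ₐ[ℂ] Module.End ℂ VJ)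
    (D : H.K N →ₐ[ℂ] Module.End ℂ (W G N VI VJ)) : Prop where
  holonomy : ∀ k : Fin (N - 1),
    Algebra.TensorProduct.map (AlgHom.id ℂ G) D (H.U N (k + 1))
      = LinearMap.lTensor G (theta N VI VJ k k.2.le) (↑H.R⁻¹ : G ⊗[ℂ] G)
        * LinearMap.lTensor G (onFactor N VI VJ k) H.holonomyOp
  monodromy :
    Algebra.TensorProduct.map (AlgHom.id ℂ G) D (H.M N)
      = LinearMap.lTensor G (theta N VI VJ (N - 1) le_rfl) (↑H.R⁻¹ : G ⊗[ℂ] G)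
        * Algebra.TensorProduct.map (AlgHom.id ℂ G) (onLast N) (H.monodromyOp τI)
        * LinearMap.lTensor G (theta N VI VJ (N - 1) le_rfl) (↑H.R : G ⊗[ℂ] G)
  site : ∀ (k : Fin (N - 1)) (ξ : G),
    D (H.site (((k + 1 : ℕ)) : ZMod N) ξ) = onFactor N VI VJ k (headOp ξ)
  site_zero : ∀ ξ : G,
    D (H.site 0 ξ)
      = convolve (theta N VI VJ (N - 1) le_rfl)
          ((onLast N).toLinearMap ∘ₗ (boxRep τI τJ).toLinearMap) ξ

end RibbonStructure

end Rep

/-! ### The coproduct `Λ_{M,N}` and the tensor product of representations -/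

namespace RibbonStructure

variable (H : RibbonStructure G) (M N : ℕ)

/-- The embedding `G ⊗ K_M → G ⊗ K_M ⊗ K_N`, written with an upper index `α`. -/
def left : G ⊗[ℂ] H.K M →ₐ[ℂ] G ⊗[ℂ] (H.K M ⊗[ℂ] H.K N) :=
  Algebra.TensorProduct.map (AlgHom.id ℂ G) Algebra.TensorProduct.includeLeft

/-- The embedding `G ⊗ K_N → G ⊗ K_M ⊗ K_N`, written with an upper index `β`. -/
def right : G ⊗[ℂ] H.K N →ₐ[ℂ] G ⊗[ℂ] (H.K M ⊗[ℂ] H.K N) :=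
  Algebra.TensorProduct.map (AlgHom.id ℂ G) Algebra.TensorProduct.includeRight

/-- `N^α_- = (id ⊗ ι^α_0)(R⁻¹)`. -/
def Nminus : G ⊗[ℂ] (H.K M ⊗[ℂ] H.K N) :=
  H.left M N (Algebra.TensorProduct.map (AlgHom.id ℂ G) (H.site 0) (↑H.R⁻¹ : G ⊗[ℂ] G))

/-- `(N^α_-)⁻¹ = (id ⊗ ι^α_0)(R)`. -/
def NminusInv : G ⊗[ℂ] (H.K M ⊗[ℂ] H.K N) :=
  H.left M N (Algebra.TensorProduct.map (AlgHom.id ℂ G) (H.site 0) (↑H.R : G ⊗[ℂ] G))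

variable {M N} in
/-- `Λ` is the coproduct `Λ_{M,N} : K_{M+N-1} → K_M ⊗ K_N`, given on the generators by
* `J_ρ ↦ J^α_ρ` for `1 ≤ ρ ≤ M - 1`, `J_M ↦ J^α_M N^α_- J^β_1`, and `J_ρ ↦ J^β_{ρ-M+1}` for
  `M + 1 ≤ ρ`, where the image of the last current `J_{M+N-1}` is in addition multiplied by
  `(N^α_-)⁻¹` from the right;
* `ι_ρ ↦ ι^α_ρ` for `1 ≤ ρ ≤ M - 1`, `ι_ρ ↦ ι^β_{ρ-M+1}` for `M ≤ ρ ≤ M + N - 2`, and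
  `ι_{M+N-1} ↦ (ι^α_0 ⊗ ι^β_0) ∘ Δ`.
The number `L` stands for `M + N - 1`. -/
structure IsCoproduct {L : ℕ} (Λ : H.K L →ₐ[ℂ] H.K M ⊗[ℂ] H.K N) : Prop where
  length : L + 1 = M + N
  current : ∀ ρ : ℕ, 1 ≤ ρ → ρ ≤ L →
    Algebra.TensorProduct.map (AlgHom.id ℂ G) Λ (H.J (ρ : ZMod L))
      = (if ρ < M then H.left M N (H.J (ρ : ZMod M))
          else if ρ = M then
            H.left M N (H.J (M : ZMod M)) * H.Nminus M N * H.right M N (H.J 1)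
          else H.right M N (H.J ((ρ - M + 1 : ℕ) : ZMod N)))
        * (if ρ = L then H.NminusInv M N else 1)
  site : ∀ (ρ : ℕ) (ξ : G), 1 ≤ ρ → ρ ≤ L →
    Λ (H.site (ρ : ZMod L) ξ)
      = if ρ = L then Algebra.TensorProduct.map (H.site (0 : ZMod M)) (H.site (0 : ZMod N)) (Δ G ξ)
        else if ρ < M then H.site (ρ : ZMod M) ξ ⊗ₜ[ℂ] 1
        else 1 ⊗ₜ[ℂ] H.site ((ρ - M + 1 : ℕ) : ZMod N) ξ

variable {H M N} in
/-- The tensor product `D ⊠ D' = (D ⊗ D') ∘ Λ` of a representation of `K_M` and one of `K_N`. -/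
def tensorRep {L : ℕ} (Λ : H.K L →ₐ[ℂ] H.K M ⊗[ℂ] H.K N)
    {V V' : Type*} [AddCommMonoid V] [Module ℂ V] [AddCommMonoid V'] [Module ℂ V']
    (D : H.K M →ₐ[ℂ] Module.End ℂ V) (D' : H.K N →ₐ[ℂ] Module.End ℂ V') :
    H.K L →ₐ[ℂ] Module.End ℂ (V ⊗[ℂ] V') :=
  (Module.endTensorEndAlgHom (R := ℂ) (S := ℂ) (A := ℂ) (M := V) (N := V')).comp
    ((Algebra.TensorProduct.map D D').comp Λ)

end RibbonStructure

end Hopf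

end

end LatticeCurrent

namespace LatticeCurrent

noncomputable section

universe u

/-! ### Calculus of pairings with values in an algebra -/

section Calculus

variable {G : Type u} [Ring G] [HopfAlgebra ℂ G]
variable {B : Type*} [Ring B] [Algebra ℂ B] {C : Type*} [Ring C] [Algebra ℂ C]

/-! The currents are awkward generators, because neighbouring ones braid. The holonomies `U_ν =
v^{1-ν} J_1 ⋯ J_ν` all start at the site `0`: any two of them exchange at the cost of `R'`, each
`U_ν` with `ν < N` is functorial on its own, and it is seen only by the sites `0` and `ν`. With the
convention `U_0 = v` the currents are recovered as `J_n = v U_{n-1}⁻¹ U_n`, and the two sets of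
relations are equivalent (`IsHolonomySystem.isCurrentSystem`, `IsCurrentSystem.isHolonomySystem`).
The powers of `v` are what makes this work: when functoriality of a product is computed, a factor
`R'R` is left over, and `R'R = (v ⊗ v) Δ(v⁻¹)` absorbs it.

In terms of holonomies two lattices are easy to glue. Given commuting systems `α`, `β` of lengths
`M`, `N`, put `P = M^α N^α_-`. The glued lattice has the holonomies `U^α_ν` for `ν < M`, then `P
U^β_κ` for `κ < N`, and the monodromy `P M^β (N^α_-)⁻¹`; its site `0` acts through the coproduct.
The relations follow from those of the two parts (`isHolonomySystem_concat`), and the associated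
currents are those prescribed for `Λ_{M,N}` (`currentOf_concatU`). Hence `Λ_{M,N}` exists; it is
unique because holonomies and sites determine a homomorphism.

The building blocks of the representations are `ℜ`, a representation of `K_2` with monodromy `1`
(`isHolonomySystem_regular`; invertibility of `D(U)` rests on `v² = u S(u)` with `u = ∑ S(r²) r¹`),
and `V^I ⊗ V^J`, a representation of `K_1` with monodromy `R'R` (`exists_isLatticeHom_one`). If the
vacuum is the left factor, its monodromy is `1` and its site `0` acts by `ϑ`, so the gluing formulas
are literally those of `D^{IJ}_{M+N-1}` (`IsConcat.isLatticeHom`). Attaching one `ℜ` at a time from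
the left yields the existence of all `D^{IJ}_N`; the same lemma gives one of the two isomorphisms.

If the vacuum is the right factor, `V^I ⊗ V^J` stands in front of the new factors `ℜ`, and these see
the extra twist `R_{ia} R_{aj}⁻¹`, where `a` is the auxiliary factor and `i`, `j` are the actions on
`V^I`, `V^J`. Let `t` be the action of `ι_0` on the vacuum. Conjugation with `R_{tj} R_{it}⁻¹`,
which braids the vacuum past `V^J` and past `V^I` with opposite crossings, removes the twist
(`IsConcat.isLatticeHom_braided`). Since `D^{IJ}_{M+N-1}` is determined by its formulas, the
conjugated representation is equal to it. -/

/-- Elementwise commutation of the values of two maps. -/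
def Commuting {X Y : Type*} (f : X → B) (g : Y → B) : Prop := ∀ x y, Commute (f x) (g y)

theorem Commuting.symm {B : Type*} [Ring B] {X Y : Type*} {f : X → B} {g : Y → B} (h : Commuting f g) :
    Commuting g f := fun x y => (h y x).symm

/-- A linear map that preserves units and products. -/
structure IsRep (f : G →ₗ[ℂ] B) : Prop where
  one : f 1 = 1
  mul : ∀ x y, f (x * y) = f x * f y

/-- The algebra homomorphism underlying a multiplicative linear map. -/
def IsRep.hom {f : G →ₗ[ℂ] B} (h : IsRep f) : G →ₐ[ℂ] B := AlgHom.ofLinearMap f h.one h.mul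

theorem IsRep.ofAlgHom (f : G →ₐ[ℂ] B) : IsRep f.toLinearMap := ⟨map_one f, map_mul f⟩

theorem IsRep.comp {f : G →ₗ[ℂ] B} (h : IsRep f) (φ : B →ₐ[ℂ] C) :
    IsRep (φ.toLinearMap ∘ₗ f) :=
  ⟨by simp [h.one], fun x y => by simp [h.mul]⟩

/-- The map `x ⊗ y ↦ f(x) g(y)`. -/
def pr (f g : G →ₗ[ℂ] B) : G ⊗[ℂ] G →ₗ[ℂ] B := LinearMap.mul' ℂ B ∘ₗ TensorProduct.map f g

@[simp] theorem pr_tmul (f g : G →ₗ[ℂ] B) (x y : G) : pr f g (x ⊗ₜ y) = f x * g y := rfl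

theorem convolve_apply (f g : G →ₗ[ℂ] B) (ξ : G) : convolve f g ξ = pr f g (Δ G ξ) := rfl

theorem pr_eq_lift {f g : G →ₗ[ℂ] B} (hf : IsRep f) (hg : IsRep g) (h : Commuting f g) :
    pr f g = (Algebra.TensorProduct.lift hf.hom hg.hom h).toLinearMap := by
  ext x y; rfl

theorem pr_mul {f g : G →ₗ[ℂ] B} (hf : IsRep f) (hg : IsRep g) (h : Commuting f g)
    (X Y : G ⊗[ℂ] G) : pr f g (X * Y) = pr f g X * pr f g Y := by
  rw [pr_eq_lift hf hg h]
  exact map_mul (Algebra.TensorProduct.lift hf.hom hg.hom h) X Y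

theorem pr_one {f g : G →ₗ[ℂ] B} (hf : IsRep f) (hg : IsRep g) : pr f g 1 = 1 := by
  rw [Algebra.TensorProduct.one_def, pr_tmul, hf.one, hg.one, one_mul]

theorem pr_flip {f g : G →ₗ[ℂ] B} (h : Commuting f g) (Y : G ⊗[ℂ] G) :
    pr g f (flip G Y) = pr f g Y := by
  induction Y with
  | zero => simp
  | tmul x y => exact (h x y).symm
  | add x y hx hy => simp only [map_add, hx, hy]

/-- The main tool: an exchange relation of `X` with two actions passes to every element of `G ⊗ G`
evaluated in them, in particular to `R`, `R⁻¹` and `Δ(ξ)`. No commutation between `f` and `g` is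
needed. -/
theorem pr_intertwine {f f' g g' : G →ₗ[ℂ] B} {X : B} (hf : ∀ x, f x * X = X * f' x)
    (hg : ∀ x, g x * X = X * g' x) (Y : G ⊗[ℂ] G) : pr f g Y * X = X * pr f' g' Y := by
  induction Y with
  | zero => simp
  | tmul x y => rw [pr_tmul, pr_tmul, mul_assoc, hg, ← mul_assoc, hf, mul_assoc]
  | add x y hx hy => simp only [map_add, add_mul, mul_add, hx, hy]

theorem convolve_intertwine {f f' g g' : G →ₗ[ℂ] B} {X : B} (hf : ∀ x, f x * X = X * f' x)
    (hg : ∀ x, g x * X = X * g' x) (ξ : G) : convolve f g ξ * X = X * convolve f' g' ξ :=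
  pr_intertwine hf hg _

theorem commute_pr {f g : G →ₗ[ℂ] B} {X : B} (hf : ∀ x, Commute (f x) X)
    (hg : ∀ x, Commute (g x) X) (Y : G ⊗[ℂ] G) : Commute (pr f g Y) X :=
  pr_intertwine hf hg Y

theorem commute_convolve {f g : G →ₗ[ℂ] B} {X : B} (hf : ∀ x, Commute (f x) X)
    (hg : ∀ x, Commute (g x) X) (ξ : G) : Commute (convolve f g ξ) X :=
  commute_pr hf hg _

theorem Commuting.convolve_left {X : Type*} {f g : G →ₗ[ℂ] B} {h : X → B} (hf : Commuting f h)
    (hg : Commuting g h) : Commuting (convolve f g) h :=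
  fun ξ y => commute_convolve (fun x => hf x y) (fun x => hg x y) ξ

theorem Commuting.convolve_right {X : Type*} {f g : G →ₗ[ℂ] B} {h : X → B} (hf : Commuting h f)
    (hg : Commuting h g) : Commuting h (convolve f g) :=
  (hf.symm.convolve_left hg.symm).symm

theorem IsRep.convolve {f g : G →ₗ[ℂ] B} (hf : IsRep f) (hg : IsRep g) (h : Commuting f g) :
    IsRep (convolve f g) :=
  ⟨by rw [convolve_apply, map_one, pr_one hf hg],
   fun x y => by simp only [convolve_apply, map_mul, pr_mul hf hg h]⟩

theorem map_pr (φ : B →ₐ[ℂ] C) (f g : G →ₗ[ℂ] B) (Y : G ⊗[ℂ] G) :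
    φ (pr f g Y) = pr (φ.toLinearMap ∘ₗ f) (φ.toLinearMap ∘ₗ g) Y := by
  induction Y with
  | zero => simp
  | tmul x y => simp
  | add x y hx hy => simp only [map_add, hx, hy]

theorem map_convolve (φ : B →ₐ[ℂ] C) (f g : G →ₗ[ℂ] B) :
    φ.toLinearMap ∘ₗ convolve f g = convolve (φ.toLinearMap ∘ₗ f) (φ.toLinearMap ∘ₗ g) :=
  LinearMap.ext fun _ => map_pr φ f g _

/-- This is coassociativity: `convolve` is the product on `WithConv`, the convolution algebra of
maps from the coalgebra `G`. -/
theorem convolve_assoc (f g h : G →ₗ[ℂ] B) :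
    convolve (convolve f g) h = convolve f (convolve g h) := by
  have := mul_assoc (WithConv.toConv f) (WithConv.toConv g) (WithConv.toConv h)
  exact congrArg WithConv.ofConv this

variable (G B) in
/-- The trivial action `ξ ↦ ε(ξ)`. -/
def triv : G →ₗ[ℂ] B := Algebra.linearMap ℂ B ∘ₗ (ε G).toLinearMap

theorem triv_apply (ξ : G) : triv G B ξ = algebraMap ℂ B (ε G ξ) := rfl

theorem isRep_triv : IsRep (triv G B) := IsRep.ofAlgHom ((Algebra.ofId ℂ B).comp (ε G))

theorem commute_triv (ξ : G) (x : B) : Commute (triv G B ξ) x := Algebra.commutes _ _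

theorem triv_convolve (f : G →ₗ[ℂ] B) : convolve (triv G B) f = f :=
  congrArg WithConv.ofConv (one_mul (WithConv.toConv f))

theorem convolve_triv (f : G →ₗ[ℂ] B) : convolve f (triv G B) = f :=
  congrArg WithConv.ofConv (mul_one (WithConv.toConv f))

theorem map_triv (φ : B →ₐ[ℂ] C) : φ.toLinearMap ∘ₗ triv G B = triv G C :=
  LinearMap.ext fun ξ => by simp [triv_apply]

/-- The map `x ⊗ y ⊗ z ↦ f(x) g(y) h(z)`. -/
def pr₃ (f g h : G →ₗ[ℂ] B) : G ⊗[ℂ] (G ⊗[ℂ] G) →ₗ[ℂ] B :=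
  LinearMap.mul' ℂ B ∘ₗ TensorProduct.map f (pr g h)

@[simp] theorem pr₃_tmul (f g h : G →ₗ[ℂ] B) (x y z : G) :
    pr₃ f g h (x ⊗ₜ (y ⊗ₜ z)) = f x * (g y * h z) := rfl

theorem pr₃_mul {f g h : G →ₗ[ℂ] B} (hf : IsRep f) (hg : IsRep g) (hh : IsRep h)
    (hfg : Commuting f g) (hfh : Commuting f h) (hgh : Commuting g h)
    (X Y : G ⊗[ℂ] (G ⊗[ℂ] G)) : pr₃ f g h (X * Y) = pr₃ f g h X * pr₃ f g h Y := by
  have hc : ∀ x y, Commute (hf.hom x) (Algebra.TensorProduct.lift hg.hom hh.hom hgh y) := by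
    intro x y
    induction y with
    | zero => simp
    | tmul y z => exact (hfg x y).mul_right (hfh x z)
    | add y z hy hz => rw [map_add]; exact hy.add_right hz
  have : pr₃ f g h = (Algebra.TensorProduct.lift hf.hom
      (Algebra.TensorProduct.lift hg.hom hh.hom hgh) hc).toLinearMap := by
    ext x y z; rfl
  rw [this]
  exact map_mul (Algebra.TensorProduct.lift hf.hom
      (Algebra.TensorProduct.lift hg.hom hh.hom hgh) hc) X Y

theorem pr₃_leg13 {f g h : G →ₗ[ℂ] B} (hg : IsRep g) (Y : G ⊗[ℂ] G) :
    pr₃ f g h (leg13 Y) = pr f h Y := by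
  induction Y with
  | zero => simp
  | tmul x y => simp [leg13, hg.one]
  | add x y hx hy => simp only [map_add, hx, hy]

theorem pr₃_leg12 {f g h : G →ₗ[ℂ] B} (hh : IsRep h) (Y : G ⊗[ℂ] G) :
    pr₃ f g h (leg12 Y) = pr f g Y := by
  induction Y with
  | zero => simp
  | tmul x y => simp [leg12, hh.one]
  | add x y hx hy => simp only [map_add, hx, hy]

theorem pr₃_leg23 {f g h : G →ₗ[ℂ] B} (hf : IsRep f) (Y : G ⊗[ℂ] G) :
    pr₃ f g h (leg23 Y) = pr g h Y := by
  induction Y with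
  | zero => simp
  | tmul x y => simp [leg23, hf.one]
  | add x y hx hy => simp only [map_add, hx, hy]

theorem pr₃_comul (f g h : G →ₗ[ℂ] B) (Y : G ⊗[ℂ] G) :
    pr₃ f g h (Algebra.TensorProduct.map (AlgHom.id ℂ G) (Δ G) Y) = pr f (convolve g h) Y := by
  induction Y with
  | zero => simp
  | tmul x y => rfl
  | add x y hx hy => simp only [map_add, hx, hy]

theorem pr₃_comulAux (f g h : G →ₗ[ℂ] B) (Y : G ⊗[ℂ] G) :
    pr₃ f g h (comulAux Y) = pr (convolve f g) h Y := by
  induction Y with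
  | zero => simp
  | tmul x y =>
    simp only [comulAux, AlgHom.comp_apply, Algebra.TensorProduct.map_tmul, pr_tmul,
      convolve_apply, AlgHom.coe_id, id_eq]
    induction Δ G x with
    | zero => simp
    | tmul a b => exact (mul_assoc _ _ _).symm
    | add a b ha hb => simp only [map_add, TensorProduct.add_tmul, add_mul, ha, hb]
  | add x y hx hy => simp only [map_add, hx, hy]

theorem convolve_swap {f g : G →ₗ[ℂ] B} (h : Commuting f g) (ξ : G) :
    convolve g f ξ = pr f g (flip G (Δ G ξ)) := by
  rw [convolve_apply, pr_flip h.symm]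

namespace RibbonStructure

variable (H : RibbonStructure G)

/-- `R` with its two factors represented by `f` and `g`. -/
def rr (f g : G →ₗ[ℂ] B) : B := pr f g (H.R : G ⊗[ℂ] G)

/-- `R⁻¹` with its two factors represented by `f` and `g`. -/
def ri (f g : G →ₗ[ℂ] B) : B := pr f g (↑H.R⁻¹ : G ⊗[ℂ] G)

variable {f g h : G →ₗ[ℂ] B}

theorem map_rr (φ : B →ₐ[ℂ] C) (f g : G →ₗ[ℂ] B) :
    φ (H.rr f g) = H.rr (φ.toLinearMap ∘ₗ f) (φ.toLinearMap ∘ₗ g) := map_pr φ f g _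

theorem map_ri (φ : B →ₐ[ℂ] C) (f g : G →ₗ[ℂ] B) :
    φ (H.ri f g) = H.ri (φ.toLinearMap ∘ₗ f) (φ.toLinearMap ∘ₗ g) := map_pr φ f g _

theorem rr_mul_ri (hf : IsRep f) (hg : IsRep g) (hfg : Commuting f g) :
    H.rr f g * H.ri f g = 1 := by
  rw [rr, ri, ← pr_mul hf hg hfg, Units.mul_inv, pr_one hf hg]

theorem ri_mul_rr (hf : IsRep f) (hg : IsRep g) (hfg : Commuting f g) :
    H.ri f g * H.rr f g = 1 := by
  rw [rr, ri, ← pr_mul hf hg hfg, Units.inv_mul, pr_one hf hg]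

/-- `R` represented by `f` and `g`, as a unit. -/
def ru (hf : IsRep f) (hg : IsRep g) (hfg : Commuting f g) : Bˣ :=
  ⟨H.rr f g, H.ri f g, H.rr_mul_ri hf hg hfg, H.ri_mul_rr hf hg hfg⟩

theorem commute_rr {X : B} (hf : ∀ x, Commute (f x) X) (hg : ∀ x, Commute (g x) X) :
    Commute (H.rr f g) X := commute_pr hf hg _

theorem commute_ri {X : B} (hf : ∀ x, Commute (f x) X) (hg : ∀ x, Commute (g x) X) :
    Commute (H.ri f g) X := commute_pr hf hg _

theorem rr_convolve_right (hf : IsRep f) (hg : IsRep g) (hh : IsRep h)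
    (hfg : Commuting f g) (hfh : Commuting f h) (hgh : Commuting g h) :
    H.rr f (convolve g h) = H.rr f h * H.rr f g := by
  rw [rr, ← pr₃_comul, H.id_comul_R, pr₃_mul hf hg hh hfg hfh hgh, pr₃_leg13 hg, pr₃_leg12 hh]
  rfl

theorem rr_convolve_left (hf : IsRep f) (hg : IsRep g) (hh : IsRep h)
    (hfg : Commuting f g) (hfh : Commuting f h) (hgh : Commuting g h) :
    H.rr (convolve f g) h = H.rr f h * H.rr g h := by
  rw [rr, ← pr₃_comulAux, H.comul_id_R, pr₃_mul hf hg hh hfg hfh hgh, pr₃_leg13 hg, pr₃_leg23 hf]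
  rfl

theorem ri_convolve_right (hf : IsRep f) (hg : IsRep g) (hh : IsRep h)
    (hfg : Commuting f g) (hfh : Commuting f h) (hgh : Commuting g h) :
    H.ri f (convolve g h) = H.ri f g * H.ri f h := by
  refine left_inv_eq_right_inv (H.ri_mul_rr hf (hg.convolve hh hgh) (hfg.convolve_right hfh)) ?_
  rw [H.rr_convolve_right hf hg hh hfg hfh hgh, mul_assoc, ← mul_assoc (H.rr f g),
    H.rr_mul_ri hf hg hfg, one_mul, H.rr_mul_ri hf hh hfh]

theorem rr_mul_convolve (hf : IsRep f) (hg : IsRep g) (hfg : Commuting f g) (ξ : G) :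
    H.rr f g * convolve f g ξ = convolve g f ξ * H.rr f g := by
  rw [convolve_swap hfg, convolve_apply, rr, ← pr_mul hf hg hfg, ← pr_mul hf hg hfg, H.R_comul]

theorem convolve_mul_ri (hf : IsRep f) (hg : IsRep g) (hfg : Commuting f g) (ξ : G) :
    convolve f g ξ * H.ri f g = H.ri f g * convolve g f ξ := by
  have h1 := H.rr_mul_convolve hf hg hfg ξ
  calc _ = (H.ri f g * H.rr f g) * convolve f g ξ * H.ri f g := by
        rw [H.ri_mul_rr hf hg hfg, one_mul]
    _ = H.ri f g * (convolve g f ξ * H.rr f g) * H.ri f g := by rw [mul_assoc (H.ri f g), h1]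
    _ = _ := by simp only [mul_assoc, H.rr_mul_ri hf hg hfg, mul_one]

/-- The product `R_{fh} R_{gh}` is `R` with `f ∗ g` in its first leg. Moving `R_{fg}` through it
replaces `f ∗ g` by `g ∗ f`, which expands in the opposite order. -/
theorem yang_baxter (hf : IsRep f) (hg : IsRep g) (hh : IsRep h)
    (hfg : Commuting f g) (hfh : Commuting f h) (hgh : Commuting g h) :
    H.rr f g * (H.rr f h * H.rr g h) = H.rr g h * (H.rr f h * H.rr f g) := by
  rw [← H.rr_convolve_left hf hg hh hfg hfh hgh, ← mul_assoc (H.rr g h),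
    ← H.rr_convolve_left hg hf hh hfg.symm hgh hfh]
  exact (pr_intertwine (fun x => (H.rr_mul_convolve hf hg hfg x).symm)
    (fun x => (H.commute_rr (fun y => hfh y x) (fun y => hgh y x)).symm) _).symm

theorem rr_mul_rr (hf : IsRep f) (hg : IsRep g) (hfg : Commuting f g) :
    H.rr g f * H.rr f g = f H.v * g H.v * convolve f g (↑H.v⁻¹ : G) := by
  have h := congrArg (pr f g) H.v_factor
  rw [pr_mul hf hg hfg, pr_mul hf hg hfg, pr_flip hfg.symm] at h
  exact h

/-- The trivial action is idempotent under convolution, so the rule for `(Δ ⊗ id)(R)` makes this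
element idempotent. Being invertible, it is `1`. -/
theorem rr_triv_left (hf : IsRep f) : H.rr (triv G B) f = 1 := by
  have c : ∀ {k : G →ₗ[ℂ] B}, Commuting (triv G B) k := fun ξ y => commute_triv ξ _
  have h := H.rr_convolve_left isRep_triv isRep_triv hf c c c
  rw [triv_convolve] at h
  have h2 := congrArg (· * H.ri (triv G B) f) h
  simp only [mul_assoc, H.rr_mul_ri isRep_triv hf c, mul_one] at h2
  exact h2.symm

theorem rr_triv_right (hf : IsRep f) : H.rr f (triv G B) = 1 := by
  have c : ∀ {k : G →ₗ[ℂ] B}, Commuting k (triv G B) := fun ξ y => (commute_triv _ _).symm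
  have h := H.rr_convolve_right hf isRep_triv isRep_triv c c c
  rw [triv_convolve] at h
  have h2 := congrArg (· * H.ri f (triv G B)) h
  simp only [mul_assoc, H.rr_mul_ri hf isRep_triv c, mul_one] at h2
  exact h2.symm

theorem ri_triv_right (hf : IsRep f) : H.ri f (triv G B) = 1 := by
  have h := H.rr_mul_ri hf isRep_triv (fun ξ y => (commute_triv y (f ξ)).symm)
  rwa [H.rr_triv_right hf, one_mul] at h

end RibbonStructure

end Calculus

/-! ### Placing elements in tensor factors -/

section Slots

variable {G : Type u} [Ring G] [HopfAlgebra ℂ G]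
variable {A : Type*} [Ring A] [Algebra ℂ A] {B : Type*} [Ring B] [Algebra ℂ B]

variable (A) in
/-- The embedding `x ↦ x ⊗ 1` of `G` in `G ⊗ A`. -/
def aux : G →ₗ[ℂ] G ⊗[ℂ] A :=
  (Algebra.TensorProduct.includeLeft : G →ₐ[ℂ] G ⊗[ℂ] A).toLinearMap

/-- A map with values in `A`, regarded as a map with values in `G ⊗ A`. -/
def up (f : G →ₗ[ℂ] A) : G →ₗ[ℂ] G ⊗[ℂ] A :=
  (Algebra.TensorProduct.includeRight : A →ₐ[ℂ] G ⊗[ℂ] A).toLinearMap ∘ₗ f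

variable (A) in
/-- The embedding of `G` as the first factor of `G ⊗ G ⊗ A`. -/
def slot₁ : G →ₗ[ℂ] G ⊗[ℂ] (G ⊗[ℂ] A) := aux (G ⊗[ℂ] A)

variable (A) in
/-- The embedding of `G` as the second factor of `G ⊗ G ⊗ A`. -/
def slot₂ : G →ₗ[ℂ] G ⊗[ℂ] (G ⊗[ℂ] A) := up (aux A)

/-- A map with values in `A`, regarded as a map with values in `G ⊗ G ⊗ A`. -/
def upp (f : G →ₗ[ℂ] A) : G →ₗ[ℂ] G ⊗[ℂ] (G ⊗[ℂ] A) := up (up f)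

theorem aux_apply (x : G) : aux A x = x ⊗ₜ[ℂ] (1 : A) := rfl
theorem up_apply (f : G →ₗ[ℂ] A) (x : G) : up f x = (1 : G) ⊗ₜ[ℂ] f x := rfl
theorem slot₁_apply (x : G) : slot₁ A x = x ⊗ₜ[ℂ] (1 : G ⊗[ℂ] A) := rfl
theorem slot₂_apply (x : G) : slot₂ A x = (1 : G) ⊗ₜ[ℂ] (x ⊗ₜ[ℂ] (1 : A)) := rfl
theorem upp_apply (f : G →ₗ[ℂ] A) (x : G) :
    upp f x = (1 : G) ⊗ₜ[ℂ] ((1 : G) ⊗ₜ[ℂ] f x) := rfl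

theorem isRep_aux : IsRep (aux (G := G) A) := IsRep.ofAlgHom _
theorem IsRep.up {f : G →ₗ[ℂ] A} (h : IsRep f) : IsRep (up f) := h.comp _
theorem isRep_slot₁ : IsRep (slot₁ (G := G) A) := isRep_aux
theorem isRep_slot₂ : IsRep (slot₂ (G := G) A) := isRep_aux.up
theorem IsRep.upp {f : G →ₗ[ℂ] A} (h : IsRep f) : IsRep (upp f) := h.up.up

theorem commuting_aux_up (f : G →ₗ[ℂ] A) : Commuting (aux (G := G) A) (up f) := fun x y => by
  simp [Commute, SemiconjBy, aux_apply, up_apply]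

theorem commute_aux_inr (x : G) (a : A) : Commute (aux A x) ((1 : G) ⊗ₜ[ℂ] a) := by
  simp [Commute, SemiconjBy, aux_apply]

theorem Commuting.up {f g : G →ₗ[ℂ] A} (h : Commuting f g) : Commuting (up f) (up g) :=
  fun x y => by
    simp [Commute, SemiconjBy, up_apply, (h x y).eq]

theorem commuting_slot₁_slot₂ : Commuting (slot₁ (G := G) A) (slot₂ A) := commuting_aux_up _
theorem commuting_slot₁_upp (f : G →ₗ[ℂ] A) : Commuting (slot₁ (G := G) A) (upp f) :=
  commuting_aux_up _
theorem commuting_slot₂_upp (f : G →ₗ[ℂ] A) : Commuting (slot₂ (G := G) A) (upp f) :=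
  (commuting_aux_up f).up

theorem commute_slot₁_leg23 (x : G) (X : G ⊗[ℂ] A) : Commute (slot₁ A x) (leg23 X) :=
  commute_aux_inr x X

theorem commute_slot₂_leg13 (x : G) (X : G ⊗[ℂ] A) : Commute (slot₂ A x) (leg13 X) := by
  induction X with
  | zero => simp
  | tmul y a => simp [Commute, SemiconjBy, slot₂_apply, leg13]
  | add y z hy hz => rw [map_add]; exact hy.add_right hz

theorem leg13_up (f : G →ₗ[ℂ] A) (x : G) : leg13 (up f x) = upp f x := rfl
theorem leg23_up (f : G →ₗ[ℂ] A) (x : G) : leg23 (up f x) = upp f x := rfl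

theorem leg13_pr (f : G →ₗ[ℂ] A) (Y : G ⊗[ℂ] G) :
    leg13 (pr (aux A) (up f) Y) = pr (slot₁ A) (upp f) Y := map_pr leg13 _ _ Y
theorem leg23_pr (f : G →ₗ[ℂ] A) (Y : G ⊗[ℂ] G) :
    leg23 (pr (aux A) (up f) Y) = pr (slot₂ A) (upp f) Y := map_pr leg23 _ _ Y
theorem leg13_convolve (f : G →ₗ[ℂ] A) (ξ : G) :
    leg13 (convolve (aux A) (up f) ξ) = convolve (slot₁ A) (upp f) ξ := leg13_pr _ _
theorem leg23_convolve (f : G →ₗ[ℂ] A) (ξ : G) :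
    leg23 (convolve (aux A) (up f) ξ) = convolve (slot₂ A) (upp f) ξ := leg23_pr _ _

theorem leg12_eq (Y : G ⊗[ℂ] G) : leg12 Y = pr (slot₁ A) (slot₂ A) Y := by
  induction Y with
  | zero => simp
  | tmul x y => simp [leg12, slot₁_apply, slot₂_apply]
  | add x y hx hy => simp only [map_add, hx, hy]

theorem leg12_flip (Y : G ⊗[ℂ] G) : leg12 (flip G Y) = pr (slot₂ A) (slot₁ A) Y := by
  rw [leg12_eq, pr_flip commuting_slot₁_slot₂.symm]

theorem lTensor_eq (f : G →ₗ[ℂ] A) (Y : G ⊗[ℂ] G) :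
    LinearMap.lTensor G f Y = pr (aux A) (up f) Y := by
  induction Y with
  | zero => simp
  | tmul x y => simp [aux_apply, up_apply]
  | add x y hx hy => simp only [map_add, hx, hy]

theorem map_id_eq (f : G →ₐ[ℂ] A) (Y : G ⊗[ℂ] G) :
    Algebra.TensorProduct.map (AlgHom.id ℂ G) f Y = pr (aux A) (up f.toLinearMap) Y :=
  lTensor_eq f.toLinearMap Y

variable (G) in
/-- The homomorphism `id ⊗ φ`. -/
abbrev amp (φ : A →ₐ[ℂ] B) : G ⊗[ℂ] A →ₐ[ℂ] G ⊗[ℂ] B :=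
  Algebra.TensorProduct.map (AlgHom.id ℂ G) φ

theorem amp_comp_aux (φ : A →ₐ[ℂ] B) : (amp G φ).toLinearMap ∘ₗ aux A = aux B :=
  LinearMap.ext fun x => by simp [aux_apply]

theorem amp_aux (φ : A →ₐ[ℂ] B) (x : G) : amp G φ (aux A x) = aux B x := by simp [aux_apply]

theorem amp_comp_up (φ : A →ₐ[ℂ] B) (f : G →ₗ[ℂ] A) :
    (amp G φ).toLinearMap ∘ₗ up f = up (φ.toLinearMap ∘ₗ f) :=
  LinearMap.ext fun x => by simp [up_apply]

theorem amp_up (φ : A →ₐ[ℂ] B) (f : G →ₗ[ℂ] A) (x : G) :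
    amp G φ (up f x) = up (φ.toLinearMap ∘ₗ f) x := by simp [up_apply]

theorem amp_pr (φ : A →ₐ[ℂ] B) (f : G →ₗ[ℂ] A) (Y : G ⊗[ℂ] G) :
    amp G φ (pr (aux A) (up f) Y) = pr (aux B) (up (φ.toLinearMap ∘ₗ f)) Y := by
  rw [map_pr, amp_comp_aux, amp_comp_up]

theorem amp_comp {C : Type*} [Ring C] [Algebra ℂ C] (ψ : B →ₐ[ℂ] C) (φ : A →ₐ[ℂ] B)
    (X : G ⊗[ℂ] A) : amp G (ψ.comp φ) X = amp G ψ (amp G φ X) := by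
  induction X with
  | zero => simp
  | tmul x y => simp
  | add x y hx hy => simp only [map_add, hx, hy]

theorem leg13_amp (φ : A →ₐ[ℂ] B) (X : G ⊗[ℂ] A) :
    leg13 (amp G φ X) = amp G (amp G φ) (leg13 X) := by
  induction X with
  | zero => simp
  | tmul x y => simp [leg13]
  | add x y hx hy => simp only [map_add, hx, hy]

theorem leg23_amp (φ : A →ₐ[ℂ] B) (X : G ⊗[ℂ] A) :
    leg23 (amp G φ X) = amp G (amp G φ) (leg23 X) := by
  simp [leg23]

theorem comulAux_amp (φ : A →ₐ[ℂ] B) (X : G ⊗[ℂ] A) :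
    comulAux (amp G φ X) = amp G (amp G φ) (comulAux X) := by
  induction X with
  | zero => simp
  | tmul x y =>
    simp only [comulAux, AlgHom.comp_apply, Algebra.TensorProduct.map_tmul, AlgHom.coe_id, id_eq]
    induction Δ G x with
    | zero => simp
    | tmul a b => simp
    | add a b ha hb => simp only [map_add, TensorProduct.add_tmul, ha, hb]
  | add x y hx hy => simp only [map_add, hx, hy]

theorem leg12_amp (φ : A →ₐ[ℂ] B) (Y : G ⊗[ℂ] G) :
    amp G (amp G φ) (leg12 Y) = leg12 Y := by
  induction Y with
  | zero => simp
  | tmul x y => simp [leg12]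
  | add x y hx hy => simp only [map_add, hx, hy]

variable (G A) in
/-- The flip of the first two factors of `G ⊗ G ⊗ A`. -/
def swap : G ⊗[ℂ] (G ⊗[ℂ] A) →ₐ[ℂ] G ⊗[ℂ] (G ⊗[ℂ] A) :=
  (Algebra.TensorProduct.leftComm ℂ G G A).toAlgHom

theorem swap_leg13 (X : G ⊗[ℂ] A) : swap G A (leg13 X) = leg23 X := by
  induction X with
  | zero => simp
  | tmul y a => rfl
  | add y z hy hz => simp only [map_add, hy, hz]

theorem swap_leg23 (X : G ⊗[ℂ] A) : swap G A (leg23 X) = leg13 X := by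
  induction X with
  | zero => simp
  | tmul y a => rfl
  | add y z hy hz => simp only [map_add, hy, hz]

theorem swap_comp_slot₁ : (swap G A).toLinearMap ∘ₗ slot₁ A = slot₂ A := rfl
theorem swap_comp_slot₂ : (swap G A).toLinearMap ∘ₗ slot₂ A = slot₁ A := rfl
theorem swap_pr₁₂ (Y : G ⊗[ℂ] G) :
    swap G A (pr (slot₁ A) (slot₂ A) Y) = pr (slot₂ A) (slot₁ A) Y := by
  rw [map_pr, swap_comp_slot₁, swap_comp_slot₂]
theorem swap_pr₂₁ (Y : G ⊗[ℂ] G) :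
    swap G A (pr (slot₂ A) (slot₁ A) Y) = pr (slot₁ A) (slot₂ A) Y := by
  rw [map_pr, swap_comp_slot₁, swap_comp_slot₂]

theorem comulAux_tmul (x : G) (a : A) :
    comulAux (x ⊗ₜ[ℂ] a) = convolve (slot₁ A) (slot₂ A) x * (1 ⊗ₜ[ℂ] (1 ⊗ₜ[ℂ] a)) := by
  rw [convolve_apply, ← leg12_eq]
  simp only [comulAux, AlgHom.comp_apply, Algebra.TensorProduct.map_tmul, AlgHom.coe_id, id_eq]
  induction Δ G x with
  | zero => simp
  | tmul a b => simp [leg12]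
  | add a b ha hb => simp only [map_add, TensorProduct.add_tmul, ha, hb, add_mul]

theorem comulAux_aux (x : G) : comulAux (aux A x) = convolve (slot₁ A) (slot₂ A) x := by
  rw [aux_apply, comulAux_tmul]
  exact mul_one _

theorem comulAux_up (f : G →ₗ[ℂ] A) (x : G) : comulAux (up f x) = upp f x := by
  rw [up_apply, comulAux_tmul, (isRep_slot₁.convolve isRep_slot₂ commuting_slot₁_slot₂).one,
    one_mul, upp_apply]

theorem comulAux_pr (f : G →ₗ[ℂ] A) (Y : G ⊗[ℂ] G) :
    comulAux (pr (aux A) (up f) Y) = pr (convolve (slot₁ A) (slot₂ A)) (upp f) Y := by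
  have h1 : comulAux.toLinearMap ∘ₗ aux A = convolve (slot₁ (G := G) A) (slot₂ A) :=
    LinearMap.ext comulAux_aux
  have h2 : comulAux.toLinearMap ∘ₗ up f = upp f := LinearMap.ext (comulAux_up f)
  rw [map_pr, h1, h2]

namespace RibbonStructure

variable (H : RibbonStructure G)

/-- `R` in the first two factors of `G ⊗ G ⊗ A`. -/
theorem leg12_R : leg12 (H.R : G ⊗[ℂ] G) = H.rr (slot₁ A) (slot₂ A) := leg12_eq _

theorem swap_r₁₂ : swap G A (H.rr (slot₁ A) (slot₂ A)) = H.rr (slot₂ A) (slot₁ A) := swap_pr₁₂ _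
theorem swap_r₂₁ : swap G A (H.rr (slot₂ A) (slot₁ A)) = H.rr (slot₁ A) (slot₂ A) := swap_pr₂₁ _

theorem rr_mul_comulAux (X : G ⊗[ℂ] A) :
    H.rr (slot₁ A) (slot₂ A) * comulAux X
      = swap G A (comulAux X) * H.rr (slot₁ A) (slot₂ A) := by
  induction X with
  | zero => simp
  | tmul x a =>
    have hc : Commute (H.rr (slot₁ A) (slot₂ A))
        ((1 : G) ⊗ₜ[ℂ] ((1 : G) ⊗ₜ[ℂ] a) : G ⊗[ℂ] (G ⊗[ℂ] A)) :=
      H.commute_rr (fun y => by simp [Commute, SemiconjBy, slot₁_apply])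
        (fun y => by simp [Commute, SemiconjBy, slot₂_apply])
    rw [comulAux_tmul, map_mul, ← mul_assoc,
      H.rr_mul_convolve isRep_slot₁ isRep_slot₂ commuting_slot₁_slot₂, mul_assoc, hc.eq,
      ← mul_assoc]
    congr 2
    exact (map_pr (swap G A) (slot₁ A) (slot₂ A) _).symm
  | add x y hx hy => simp only [map_add, mul_add, add_mul, hx, hy]

end RibbonStructure

end Slots

/-! ### Components and the universal property of `K_N` -/

section Universal

variable {G : Type u} [Ring G] [HopfAlgebra ℂ G]
variable {A : Type*} [Ring A] [Algebra ℂ A] {B : Type*} [Ring B] [Algebra ℂ B]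

theorem component_tmul (π : Module.Dual ℂ G) (x : G) (a : A) :
    component π (x ⊗ₜ[ℂ] a) = π x • a := rfl

theorem component_amp (φ : A →ₐ[ℂ] B) (π : Module.Dual ℂ G) (X : G ⊗[ℂ] A) :
    component π (amp G φ X) = φ (component π X) := by
  induction X with
  | zero => simp
  | tmul x a => simp [component_tmul]
  | add x y hx hy => simp only [map_add, hx, hy]

variable [Module.Finite ℂ G]

theorem universal_component (X : G ⊗[ℂ] A) :
    universal (fun i => component ((basis G).coord i) X) = X := by
  unfold universal
  induction X with
  | zero => simp
  | tmul x a =>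
    simp only [component_tmul, ← TensorProduct.smul_tmul]
    rw [← TensorProduct.sum_tmul]
    congr 1
    exact (basis G).sum_repr x
  | add x y hx hy => simp only [map_add, TensorProduct.tmul_add, Finset.sum_add_distrib, hx, hy]

theorem component_ext {X Y : G ⊗[ℂ] A} (h : ∀ π, component π X = component π Y) : X = Y := by
  rw [← universal_component X, ← universal_component Y]
  simp only [h]

theorem component_universal (π : Module.Dual ℂ G) (a : Fin (Module.finrank ℂ G) → A) :
    component π (universal a) = ∑ i, π (basis G i) • a i := by
  simp [universal, component_tmul]

theorem amp_universal (φ : A →ₐ[ℂ] B) (a : Fin (Module.finrank ℂ G) → A) :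
    amp G φ (universal a) = universal fun i => φ (a i) := by
  simp [universal]

namespace RibbonStructure

variable (H : RibbonStructure G) {N : ℕ}

theorem amp_proj_J (n : ZMod N) : amp G (H.proj N) (Free.J n) = H.J n := rfl

/-- The current `J_n⁻¹`. -/
def Jinv (n : ZMod N) : G ⊗[ℂ] H.K N := amp G (H.proj N) (Free.Jinv n)

theorem proj_rel {x y : Free G N} (h : H.Rel N x y) : H.proj N x = H.proj N y :=
  RingQuot.mkAlgHom_rel ℂ h

theorem J_mul_Jinv (n : ZMod N) : H.J n * H.Jinv n = 1 :=
  component_ext fun π => by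
    have := H.proj_rel (Rel.inv_right n π)
    rwa [← component_amp, ← component_amp, map_mul, map_one] at this

theorem Jinv_mul_J (n : ZMod N) : H.Jinv n * H.J n = 1 :=
  component_ext fun π => by
    have := H.proj_rel (Rel.inv_left n π)
    rwa [← component_amp, ← component_amp, map_mul, map_one] at this

/-- The current `J_n` as a unit. -/
def Ju (n : ZMod N) : (G ⊗[ℂ] H.K N)ˣ := ⟨H.J n, H.Jinv n, H.J_mul_Jinv n, H.Jinv_mul_J n⟩

theorem amp_proj_siteAux (n : ZMod N) (ξ : G) :
    amp G (H.proj N) (Free.siteAux n ξ) = up (H.site n).toLinearMap ξ := by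
  simp [Free.siteAux, up_apply]; rfl

theorem amp_proj_comulSite (n : ZMod N) (ξ : G) :
    amp G (H.proj N) (Free.comulSite n ξ) = convolve (aux _) (up (H.site n).toLinearMap) ξ := by
  rw [Free.comulSite, lTensor_eq, amp_pr]; rfl

theorem cov (n m : ZMod N) (ξ : G) :
    (if m = n - 1 then convolve (aux _) (up (H.site m).toLinearMap) ξ
      else up (H.site m).toLinearMap ξ) * H.J n
    = H.J n * (if m = n then convolve (aux _) (up (H.site m).toLinearMap) ξ
      else up (H.site m).toLinearMap ξ) :=
  component_ext fun π => by
    have := H.proj_rel (Rel.cov n m ξ π)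
    simpa only [← component_amp, map_mul, apply_ite (amp G (H.proj N)), amp_proj_comulSite,
      amp_proj_siteAux, amp_proj_J] using this

theorem site_commute {n m : ZMod N} (h : n ≠ m) (ξ η : G) :
    Commute (H.site n ξ) (H.site m η) := by
  have := H.proj_rel (Rel.site_comm n m ξ η h)
  rwa [map_mul, map_mul] at this

theorem funct (n : ZMod N) :
    leg13 (H.J n) * leg12 (H.adj n n) * leg23 (H.J n)
      = H.rr (slot₁ _) (slot₂ _) * comulAux (H.J n) := by
  rw [← leg12_R]
  exact component_ext fun π₁ => component_ext fun π₂ => by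
    have := H.proj_rel (Rel.funct n π₁ π₂)
    simpa only [← component_amp, map_mul, ← leg13_amp, ← leg23_amp, ← comulAux_amp, leg12_amp,
      amp_proj_J] using this

theorem braid {n m : ZMod N} (h : n ≠ m) :
    leg13 (H.J n) * leg12 (H.adj n m) * leg23 (H.J m)
      = leg23 (H.J m) * leg12 (flip G (H.adj m n)) * leg13 (H.J n) :=
  component_ext fun π₁ => component_ext fun π₂ => by
    have := H.proj_rel (Rel.braid n m π₁ π₂ h)
    simpa only [← component_amp, map_mul, ← leg13_amp, ← leg23_amp, leg12_amp,
      amp_proj_J] using this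

/-- The homomorphism on `K_N` induced by one on the free algebra. -/
def descend (φ : Free G N →ₐ[ℂ] A) (h : ∀ ⦃x y⦄, H.Rel N x y → φ x = φ y) : H.K N →ₐ[ℂ] A :=
  RingQuot.liftAlgHom ℂ ⟨φ, h⟩

theorem descend_comp_proj (φ : Free G N →ₐ[ℂ] A) (h : ∀ ⦃x y⦄, H.Rel N x y → φ x = φ y) :
    (H.descend φ h).comp (H.proj N) = φ :=
  AlgHom.ext fun x => RingQuot.liftAlgHom_mkAlgHom_apply ℂ φ h x

theorem hom_ext_proj {D D' : H.K N →ₐ[ℂ] A} (h : D.comp (H.proj N) = D'.comp (H.proj N)) :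
    D = D' := RingQuot.ringQuot_ext' ℂ D D' h

/-- The components of `J_n⁻¹` are generators of their own, which is why the images of the currents
are given as units. -/
theorem exists_lift (J : ZMod N → (G ⊗[ℂ] A)ˣ) (f : ZMod N → G →ₗ[ℂ] A)
    (rep : ∀ n, IsRep (f n)) (comm : ∀ n m, n ≠ m → Commuting (f n) (f m))
    (cov : ∀ n m ξ, (if m = n - 1 then convolve (aux _) (up (f m)) ξ else up (f m) ξ) * J n
      = J n * (if m = n then convolve (aux _) (up (f m)) ξ else up (f m) ξ))
    (funct : ∀ n, leg13 (J n : G ⊗[ℂ] A) * leg12 (H.adj n n) * leg23 (J n : G ⊗[ℂ] A)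
      = H.rr (slot₁ _) (slot₂ _) * comulAux (J n : G ⊗[ℂ] A))
    (braid : ∀ n m, n ≠ m → leg13 (J n : G ⊗[ℂ] A) * leg12 (H.adj n m) * leg23 (J m : G ⊗[ℂ] A)
      = leg23 (J m : G ⊗[ℂ] A) * leg12 (flip G (H.adj m n)) * leg13 (J n : G ⊗[ℂ] A)) :
    ∃ D : H.K N →ₐ[ℂ] A, (∀ n, amp G D (H.J n) = J n) ∧ ∀ n ξ, D (H.site n ξ) = f n ξ := by
  let φ : Free G N →ₐ[ℂ] A := FreeAlgebra.lift ℂ fun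
    | Gen.link n i => component ((basis G).coord i) (J n : G ⊗[ℂ] A)
    | Gen.linkInv n i => component ((basis G).coord i) (↑(J n)⁻¹ : G ⊗[ℂ] A)
    | Gen.site n i => f n (basis G i)
  have hJ : ∀ n, amp G φ (Free.J n) = J n := fun n => by
    rw [Free.J, amp_universal, ← universal_component (J n : G ⊗[ℂ] A)]
    simp [φ]
  have hJinv : ∀ n, amp G φ (Free.Jinv n) = (↑(J n)⁻¹ : G ⊗[ℂ] A) := fun n => by
    rw [Free.Jinv, amp_universal, ← universal_component (↑(J n)⁻¹ : G ⊗[ℂ] A)]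
    simp [φ]
  have hs : ∀ n, φ.toLinearMap ∘ₗ Free.site n = f n := fun n =>
    (basis G).ext fun i => by
      simp [φ, Free.site]
  have hs' : ∀ n ξ, φ (Free.site n ξ) = f n ξ := fun n ξ => LinearMap.congr_fun (hs n) ξ
  have haux : ∀ n ξ, amp G φ (Free.siteAux n ξ) = up (f n) ξ := fun n ξ => by
    simp [Free.siteAux, up_apply, hs']
  have hcom : ∀ n ξ, amp G φ (Free.comulSite n ξ) = convolve (aux _) (up (f n)) ξ := fun n ξ => by
    rw [Free.comulSite, lTensor_eq, amp_pr, hs]; rfl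
  have hrel : ∀ ⦃x y⦄, H.Rel N x y → φ x = φ y := by
    intro x y h
    induction h with
    | site_one n => rw [hs', (rep n).one, map_one]
    | site_mul n ξ η => rw [map_mul φ, hs', hs', hs', (rep n).mul]
    | site_comm n m ξ η h => rw [map_mul, map_mul, hs', hs']; exact comm n m h ξ η
    | inv_right n π =>
      rw [← component_amp, ← component_amp, map_mul, hJ, hJinv, Units.mul_inv, map_one (amp G φ)]
    | inv_left n π =>
      rw [← component_amp, ← component_amp, map_mul, hJ, hJinv, Units.inv_mul, map_one (amp G φ)]
    | cov n m ξ π =>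
      simp only [← component_amp, map_mul, apply_ite (amp G φ), hcom, haux, hJ, cov]
    | funct n π₁ π₂ =>
      simp only [← component_amp, map_mul, ← leg13_amp, ← leg23_amp, ← comulAux_amp, leg12_amp,
        hJ, funct]
      rw [leg12_R]
    | braid n m π₁ π₂ h =>
      simp only [← component_amp, map_mul, ← leg13_amp, ← leg23_amp, leg12_amp, hJ, braid n m h]
  refine ⟨H.descend φ hrel, fun n => ?_, fun n ξ => ?_⟩
  · rw [← amp_proj_J, ← amp_comp, H.descend_comp_proj, hJ]
  · exact (AlgHom.congr_fun (H.descend_comp_proj φ hrel) (Free.site n ξ)).trans (hs' n ξ)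

/-- Agreement on `J_n` forces agreement on the components of `J_n⁻¹`, because inverses in `G ⊗ A`
are unique. -/
theorem hom_ext {D D' : H.K N →ₐ[ℂ] A} (hJ : ∀ n, amp G D (H.J n) = amp G D' (H.J n))
    (hs : ∀ n ξ, D (H.site n ξ) = D' (H.site n ξ)) : D = D' := by
  have hJi : ∀ n, amp G D (H.Jinv n) = amp G D' (H.Jinv n) := fun n =>
    left_inv_eq_right_inv (a := amp G D (H.J n))
      (by rw [← map_mul, H.Jinv_mul_J, map_one])
      (by rw [hJ, ← map_mul, H.J_mul_Jinv, map_one])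
  refine H.hom_ext_proj (FreeAlgebra.hom_ext (funext fun x => ?_))
  have comp : ∀ (a : Fin (Module.finrank ℂ G) → Free G N) i,
      component ((basis G).coord i) (universal a) = a i := fun a i => by
    rw [component_universal]
    simp [Finsupp.single_apply]
  change D.comp (H.proj N) (FreeAlgebra.ι ℂ x) = D'.comp (H.proj N) (FreeAlgebra.ι ℂ x)
  cases x with
  | link n i =>
    have := congrArg (component ((basis G).coord i)) (hJ n)
    simpa only [← amp_proj_J, ← amp_comp, component_amp, Free.J, comp] using this
  | linkInv n i =>
    have := congrArg (component ((basis G).coord i)) (hJi n)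
    simpa only [Jinv, ← amp_comp, component_amp, Free.Jinv, comp] using this
  | site n i =>
    have := hs n (basis G i)
    have h2 : H.site n (basis G i) = H.proj N (FreeAlgebra.ι ℂ (Gen.site n i)) := by
      change H.proj N (Free.site n (basis G i)) = _
      simp [Free.site]
    rwa [h2] at this

end RibbonStructure

end Universal

/-! ### Systems of currents and systems of holonomies -/

section Systems

variable {G : Type u} [Ring G] [HopfAlgebra ℂ G]
variable {A : Type*} [Ring A] [Algebra ℂ A] {B : Type*} [Ring B] [Algebra ℂ B]

/-- A unit of `G ⊗ A` placed in the first and third factor of `G ⊗ G ⊗ A`. -/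
def l₁₃ : (G ⊗[ℂ] A)ˣ →* (G ⊗[ℂ] (G ⊗[ℂ] A))ˣ := Units.map (leg13 (G := G) (A := A) : _ →* _)

/-- A unit of `G ⊗ A` placed in the second and third factor of `G ⊗ G ⊗ A`. -/
def l₂₃ : (G ⊗[ℂ] A)ˣ →* (G ⊗[ℂ] (G ⊗[ℂ] A))ˣ := Units.map (leg23 (G := G) (A := A) : _ →* _)

/-- The coproduct applied to the first factor of a unit of `G ⊗ A`. -/
def cm : (G ⊗[ℂ] A)ˣ →* (G ⊗[ℂ] (G ⊗[ℂ] A))ˣ := Units.map (comulAux (G := G) (A := A) : _ →* _)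

/-- The flip of the first two factors on units of `G ⊗ G ⊗ A`. -/
def sw : (G ⊗[ℂ] (G ⊗[ℂ] A))ˣ →* (G ⊗[ℂ] (G ⊗[ℂ] A))ˣ := Units.map (swap G A : _ →* _)

@[simp] theorem coe_l₁₃ (X : (G ⊗[ℂ] A)ˣ) : (l₁₃ X : G ⊗[ℂ] (G ⊗[ℂ] A)) = leg13 (X : G ⊗[ℂ] A) :=
  rfl
@[simp] theorem coe_l₂₃ (X : (G ⊗[ℂ] A)ˣ) : (l₂₃ X : G ⊗[ℂ] (G ⊗[ℂ] A)) = leg23 (X : G ⊗[ℂ] A) :=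
  rfl
@[simp] theorem coe_cm (X : (G ⊗[ℂ] A)ˣ) : (cm X : G ⊗[ℂ] (G ⊗[ℂ] A)) = comulAux (X : G ⊗[ℂ] A) :=
  rfl
@[simp] theorem coe_sw (X : (G ⊗[ℂ] (G ⊗[ℂ] A))ˣ) :
    (sw X : G ⊗[ℂ] (G ⊗[ℂ] A)) = swap G A (X : G ⊗[ℂ] (G ⊗[ℂ] A)) := rfl

@[simp] theorem sw_l₁₃ (X : (G ⊗[ℂ] A)ˣ) : sw (l₁₃ X) = l₂₃ X := Units.ext (swap_leg13 _)
@[simp] theorem sw_l₂₃ (X : (G ⊗[ℂ] A)ˣ) : sw (l₂₃ X) = l₁₃ X := Units.ext (swap_leg23 _)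

namespace RibbonStructure

variable (H : RibbonStructure G)

variable (A) in
/-- `R` in the first two factors of `G ⊗ G ⊗ A`. -/
def r₁₂ : (G ⊗[ℂ] (G ⊗[ℂ] A))ˣ := H.ru isRep_slot₁ isRep_slot₂ commuting_slot₁_slot₂

variable (A) in
/-- `R'` in the first two factors of `G ⊗ G ⊗ A`. -/
def r₂₁ : (G ⊗[ℂ] (G ⊗[ℂ] A))ˣ := H.ru isRep_slot₂ isRep_slot₁ commuting_slot₁_slot₂.symm

variable (A) in
/-- The ribbon element in the first factor of `G ⊗ A`. -/
def va : (G ⊗[ℂ] A)ˣ :=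
  Units.map (Algebra.TensorProduct.includeLeft : G →ₐ[ℂ] G ⊗[ℂ] A) H.v

theorem coe_r₁₂ : (H.r₁₂ A : G ⊗[ℂ] (G ⊗[ℂ] A)) = H.rr (slot₁ A) (slot₂ A) := rfl
theorem coe_r₂₁ : (H.r₂₁ A : G ⊗[ℂ] (G ⊗[ℂ] A)) = H.rr (slot₂ A) (slot₁ A) := rfl
@[simp] theorem sw_r₁₂ : sw (H.r₁₂ A) = H.r₂₁ A := Units.ext H.swap_r₁₂
@[simp] theorem sw_r₂₁ : sw (H.r₂₁ A) = H.r₁₂ A := Units.ext H.swap_r₂₁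

theorem r₁₂_mul_cm (X : (G ⊗[ℂ] A)ˣ) : H.r₁₂ A * cm X = sw (cm X) * H.r₁₂ A :=
  Units.ext (H.rr_mul_comulAux _)

theorem commute_aux_v (X : G ⊗[ℂ] A) : Commute (aux A (H.v : G)) X := by
  induction X with
  | zero => simp
  | tmul x a => simp [Commute, SemiconjBy, aux_apply, H.v_central]
  | add x y hx hy => exact hx.add_right hy

theorem commute_slot₂_v (X : G ⊗[ℂ] (G ⊗[ℂ] A)) : Commute (slot₂ A (H.v : G)) X := by
  induction X with
  | zero => simp
  | tmul x a =>
    simp only [Commute, SemiconjBy, slot₂_apply, Algebra.TensorProduct.tmul_mul_tmul, one_mul,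
      mul_one]
    exact congrArg _ (H.commute_aux_v a)
  | add x y hx hy => exact hx.add_right hy

theorem va_comm (X : (G ⊗[ℂ] A)ˣ) : Commute (H.va A) X := Units.ext (H.commute_aux_v _)
theorem l₁₃_va_comm (X : (G ⊗[ℂ] (G ⊗[ℂ] A))ˣ) : Commute (l₁₃ (H.va A)) X :=
  Units.ext (H.commute_aux_v _)
theorem l₂₃_va_comm (X : (G ⊗[ℂ] (G ⊗[ℂ] A))ˣ) : Commute (l₂₃ (H.va A)) X :=
  Units.ext (H.commute_slot₂_v _)

theorem ribbon : H.r₂₁ A * H.r₁₂ A = l₁₃ (H.va A) * l₂₃ (H.va A) * (cm (H.va A))⁻¹ := by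
  apply Units.ext
  have h1 : ((cm (H.va A))⁻¹ : (G ⊗[ℂ] (G ⊗[ℂ] A))ˣ) = cm ((H.va A)⁻¹) := (map_inv _ _).symm
  rw [h1]
  have h2 : (((H.va A)⁻¹ : (G ⊗[ℂ] A)ˣ) : G ⊗[ℂ] A) = aux A (↑H.v⁻¹ : G) := rfl
  simp only [Units.val_mul, coe_l₁₃, coe_l₂₃, coe_cm, h2, comulAux_aux, coe_r₁₂, coe_r₂₁]
  exact H.rr_mul_rr isRep_slot₁ isRep_slot₂ commuting_slot₁_slot₂

/-- Invertible currents `J_1, …, J_N` in `G ⊗ A` and actions `ι_0, …, ι_{N-1}` of `G` that satisfy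
the relations of `K_N`. -/
structure IsCurrentSystem (N : ℕ) (J : ℕ → (G ⊗[ℂ] A)ˣ) (f : ℕ → G →ₗ[ℂ] A) : Prop where
  rep : ∀ n < N, IsRep (f n)
  comm : ∀ n < N, ∀ m < N, n ≠ m → Commuting (f n) (f m)
  cov : ∀ k μ ξ, 1 ≤ k → k ≤ N → μ < N →
    (if μ + 1 = k then convolve (aux A) (up (f μ)) ξ else up (f μ) ξ) * (J k : G ⊗[ℂ] A)
      = J k * (if μ = k ∨ (k = N ∧ μ = 0) then convolve (aux A) (up (f μ)) ξ else up (f μ) ξ)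
  funct : ∀ k, 1 ≤ k → k ≤ N →
    l₁₃ (J k) * (if N = 1 then H.r₁₂ A else 1) * l₂₃ (J k) = H.r₁₂ A * cm (J k)
  braid : ∀ k l, 1 ≤ k → k < l → l ≤ N →
    l₁₃ (J k) * (if l = k + 1 then H.r₁₂ A else 1) * l₂₃ (J l)
      = l₂₃ (J l) * (if k = 1 ∧ l = N then H.r₂₁ A else 1) * l₁₃ (J k)

/-- Invertible holonomies `U_0 = v, U_1, …, U_{N-1}, U_N = M` in `G ⊗ A` and actions
`ι_0, …, ι_{N-1}` of `G` that satisfy the relations between the holonomies of a lattice of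
length `N`. -/
structure IsHolonomySystem (N : ℕ) (U : ℕ → (G ⊗[ℂ] A)ˣ) (f : ℕ → G →ₗ[ℂ] A) : Prop where
  rep : ∀ n < N, IsRep (f n)
  comm : ∀ n < N, ∀ m < N, n ≠ m → Commuting (f n) (f m)
  zero : U 0 = H.va A
  tail : ∀ ν ξ, 1 ≤ ν → ν < N →
    convolve (aux A) (up (f 0)) ξ * (U ν : G ⊗[ℂ] A) = U ν * up (f 0) ξ
  tail_last : ∀ ξ, Commute (convolve (aux A) (up (f 0)) ξ) (U N : G ⊗[ℂ] A)
  head : ∀ ν ξ, 1 ≤ ν → ν < N →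
    up (f ν) ξ * (U ν : G ⊗[ℂ] A) = U ν * convolve (aux A) (up (f ν)) ξ
  other : ∀ ν μ ξ, 1 ≤ ν → ν ≤ N → 1 ≤ μ → μ < N → μ ≠ ν →
    Commute (up (f μ) ξ) (U ν : G ⊗[ℂ] A)
  funct : ∀ ν, 1 ≤ ν → ν < N → l₁₃ (U ν) * l₂₃ (U ν) = H.r₁₂ A * cm (U ν)
  funct_last : l₁₃ (U N) * H.r₁₂ A * l₂₃ (U N) = H.r₁₂ A * cm (U N)
  exch : ∀ ν μ, 1 ≤ ν → ν < μ → μ < N →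
    H.r₂₁ A * l₁₃ (U ν) * l₂₃ (U μ) = l₂₃ (U μ) * l₁₃ (U ν)
  exch_last : ∀ ν, 1 ≤ ν → ν < N →
    H.r₂₁ A * l₁₃ (U ν) * l₂₃ (U N) = l₂₃ (U N) * H.r₂₁ A * l₁₃ (U ν)

/-- The current `J_n = v U_{n-1}⁻¹ U_n`. -/
def currentOf (U : ℕ → (G ⊗[ℂ] A)ˣ) (n : ℕ) : (G ⊗[ℂ] A)ˣ := H.va A * (U (n - 1))⁻¹ * U n

/-- The holonomy `U_n = v^{1-n} J_1 ⋯ J_n`. -/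
def holonomyOf (J : ℕ → (G ⊗[ℂ] A)ˣ) : ℕ → (G ⊗[ℂ] A)ˣ
  | 0 => H.va A
  | n + 1 => (H.va A)⁻¹ * holonomyOf J n * J (n + 1)

variable {H}

/-- Flipping functoriality gives `X² X¹ = R' Δ'(X)`. Then `R' X¹ X² = R'R Δ(X) = R' Δ'(X) R`, which
is `X² X¹ R`. -/
theorem self_exch {X : (G ⊗[ℂ] A)ˣ} (h : l₁₃ X * l₂₃ X = H.r₁₂ A * cm X) :
    H.r₂₁ A * l₁₃ X * l₂₃ X = l₂₃ X * l₁₃ X * H.r₁₂ A := by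
  have h2 := congrArg sw h
  simp only [map_mul, sw_l₁₃, sw_l₂₃, sw_r₁₂] at h2
  rw [h2, mul_assoc, mul_assoc, h, H.r₁₂_mul_cm]

namespace IsHolonomySystem

variable {N : ℕ} {U : ℕ → (G ⊗[ℂ] A)ˣ} {f : ℕ → G →ₗ[ℂ] A}

theorem currentOf_one (h : H.IsHolonomySystem N U f) : H.currentOf U 1 = U 1 := by
  simp [currentOf, h.zero]

/-- `J_m` is built from `U_{m-1}⁻¹` and `U_m`. Both exchange with `U_n` after the same factor `R'`,
which therefore cancels. What survives is an `R` if `m - 1 = n`, from the exchange of `U_n` with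
itself, and an `R'` if `m = N`. -/
theorem exch_current (h : H.IsHolonomySystem N U f) {n m : ℕ} (hn : 1 ≤ n) (hnm : n < m)
    (hm : m ≤ N) :
    l₁₃ (U n) * (if m = n + 1 then H.r₁₂ A else 1) * l₂₃ (H.currentOf U m)
      = l₂₃ (H.currentOf U m) * (if m = N then H.r₂₁ A else 1) * l₁₃ (U n) := by
  have h1 : H.r₂₁ A * l₁₃ (U n) * l₂₃ (U (m - 1))
      = l₂₃ (U (m - 1)) * l₁₃ (U n) * (if m = n + 1 then H.r₁₂ A else 1) := by
    split_ifs with hm1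
    · subst hm1
      exact self_exch (h.funct n hn (by omega))
    · rw [mul_one]
      exact h.exch n (m - 1) hn (by omega) (by omega)
  have h2 : H.r₂₁ A * l₁₃ (U n) * l₂₃ (U m)
      = l₂₃ (U m) * (if m = N then H.r₂₁ A else 1) * l₁₃ (U n) := by
    split_ifs with hm1
    · subst hm1
      exact h.exch_last n hn hnm
    · rw [mul_one]
      exact h.exch n m hn hnm (by omega)
  have hv := H.l₂₃_va_comm (l₁₃ (U n) * (if m = n + 1 then H.r₁₂ A else 1))
  simp only [currentOf, map_mul, map_inv]
  generalize (if m = n + 1 then H.r₁₂ A else 1) = x at *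
  generalize (if m = N then H.r₂₁ A else 1) = y at *
  calc _ = (l₁₃ (U n) * x * l₂₃ (H.va A)) * (l₂₃ (U (m - 1)))⁻¹ * l₂₃ (U m) := by group
    _ = l₂₃ (H.va A) * (l₂₃ (U (m - 1)))⁻¹ * (l₂₃ (U (m - 1)) * l₁₃ (U n) * x)
          * (l₂₃ (U (m - 1)))⁻¹ * l₂₃ (U m) := by rw [← hv.eq]; group
    _ = l₂₃ (H.va A) * (l₂₃ (U (m - 1)))⁻¹ * (H.r₂₁ A * l₁₃ (U n) * l₂₃ (U m)) := by
        rw [← h1]; group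
    _ = _ := by rw [h2]; group

theorem isCurrentSystem (h : H.IsHolonomySystem N U f) :
    H.IsCurrentSystem N (H.currentOf U) f where
  rep := h.rep
  comm := h.comm
  cov k μ ξ hk hkN hμ := by
    have hv : ∀ X : G ⊗[ℂ] A, Commute X (H.va A : G ⊗[ℂ] A) := fun X =>
      (H.commute_aux_v X).symm
    have inv : ∀ {X Y : G ⊗[ℂ] A} {W : (G ⊗[ℂ] A)ˣ}, X * W = W * Y → Y * (↑W⁻¹ : G ⊗[ℂ] A)
        = (↑W⁻¹ : G ⊗[ℂ] A) * X := fun {X Y W} e => by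
      rw [Units.mul_inv_eq_iff_eq_mul, mul_assoc, e, Units.inv_mul_cancel_left]
    -- The exchange with `U_{k-1}` read backwards, followed by the exchange with `U_k`; the factor
    -- `v` is central.
    have fin : ∀ {X Y Z : G ⊗[ℂ] A}, 2 ≤ k → Y * (U (k - 1) : G ⊗[ℂ] A) = U (k - 1) * X →
        Y * (U k : G ⊗[ℂ] A) = U k * Z →
        X * (H.currentOf U k : G ⊗[ℂ] A) = H.currentOf U k * Z := fun {X Y Z} _ e1 e2 => by
      simp only [currentOf, Units.val_mul]
      rw [← mul_assoc, ← mul_assoc, (hv X).eq, mul_assoc (H.va A : G ⊗[ℂ] A), inv e1, mul_assoc,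
        mul_assoc, e2]
      simp only [mul_assoc]
    rcases Nat.lt_or_ge k 2 with hk2 | hk2
    · obtain rfl : k = 1 := by omega
      rw [h.currentOf_one]
      rcases Nat.eq_zero_or_pos μ with rfl | hμ0
      · rcases Nat.lt_or_ge 1 N with hN | hN
        · rw [if_pos rfl, if_neg (by omega)]
          exact h.tail 1 ξ le_rfl hN
        · obtain rfl : N = 1 := by omega
          rw [if_pos rfl, if_pos (by simp)]
          exact h.tail_last ξ
      · rw [if_neg (by omega)]
        by_cases hμ1 : μ = 1
        · subst hμ1
          rw [if_pos (by simp)]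
          exact h.head 1 ξ le_rfl hμ
        · rw [if_neg (by omega)]
          exact h.other 1 μ ξ le_rfl hkN hμ0 hμ hμ1
    · by_cases hμk : μ + 1 = k
      · obtain rfl : μ = k - 1 := by omega
        rw [if_pos hμk, if_neg (by omega)]
        exact fin hk2 (h.head (k - 1) ξ (by omega) (by omega))
          (h.other k (k - 1) ξ hk hkN (by omega) (by omega) (by omega))
      · rw [if_neg hμk]
        rcases Nat.eq_zero_or_pos μ with rfl | hμ0
        · by_cases hkN' : k = N
          · subst hkN'
            rw [if_pos (by simp)]
            exact fin hk2 (h.tail (k - 1) ξ (by omega) (by omega)) (h.tail_last ξ)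
          · rw [if_neg (by omega)]
            exact fin hk2 (h.tail (k - 1) ξ (by omega) (by omega))
              (h.tail k ξ (by omega) (by omega))
        · have e1 := h.other (k - 1) μ ξ (by omega) (by omega) hμ0 hμ (by omega)
          by_cases hμ1 : μ = k
          · subst hμ1
            rw [if_pos (by simp)]
            exact fin hk2 e1 (h.head μ ξ hμ0 hμ)
          · rw [if_neg (by omega)]
            exact fin hk2 e1 (h.other k μ ξ hk hkN hμ0 hμ hμ1)
  funct k hk hkN := by
    rcases Nat.lt_or_ge k 2 with hk2 | hk2
    · obtain rfl : k = 1 := by omega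
      rw [h.currentOf_one]
      split_ifs with hN
      · subst hN
        exact h.funct_last
      · rw [mul_one]
        exact h.funct 1 le_rfl (by omega)
    · rw [if_neg (by omega), mul_one]
      -- The inverse of `U_{k-1}²` is carried through `U_k¹`, which leaves the functoriality of
      -- `U_k`. For `k = N` the second `R'` of `exch_last` supplies, after the flip, the middle `R`
      -- needed in `funct_last`.
      have h1 : l₁₃ (U k) * (l₂₃ (U (k - 1)))⁻¹ * l₂₃ (U k)
          = (l₂₃ (U (k - 1)))⁻¹ * cm (U k) := by
        by_cases hkN' : k = N
        · subst hkN'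
          have e := congrArg sw (h.exch_last (k - 1) (by omega) (by omega))
          simp only [map_mul, sw_l₁₃, sw_l₂₃, sw_r₂₁] at e
          have e2 := h.funct_last
          calc _ = (l₂₃ (U (k - 1)))⁻¹ * (H.r₁₂ A)⁻¹
                * (H.r₁₂ A * l₂₃ (U (k - 1)) * l₁₃ (U k)) * (l₂₃ (U (k - 1)))⁻¹ * l₂₃ (U k) := by
                group
            _ = (l₂₃ (U (k - 1)))⁻¹ * (H.r₁₂ A)⁻¹ * (l₁₃ (U k) * H.r₁₂ A * l₂₃ (U k)) := by
                rw [e]; group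
            _ = _ := by rw [e2]; group
        · have e := congrArg sw (h.exch (k - 1) k (by omega) (by omega) (by omega))
          simp only [map_mul, sw_l₁₃, sw_l₂₃, sw_r₂₁] at e
          have e2 := h.funct k hk (by omega)
          calc _ = (l₂₃ (U (k - 1)))⁻¹ * (H.r₁₂ A)⁻¹
                * (H.r₁₂ A * l₂₃ (U (k - 1)) * l₁₃ (U k)) * (l₂₃ (U (k - 1)))⁻¹ * l₂₃ (U k) := by
                group
            _ = (l₂₃ (U (k - 1)))⁻¹ * (H.r₁₂ A)⁻¹ * (l₁₃ (U k) * l₂₃ (U k)) := by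
                rw [e]; group
            _ = _ := by rw [e2]; group
      have h2 := h.funct (k - 1) (by omega) (by omega)
      have h3 := self_exch h2
      have h4 := H.ribbon (A := A)
      have v1 := H.l₁₃_va_comm (A := A)
      have v2 := H.l₂₃_va_comm (A := A)
      simp only [currentOf, map_mul, map_inv]
      set X := U (k - 1)
      -- The inverses multiply in the wrong order for functoriality, and correcting this costs
      -- `(R'R)⁻¹`. Together with the two factors `v` this becomes `Δ(v)` by the ribbon identity,
      -- which is `h6`.
      have h5 : (l₁₃ X)⁻¹ * (l₂₃ X)⁻¹ = H.r₁₂ A * (cm X)⁻¹ * (H.r₂₁ A * H.r₁₂ A)⁻¹ := by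
        have e : l₂₃ X * l₁₃ X = H.r₂₁ A * (H.r₁₂ A * cm X) * (H.r₁₂ A)⁻¹ := by
          rw [← h2, ← mul_assoc, h3]; group
        rw [← mul_inv_rev, e]; group
      have h6 : l₁₃ (H.va A) * l₂₃ (H.va A) * (H.r₂₁ A * H.r₁₂ A)⁻¹ = cm (H.va A) := by
        rw [h4, mul_inv_rev, inv_inv, ← mul_assoc, ((v1 _).mul_left (v2 (cm (H.va A)))).eq,
          mul_inv_cancel_right]
      have v3 : Commute (cm (H.va A)) (cm X)⁻¹ := by
        rw [← map_inv]; exact (H.va_comm _).map cm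
      calc _ = l₁₃ (H.va A) * (l₁₃ X)⁻¹ * (l₁₃ (U k) * l₂₃ (H.va A)) * (l₂₃ X)⁻¹ * l₂₃ (U k) := by
            group
        _ = l₁₃ (H.va A) * ((l₁₃ X)⁻¹ * l₂₃ (H.va A))
              * (l₁₃ (U k) * (l₂₃ X)⁻¹ * l₂₃ (U k)) := by rw [← (v2 (l₁₃ (U k))).eq]; group
        _ = (l₁₃ (H.va A) * l₂₃ (H.va A)) * ((l₁₃ X)⁻¹ * (l₂₃ X)⁻¹) * cm (U k) := by
            rw [h1, ← (v2 (l₁₃ X)⁻¹).eq]; group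
        _ = (l₁₃ (H.va A) * l₂₃ (H.va A)) * (H.r₁₂ A * (cm X)⁻¹) * (H.r₂₁ A * H.r₁₂ A)⁻¹
              * cm (U k) := by rw [h5]; group
        _ = (H.r₁₂ A * (cm X)⁻¹) * (l₁₃ (H.va A) * l₂₃ (H.va A)) * (H.r₂₁ A * H.r₁₂ A)⁻¹
              * cm (U k) := by rw [((v1 _).mul_left (v2 (H.r₁₂ A * (cm X)⁻¹))).eq]
        _ = H.r₁₂ A * ((cm X)⁻¹ * cm (H.va A)) * cm (U k) := by rw [← h6]; group
        _ = _ := by rw [← v3.eq]; group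
  braid n m hn hnm hm := by
    have h1 := h.exch_current hn hnm hm
    rcases Nat.lt_or_ge n 2 with hn2 | hn2
    · obtain rfl : n = 1 := by omega
      rw [h.currentOf_one, h1]
      simp
    -- `J_n` is built from `U_{n-1}⁻¹` and `U_n`. The link `m` does not follow `n - 1`, so no `R`
    -- appears here, and the factor `R'` for `m = N` cancels between `U_{n-1}` and `U_n`.
    · have h2 := h.exch_current (n := n - 1) (m := m) (by omega) (by omega) hm
      rw [if_neg (by omega), mul_one] at h2
      rw [if_neg (by omega : ¬ (n = 1 ∧ m = N)), mul_one]
      have e : l₁₃ (H.currentOf U n) = l₁₃ (H.va A) * (l₁₃ (U (n - 1)))⁻¹ * l₁₃ (U n) := by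
        simp only [currentOf, map_mul, map_inv]
      have v1 := H.l₁₃_va_comm (A := A) (l₂₃ (H.currentOf U m))
      rw [e]
      generalize (if m = n + 1 then H.r₁₂ A else 1) = x at *
      generalize (if m = N then H.r₂₁ A else 1) = y at *
      generalize l₂₃ (H.currentOf U m) = w at *
      calc _ = l₁₃ (H.va A) * (l₁₃ (U (n - 1)))⁻¹ * (l₁₃ (U n) * x * w) := by group
        _ = l₁₃ (H.va A) * (l₁₃ (U (n - 1)))⁻¹ * (w * y * l₁₃ (U (n - 1)))
              * (l₁₃ (U (n - 1)))⁻¹ * l₁₃ (U n) := by rw [h1]; group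
        _ = (l₁₃ (H.va A) * w) * (l₁₃ (U (n - 1)))⁻¹ * l₁₃ (U n) := by rw [← h2]; group
        _ = _ := by rw [v1.eq]; group

end IsHolonomySystem

end RibbonStructure

end Systems

/-! ### From currents to holonomies -/

section CurrentToHolonomy

variable {G : Type u} [Ring G] [HopfAlgebra ℂ G]
variable {A : Type*} [Ring A] [Algebra ℂ A] {B : Type*} [Ring B] [Algebra ℂ B]

namespace RibbonStructure

variable {H : RibbonStructure G}

theorem holonomyOf_one (J : ℕ → (G ⊗[ℂ] A)ˣ) : H.holonomyOf J 1 = J 1 := by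
  simp [holonomyOf]

theorem currentOf_holonomyOf (J : ℕ → (G ⊗[ℂ] A)ˣ) {n : ℕ} (hn : 1 ≤ n) :
    H.currentOf (H.holonomyOf J) n = J n := by
  obtain ⟨k, rfl⟩ : ∃ k, n = k + 1 := ⟨n - 1, by omega⟩
  rw [currentOf, Nat.add_sub_cancel, holonomyOf]
  calc _ = H.va A * (((H.holonomyOf J k)⁻¹ * (H.va A)⁻¹) * H.holonomyOf J k) * J (k + 1) := by
        group
    _ = H.va A * (((H.va A)⁻¹ * (H.holonomyOf J k)⁻¹) * H.holonomyOf J k) * J (k + 1) := by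
        rw [(H.va_comm (H.holonomyOf J k)).inv_inv.eq]
    _ = _ := by group

namespace IsCurrentSystem

variable {N : ℕ} {J : ℕ → (G ⊗[ℂ] A)ˣ} {f : ℕ → G →ₗ[ℂ] A}

/-- The induction step behind all covariance relations: `U_{n+1} = v⁻¹ U_n J_{n+1}` with `v`
central, so exchange relations compose. -/
theorem holonomyOf_intertwine {n : ℕ} {X Y Z : G ⊗[ℂ] A}
    (h1 : X * (H.holonomyOf J n : G ⊗[ℂ] A) = H.holonomyOf J n * Y)
    (h2 : Y * (J (n + 1) : G ⊗[ℂ] A) = J (n + 1) * Z) :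
    X * (H.holonomyOf J (n + 1) : G ⊗[ℂ] A) = H.holonomyOf J (n + 1) * Z := by
  have hv : Commute X (↑(H.va A)⁻¹ : G ⊗[ℂ] A) := (H.commute_aux_v X).symm.units_inv_right
  simp only [holonomyOf, Units.val_mul]
  rw [← mul_assoc, ← mul_assoc, hv.eq, mul_assoc (↑(H.va A)⁻¹ : G ⊗[ℂ] A), h1, mul_assoc,
    mul_assoc, h2]
  simp only [mul_assoc]

theorem tail (h : H.IsCurrentSystem N J f) (ν : ℕ) (ξ : G) (h1 : 1 ≤ ν) (hN : ν < N) :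
    convolve (aux A) (up (f 0)) ξ * (H.holonomyOf J ν : G ⊗[ℂ] A)
      = H.holonomyOf J ν * up (f 0) ξ := by
  induction ν, h1 using Nat.le_induction with
  | base =>
    have := h.cov 1 0 ξ le_rfl (by omega) (by omega)
    rwa [if_pos rfl, if_neg (by omega), ← holonomyOf_one (H := H) J] at this
  | succ n hn ih =>
    have := h.cov (n + 1) 0 ξ (by omega) (by omega) (by omega)
    rw [if_neg (by omega), if_neg (by omega)] at this
    exact holonomyOf_intertwine (ih (by omega)) this

theorem tail_last (h : H.IsCurrentSystem N J f) (hN : 1 ≤ N) (ξ : G) :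
    Commute (convolve (aux A) (up (f 0)) ξ) (H.holonomyOf J N : G ⊗[ℂ] A) := by
  obtain ⟨k, rfl⟩ : ∃ k, N = k + 1 := ⟨N - 1, by omega⟩
  have := h.cov (k + 1) 0 ξ (by omega) le_rfl (by omega)
  rcases Nat.eq_zero_or_pos k with rfl | hk
  · rwa [if_pos rfl, if_pos (by simp), ← holonomyOf_one (H := H) J] at this
  · rw [if_neg (by omega), if_pos (by simp)] at this
    exact holonomyOf_intertwine (h.tail k ξ hk (by omega)) this

theorem other_of_lt (h : H.IsCurrentSystem N J f) (ν μ : ℕ) (ξ : G) (hν : 1 ≤ ν)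
    (hμ : μ < N) (hνμ : ν < μ) : Commute (up (f μ) ξ) (H.holonomyOf J ν : G ⊗[ℂ] A) := by
  induction ν, hν using Nat.le_induction with
  | base =>
    have := h.cov 1 μ ξ le_rfl (by omega) hμ
    rwa [if_neg (by omega), if_neg (by omega), ← holonomyOf_one (H := H) J] at this
  | succ n hn ih =>
    have := h.cov (n + 1) μ ξ (by omega) (by omega) hμ
    rw [if_neg (by omega), if_neg (by omega)] at this
    exact holonomyOf_intertwine (ih (by omega)) this

theorem head (h : H.IsCurrentSystem N J f) (ν : ℕ) (ξ : G) (hν : 1 ≤ ν) (hN : ν < N) :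
    up (f ν) ξ * (H.holonomyOf J ν : G ⊗[ℂ] A)
      = H.holonomyOf J ν * convolve (aux A) (up (f ν)) ξ := by
  have := h.cov ν ν ξ hν hN.le hN
  rw [if_neg (by omega), if_pos (by simp)] at this
  obtain ⟨k, rfl⟩ : ∃ k, ν = k + 1 := ⟨ν - 1, by omega⟩
  rcases Nat.eq_zero_or_pos k with rfl | hk
  · rwa [← holonomyOf_one (H := H) J] at this
  · exact holonomyOf_intertwine (h.other_of_lt k (k + 1) ξ hk hN (by omega)) this

/-- At an interior site the two adjacent currents compensate each other: `U_μ` turns `ι_μ` into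
`Δ_μ`, and `J_{μ+1}` turns it back. Later currents do not see the site. -/
theorem other_of_gt (h : H.IsCurrentSystem N J f) (ν μ : ℕ) (ξ : G) (hν : ν ≤ N)
    (hμ : 1 ≤ μ) (hνμ : μ < ν) : Commute (up (f μ) ξ) (H.holonomyOf J ν : G ⊗[ℂ] A) := by
  induction ν, hνμ using Nat.le_induction with
  | base =>
    have := h.cov (μ + 1) μ ξ (by omega) (by omega) (by omega)
    rw [if_pos rfl, if_neg (by omega)] at this
    exact holonomyOf_intertwine (h.head μ ξ hμ (by omega)) this
  | succ n hn ih =>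
    have := h.cov (n + 1) μ ξ (by omega) (by omega) (by omega)
    rw [if_neg (by omega), if_neg (by omega)] at this
    exact holonomyOf_intertwine (ih (by omega)) this

theorem exch_current (h : H.IsCurrentSystem N J f) (ν m : ℕ) (hν : 1 ≤ ν) (hνm : ν < m)
    (hm : m ≤ N) :
    l₁₃ (H.holonomyOf J ν) * (if m = ν + 1 then H.r₁₂ A else 1) * l₂₃ (J m)
      = l₂₃ (J m) * (if m = N then H.r₂₁ A else 1) * l₁₃ (H.holonomyOf J ν) := by
  induction ν, hν using Nat.le_induction with
  | base =>
    have := h.braid 1 m le_rfl hνm hm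
    simpa only [holonomyOf_one, true_and] using this
  | succ n hn ih =>
    have ih := ih (by omega)
    have hb := h.braid (n + 1) m (by omega) hνm hm
    rw [if_neg (by omega), mul_one] at ih
    rw [if_neg (by omega : ¬ (n + 1 = 1 ∧ m = N)), mul_one] at hb
    have v1 := H.l₁₃_va_comm (A := A) (l₂₃ (J m) * (if m = N then H.r₂₁ A else 1))
    simp only [holonomyOf, map_mul, map_inv]
    generalize (if m = n + 1 + 1 then H.r₁₂ A else 1) = x at *
    generalize (if m = N then H.r₂₁ A else 1) = y at *
    calc _ = (l₁₃ (H.va A))⁻¹ * l₁₃ (H.holonomyOf J n) * (l₁₃ (J (n + 1)) * x * l₂₃ (J m)) := by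
          group
      _ = (l₁₃ (H.va A))⁻¹ * (l₁₃ (H.holonomyOf J n) * l₂₃ (J m)) * l₁₃ (J (n + 1)) := by
          rw [hb]; group
      _ = ((l₁₃ (H.va A))⁻¹ * (l₂₃ (J m) * y)) * l₁₃ (H.holonomyOf J n) * l₁₃ (J (n + 1)) := by
          rw [ih]; group
      _ = _ := by rw [v1.inv_left.eq]; group

/-- Carrying `J¹_{n+1}` past `U²_n` produces an `R'`, and the functoriality of `U_n` and of
`J_{n+1}` produces an `R` each. One `R` stays in front, and the surplus `R'R` turns the two factors
`v⁻¹` into `Δ(v⁻¹)`. -/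
theorem funct_holonomy (h : H.IsCurrentSystem N J f) (ν : ℕ) (hν : 1 ≤ ν) (hN : ν ≤ N) :
    l₁₃ (H.holonomyOf J ν) * (if ν = N then H.r₁₂ A else 1) * l₂₃ (H.holonomyOf J ν)
      = H.r₁₂ A * cm (H.holonomyOf J ν) := by
  induction ν, hν using Nat.le_induction with
  | base =>
    have := h.funct 1 le_rfl hN
    simpa only [holonomyOf_one, eq_comm] using this
  | succ n hn ih =>
    have ih := ih (by omega)
    rw [if_neg (by omega), mul_one] at ih
    have hJ := h.funct (n + 1) (by omega) hN
    rw [if_neg (by omega), mul_one] at hJ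
    have he := congrArg sw (h.exch_current n (n + 1) hn (by omega) hN)
    rw [if_pos rfl] at he
    simp only [map_mul, sw_l₁₃, sw_l₂₃, sw_r₁₂, apply_ite sw, map_one, sw_r₂₁] at he
    have h4 := H.ribbon (A := A)
    have v1 := H.l₁₃_va_comm (A := A)
    have v2 := H.l₂₃_va_comm (A := A)
    simp only [holonomyOf, map_mul, map_inv]
    generalize H.holonomyOf J n = U at *
    generalize (if n + 1 = N then H.r₁₂ A else 1) = y at *
    have v3 : Commute (cm (H.va A))⁻¹ (cm U) := by
      rw [← map_inv]; exact (H.va_comm _).inv_left.map cm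
    have h6 : (l₁₃ (H.va A))⁻¹ * (l₂₃ (H.va A))⁻¹ * (H.r₂₁ A * H.r₁₂ A) = (cm (H.va A))⁻¹ := by
      rw [h4, (v1 (l₂₃ (H.va A))).eq]; group
    calc _ = (l₁₃ (H.va A))⁻¹ * (l₁₃ U * l₁₃ (J (n + 1)) * y * (l₂₃ (H.va A))⁻¹)
              * l₂₃ U * l₂₃ (J (n + 1)) := by group
      _ = (l₁₃ (H.va A))⁻¹ * (l₂₃ (H.va A))⁻¹ * l₁₃ U * (l₁₃ (J (n + 1)) * y * l₂₃ U)
              * l₂₃ (J (n + 1)) := by rw [← (v2 _).inv_left.eq]; group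
      _ = (l₁₃ (H.va A))⁻¹ * (l₂₃ (H.va A))⁻¹ * (l₁₃ U * l₂₃ U) * H.r₂₁ A
              * (l₁₃ (J (n + 1)) * l₂₃ (J (n + 1))) := by rw [← he]; group
      _ = ((l₁₃ (H.va A))⁻¹ * (l₂₃ (H.va A))⁻¹ * (H.r₁₂ A * cm U)) * H.r₂₁ A * H.r₁₂ A
              * cm (J (n + 1)) := by rw [ih, hJ]; group
      _ = (H.r₁₂ A * cm U) * ((l₁₃ (H.va A))⁻¹ * (l₂₃ (H.va A))⁻¹ * (H.r₂₁ A * H.r₁₂ A))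
              * cm (J (n + 1)) := by
          rw [((v1 _).inv_left.mul_left (v2 (H.r₁₂ A * cm U)).inv_left).eq]; group
      _ = H.r₁₂ A * (cm U * (cm (H.va A))⁻¹) * cm (J (n + 1)) := by rw [h6]; group
      _ = _ := by rw [← v3.eq]; group

theorem exch_holonomy (h : H.IsCurrentSystem N J f) (ν μ : ℕ) (hν : 1 ≤ ν) (hνμ : ν < μ)
    (hμ : μ ≤ N) :
    H.r₂₁ A * l₁₃ (H.holonomyOf J ν) * l₂₃ (H.holonomyOf J μ)
      = l₂₃ (H.holonomyOf J μ) * (if μ = N then H.r₂₁ A else 1) * l₁₃ (H.holonomyOf J ν) := by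
  -- Here `x` is the defect left by the holonomy `U_n`: it is `R` if `n = ν`, by `self_exch`, and
  -- `1` afterwards. The defect `y` after `J_{n+1}` is `R'` exactly when the last link has been
  -- reached.
  have step : ∀ (n : ℕ) (x y : (G ⊗[ℂ] (G ⊗[ℂ] A))ˣ) (U : (G ⊗[ℂ] A)ˣ),
      H.r₂₁ A * l₁₃ U * l₂₃ (H.holonomyOf J n) = l₂₃ (H.holonomyOf J n) * l₁₃ U * x →
      l₁₃ U * x * l₂₃ (J (n + 1)) = l₂₃ (J (n + 1)) * y * l₁₃ U →
      H.r₂₁ A * l₁₃ U * l₂₃ (H.holonomyOf J (n + 1))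
        = l₂₃ (H.holonomyOf J (n + 1)) * y * l₁₃ U := by
    intro n x y U h1 h2
    have v2 := H.l₂₃_va_comm (A := A) (H.r₂₁ A * l₁₃ U)
    simp only [holonomyOf, map_mul, map_inv]
    calc _ = (H.r₂₁ A * l₁₃ U * (l₂₃ (H.va A))⁻¹) * l₂₃ (H.holonomyOf J n) * l₂₃ (J (n + 1)) := by
          group
      _ = (l₂₃ (H.va A))⁻¹ * (H.r₂₁ A * l₁₃ U * l₂₃ (H.holonomyOf J n)) * l₂₃ (J (n + 1)) := by
          rw [← v2.inv_left.eq]; group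
      _ = (l₂₃ (H.va A))⁻¹ * l₂₃ (H.holonomyOf J n) * (l₁₃ U * x * l₂₃ (J (n + 1))) := by
          rw [h1]; group
      _ = _ := by rw [h2]; group
  induction μ, hνμ using Nat.le_induction with
  | base =>
    have hf := h.funct_holonomy ν hν (by omega)
    rw [if_neg (by omega), mul_one] at hf
    have he := h.exch_current ν (ν + 1) hν (by omega) hμ
    rw [if_pos rfl] at he
    exact step ν _ _ _ (self_exch hf) he
  | succ n hn ih =>
    have ih := ih (by omega)
    rw [if_neg (by omega), mul_one] at ih
    have he := h.exch_current ν (n + 1) hν (by omega) hμ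
    rw [if_neg (by omega)] at he
    exact step n 1 _ _ (by rw [ih, mul_one]) he

theorem isHolonomySystem (h : H.IsCurrentSystem N J f) (hN : 1 ≤ N) :
    H.IsHolonomySystem N (H.holonomyOf J) f where
  rep := h.rep
  comm := h.comm
  zero := rfl
  tail := h.tail
  tail_last := h.tail_last hN
  head := h.head
  other ν μ ξ h1 h2 h3 h4 h5 := by
    rcases Nat.lt_or_gt_of_ne h5 with h6 | h6
    · exact h.other_of_gt ν μ ξ h2 h3 h6
    · exact h.other_of_lt ν μ ξ h1 h4 h6
  funct ν h1 h2 := by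
    have := h.funct_holonomy ν h1 h2.le
    rwa [if_neg (by omega), mul_one] at this
  funct_last := by
    have := h.funct_holonomy N hN le_rfl
    rwa [if_pos rfl] at this
  exch ν μ h1 h2 h3 := by
    have := h.exch_holonomy ν μ h1 h2 h3.le
    rwa [if_neg (by omega), mul_one] at this
  exch_last ν h1 h2 := by
    have := h.exch_holonomy ν N h1 h2 le_rfl
    rwa [if_pos rfl] at this

end IsCurrentSystem

section
variable (H)

theorem leg12_adj {N : ℕ} (n m : ZMod N) :
    (leg12 (H.adj n m) : G ⊗[ℂ] (G ⊗[ℂ] A)) = (↑(if m = n + 1 then H.r₁₂ A else 1) :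
      G ⊗[ℂ] (G ⊗[ℂ] A)) := by
  unfold adj
  split_ifs
  · exact H.leg12_R
  · exact map_one leg12

theorem leg12_flip_adj {N : ℕ} (n m : ZMod N) :
    (leg12 (flip G (H.adj n m)) : G ⊗[ℂ] (G ⊗[ℂ] A)) = (↑(if m = n + 1 then H.r₂₁ A else 1) :
      G ⊗[ℂ] (G ⊗[ℂ] A)) := by
  unfold adj
  split_ifs
  · exact leg12_flip _
  · simp

end

/-! ### Transport of holonomy systems along algebra homomorphisms -/

/-- The image of a unit of `G ⊗ A` under `id ⊗ φ`. -/
def ampU (φ : A →ₐ[ℂ] B) : (G ⊗[ℂ] A)ˣ →* (G ⊗[ℂ] B)ˣ := Units.map (amp G φ : _ →* _)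

@[simp] theorem coe_ampU (φ : A →ₐ[ℂ] B) (X : (G ⊗[ℂ] A)ˣ) :
    (ampU φ X : G ⊗[ℂ] B) = amp G φ (X : G ⊗[ℂ] A) := rfl

theorem l₁₃_ampU (φ : A →ₐ[ℂ] B) (X : (G ⊗[ℂ] A)ˣ) : l₁₃ (ampU (G := G) φ X) = ampU (amp G φ) (l₁₃ X) :=
  Units.ext (leg13_amp φ _)
theorem l₂₃_ampU (φ : A →ₐ[ℂ] B) (X : (G ⊗[ℂ] A)ˣ) : l₂₃ (ampU (G := G) φ X) = ampU (amp G φ) (l₂₃ X) :=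
  Units.ext (leg23_amp φ _)
theorem cm_ampU (φ : A →ₐ[ℂ] B) (X : (G ⊗[ℂ] A)ˣ) : cm (ampU (G := G) φ X) = ampU (amp G φ) (cm X) :=
  Units.ext (comulAux_amp φ _)

theorem ampU_r₁₂ (φ : A →ₐ[ℂ] B) : ampU (amp G φ) (H.r₁₂ A) = H.r₁₂ B :=
  Units.ext (by rw [coe_ampU, coe_r₁₂, coe_r₁₂, ← leg12_R, leg12_amp, leg12_R])

theorem ampU_r₂₁ (φ : A →ₐ[ℂ] B) : ampU (amp G φ) (H.r₂₁ A) = H.r₂₁ B :=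
  Units.ext (by
    rw [coe_ampU, coe_r₂₁, coe_r₂₁, rr, rr, ← leg12_flip, ← leg12_flip, leg12_amp])

theorem ampU_va (φ : A →ₐ[ℂ] B) : ampU φ (H.va A) = H.va B := Units.ext (amp_aux φ _)

theorem amp_convolve (φ : A →ₐ[ℂ] B) (f : G →ₗ[ℂ] A) (ξ : G) :
    amp G φ (convolve (aux A) (up f) ξ) = convolve (aux B) (up (φ.toLinearMap ∘ₗ f)) ξ :=
  amp_pr φ f _

theorem IsHolonomySystem.map {N : ℕ} {U : ℕ → (G ⊗[ℂ] A)ˣ} {f : ℕ → G →ₗ[ℂ] A}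
    (h : H.IsHolonomySystem N U f) (φ : A →ₐ[ℂ] B) :
    H.IsHolonomySystem N (fun n => ampU φ (U n)) (fun n => φ.toLinearMap ∘ₗ f n) where
  rep n hn := (h.rep n hn).comp φ
  comm n hn m hm hnm x y := (h.comm n hn m hm hnm x y).map φ
  zero := by rw [h.zero, ampU_va]
  tail ν ξ h1 h2 := by
    simpa only [map_mul, amp_convolve, amp_up, coe_ampU] using congrArg (amp G φ) (h.tail ν ξ h1 h2)
  tail_last ξ := by
    simpa only [map_mul, amp_convolve, amp_up, coe_ampU] using (h.tail_last ξ).map (amp G φ)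
  head ν ξ h1 h2 := by
    simpa only [map_mul, amp_convolve, amp_up, coe_ampU] using congrArg (amp G φ) (h.head ν ξ h1 h2)
  other ν μ ξ h1 h2 h3 h4 h5 := by
    simpa only [map_mul, amp_up, coe_ampU] using (h.other ν μ ξ h1 h2 h3 h4 h5).map (amp G φ)
  funct ν h1 h2 := by
    simpa only [map_mul, l₁₃_ampU, l₂₃_ampU, cm_ampU, ampU_r₁₂, ampU_r₂₁]
      using congrArg (ampU (amp G φ)) (h.funct ν h1 h2)
  funct_last := by
    simpa only [map_mul, l₁₃_ampU, l₂₃_ampU, cm_ampU, ampU_r₁₂, ampU_r₂₁]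
      using congrArg (ampU (amp G φ)) h.funct_last
  exch ν μ h1 h2 h3 := by
    simpa only [map_mul, l₁₃_ampU, l₂₃_ampU, cm_ampU, ampU_r₁₂, ampU_r₂₁]
      using congrArg (ampU (amp G φ)) (h.exch ν μ h1 h2 h3)
  exch_last ν h1 h2 := by
    simpa only [map_mul, l₁₃_ampU, l₂₃_ampU, cm_ampU, ampU_r₁₂, ampU_r₂₁]
      using congrArg (ampU (amp G φ)) (h.exch_last ν h1 h2)

end RibbonStructure

end CurrentToHolonomy

/-! ### The holonomies of `K_N` -/

section KHolonomy

variable {G : Type u} [Ring G] [HopfAlgebra ℂ G] [Module.Finite ℂ G]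
variable {A : Type*} [Ring A] [Algebra ℂ A]

/-- Systems number sites from `0` to `N - 1` and currents from `1` to `N`. Among all these numbers
the only coincidence modulo `N` is that of `0` and `N`. -/
theorem natCast_eq_iff {N a b : ℕ} (ha : a ≤ N) (hb : b ≤ N) :
    (a : ZMod N) = b ↔ a = b ∨ (a = 0 ∧ b = N) ∨ (a = N ∧ b = 0) := by
  rw [ZMod.natCast_eq_natCast_iff']
  rcases ha.eq_or_lt with rfl | ha'
  · rcases hb.eq_or_lt with rfl | hb'
    · simp
    · rw [Nat.mod_self, Nat.mod_eq_of_lt hb']; omega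
  · rcases hb.eq_or_lt with rfl | hb'
    · rw [Nat.mod_self, Nat.mod_eq_of_lt ha']; omega
    · rw [Nat.mod_eq_of_lt ha', Nat.mod_eq_of_lt hb']; omega

theorem natCast_eq_sub_one_iff {N m k : ℕ} (hm : m < N) (hk : 1 ≤ k) (hkN : k ≤ N) :
    (m : ZMod N) = (k : ZMod N) - 1 ↔ m + 1 = k := by
  rw [eq_sub_iff_add_eq, ← Nat.cast_add_one, natCast_eq_iff hm hkN]
  omega

theorem natCast_eq_add_one_iff {N l k : ℕ} (hl : 1 ≤ l) (hlN : l ≤ N) (hk : 1 ≤ k)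
    (hkN : k ≤ N) : (l : ZMod N) = (k : ZMod N) + 1 ↔ l = k + 1 ∨ (k = N ∧ l = 1) := by
  rcases hkN.eq_or_lt with rfl | hkN'
  · rw [ZMod.natCast_self, zero_add, ← Nat.cast_one, natCast_eq_iff hlN hk]
    omega
  · rw [← Nat.cast_add_one, natCast_eq_iff hlN hkN']
    omega

/-- The representative of `n ∈ ℤ/N` between `1` and `N`. -/
def posRep {N : ℕ} (n : ZMod N) : ℕ := if n.val = 0 then N else n.val

theorem posRep_spec {N : ℕ} (hN : 1 ≤ N) (n : ZMod N) :
    1 ≤ posRep n ∧ posRep n ≤ N ∧ ((posRep n : ℕ) : ZMod N) = n := by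
  have : NeZero N := ⟨by omega⟩
  have h1 := ZMod.val_lt n
  unfold posRep
  split_ifs with h
  · refine ⟨hN, le_rfl, ?_⟩
    rw [ZMod.natCast_self]
    exact ((ZMod.val_eq_zero n).mp h).symm
  · exact ⟨by omega, h1.le, ZMod.natCast_zmod_val n⟩

namespace RibbonStructure

variable (H : RibbonStructure G)

theorem isCurrentSystem_K {N : ℕ} (hN : 1 ≤ N) :
    H.IsCurrentSystem N (fun k => H.Ju (k : ZMod N))
      (fun μ => (H.site (μ : ZMod N)).toLinearMap) where
  rep n _ := IsRep.ofAlgHom _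
  comm n hn m hm hnm x y := by
    refine H.site_commute (fun h => ?_) x y
    have := (natCast_eq_iff hn.le hm.le).mp h
    omega
  cov k μ ξ h1 h2 h3 := by
    have := H.cov (k : ZMod N) (μ : ZMod N) ξ
    simp only [natCast_eq_sub_one_iff h3 h1 h2, natCast_eq_iff h3.le h2] at this
    have e : (μ = k ∨ μ = 0 ∧ k = N ∨ μ = N ∧ k = 0) ↔ (μ = k ∨ k = N ∧ μ = 0) := by omega
    simp only [e] at this
    exact this
  funct k h1 h2 := by
    refine Units.ext ?_
    have := H.funct (k : ZMod N)
    rw [leg12_adj] at this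
    simp only [natCast_eq_add_one_iff h1 h2 h1 h2] at this
    have e : (k = k + 1 ∨ k = N ∧ k = 1) ↔ N = 1 := by omega
    simp only [e] at this
    exact this
  braid k l h1 h2 h3 := by
    refine Units.ext ?_
    have := H.braid (n := (k : ZMod N)) (m := (l : ZMod N)) (fun h => by
      have := (natCast_eq_iff (by omega) h3).mp h
      omega)
    rw [leg12_adj, leg12_flip_adj] at this
    have hl : 1 ≤ l := by omega
    have hk : k ≤ N := by omega
    simp only [natCast_eq_add_one_iff hl h3 h1 hk, natCast_eq_add_one_iff h1 hk hl h3] at this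
    have e : (l = k + 1 ∨ k = N ∧ l = 1) ↔ l = k + 1 := by omega
    have e2 : (k = l + 1 ∨ l = N ∧ k = 1) ↔ (k = 1 ∧ l = N) := by omega
    simp only [e, e2] at this
    exact this

theorem IsCurrentSystem.exists_lift {H : RibbonStructure G} {N : ℕ} {J : ℕ → (G ⊗[ℂ] A)ˣ}
    {f : ℕ → G →ₗ[ℂ] A} (h : H.IsCurrentSystem N J f) (hN : 1 ≤ N) :
    ∃ D : H.K N →ₐ[ℂ] A, (∀ k : ℕ, 1 ≤ k → k ≤ N → amp G D (H.J (k : ZMod N)) = J k) ∧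
      ∀ μ < N, ∀ ξ, D (H.site (μ : ZMod N) ξ) = f μ ξ := by
  have : NeZero N := ⟨by omega⟩
  have key : ∀ k l : ℕ, 1 ≤ k → k ≤ N → 1 ≤ l → l ≤ N → ((k : ZMod N) = l ↔ k = l) := by
    intro k l h1 h2 h3 h4
    rw [natCast_eq_iff h2 h4]; omega
  obtain ⟨D, hJ, hf⟩ := H.exists_lift (N := N) (fun n => J (posRep n)) (fun n => f n.val)
    (fun n => h.rep _ (ZMod.val_lt n))
    (fun n m hnm => h.comm _ (ZMod.val_lt n) _ (ZMod.val_lt m)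
      (fun e => hnm (ZMod.val_injective N e)))
    (fun n m ξ => by
      obtain ⟨h1, h2, h3⟩ := posRep_spec hN n
      have hm := ZMod.val_lt m
      have := h.cov (posRep n) m.val ξ h1 h2 hm
      have e1 : m = n - 1 ↔ m.val + 1 = posRep n := by
        rw [← natCast_eq_sub_one_iff hm h1 h2, h3, ZMod.natCast_zmod_val]
      have e2 : m = n ↔ (m.val = posRep n ∨ (posRep n = N ∧ m.val = 0)) := by
        have := natCast_eq_iff hm.le h2
        rw [h3, ZMod.natCast_zmod_val] at this
        rw [this]; omega
      simp only [e1, e2]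
      exact this)
    (fun n => by
      obtain ⟨h1, h2, h3⟩ := posRep_spec hN n
      have := congrArg Units.val (h.funct (posRep n) h1 h2)
      have e : n = n + 1 ↔ N = 1 := by
        have := natCast_eq_add_one_iff h1 h2 h1 h2
        rw [h3] at this
        rw [this]; omega
      rw [leg12_adj]
      simp only [e]
      exact this)
    (fun n m hnm => by
      obtain ⟨h1, h2, h3⟩ := posRep_spec hN n
      obtain ⟨h1', h2', h3'⟩ := posRep_spec hN m
      have hne : posRep n ≠ posRep m := fun e => hnm (by rw [← h3, ← h3', e])
      have e1 := natCast_eq_add_one_iff h1 h2 h1' h2'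
      have e2 := natCast_eq_add_one_iff h1' h2' h1 h2
      rw [h3, h3'] at e1 e2
      rw [leg12_adj, leg12_flip_adj]
      simp only [e1, e2]
      rcases Nat.lt_or_gt_of_ne hne with hlt | hlt
      · have := congrArg Units.val (h.braid (posRep n) (posRep m) h1 hlt h2')
        have e3 : (posRep m = posRep n + 1 ∨ posRep n = N ∧ posRep m = 1)
          ↔ posRep m = posRep n + 1 := by omega
        have e4 : (posRep n = posRep m + 1 ∨ posRep m = N ∧ posRep n = 1)
          ↔ posRep n = 1 ∧ posRep m = N := by omega
        simp only [e3, e4]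
        exact this
      -- A current system records the braid relation only for an increasing pair of links; the
      -- decreasing case is its flip, which interchanges `R` and `R'`.
      · have := congrArg sw (h.braid (posRep m) (posRep n) h1' hlt h2)
        have e3 : (posRep m = posRep n + 1 ∨ posRep n = N ∧ posRep m = 1)
          ↔ (posRep m = 1 ∧ posRep n = N) := by omega
        have e4 : (posRep n = posRep m + 1 ∨ posRep m = N ∧ posRep n = 1)
          ↔ posRep n = posRep m + 1 := by omega
        simp only [e3, e4]
        simp only [map_mul, apply_ite sw, sw_l₁₃, sw_l₂₃, sw_r₁₂, sw_r₂₁, map_one] at this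
        exact congrArg Units.val this.symm)
  refine ⟨D, fun k h1 h2 => ?_, fun μ hμ ξ => ?_⟩
  · rw [hJ]
    obtain ⟨h1', h2', h3'⟩ := posRep_spec hN (k : ZMod N)
    rw [(key _ _ h1' h2' h1 h2).mp h3']
  · rw [hf, ZMod.val_natCast_of_lt hμ]

/-- The holonomies of `K_N` as units. -/
def Uu (N : ℕ) : ℕ → (G ⊗[ℂ] H.K N)ˣ := H.holonomyOf fun k => H.Ju (k : ZMod N)

theorem isHolonomySystem_K {N : ℕ} (hN : 1 ≤ N) :
    H.IsHolonomySystem N (H.Uu N) (fun μ => (H.site (μ : ZMod N)).toLinearMap) :=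
  (H.isCurrentSystem_K hN).isHolonomySystem hN

/-- The bound on `ν` matters: at `ν = 0` truncated subtraction gives `U = 1`, whereas `Uu` starts
with `v`. -/
theorem U_eq (N : ℕ) {ν : ℕ} (hν : 1 ≤ ν) : H.U N ν = (H.Uu N ν : G ⊗[ℂ] H.K N) := by
  induction ν, hν using Nat.le_induction with
  | base => simp [U, Uu, holonomyOf_one, Ju, ← Algebra.TensorProduct.one_def]
  | succ n hn ih =>
    obtain ⟨k, rfl⟩ : ∃ k, n = k + 1 := ⟨n - 1, by omega⟩
    have e : H.U N (k + 1 + 1) = (↑(H.va (H.K N))⁻¹ : G ⊗[ℂ] H.K N) * H.U N (k + 1)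
        * H.J ((k + 1 + 1 : ℕ) : ZMod N) := by
      have : (↑(H.va (H.K N))⁻¹ : G ⊗[ℂ] H.K N) = (↑H.v⁻¹ : G) ⊗ₜ[ℂ] 1 := rfl
      rw [this, U, U, List.range_succ, List.map_append, List.prod_append, ← mul_assoc, ← mul_assoc,
        Algebra.TensorProduct.tmul_mul_tmul, one_mul, ← Units.val_mul]
      simp [pow_succ']
    rw [e, ih]
    rfl

/-- The universal property of `K_N` in the presentation by holonomies; all constructions below use
it instead of the currents. -/
theorem IsHolonomySystem.exists_lift {H : RibbonStructure G} {N : ℕ} {U : ℕ → (G ⊗[ℂ] A)ˣ}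
    {f : ℕ → G →ₗ[ℂ] A} (h : H.IsHolonomySystem N U f) (hN : 1 ≤ N) :
    ∃ D : H.K N →ₐ[ℂ] A, (∀ ν ≤ N, ampU D (H.Uu N ν) = U ν) ∧
      ∀ μ < N, ∀ ξ, D (H.site (μ : ZMod N) ξ) = f μ ξ := by
  obtain ⟨D, hJ, hf⟩ := h.isCurrentSystem.exists_lift hN
  refine ⟨D, fun ν hν => ?_, hf⟩
  induction ν with
  | zero => rw [h.zero]; exact ampU_va D
  | succ n ih =>
    have e : ampU D (H.Ju ((n + 1 : ℕ) : ZMod N)) = H.currentOf U (n + 1) :=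
      Units.ext (hJ (n + 1) (by omega) hν)
    rw [Uu, holonomyOf, map_mul, map_mul, map_inv, ampU_va, e]
    have ih := ih (by omega)
    rw [Uu] at ih
    rw [ih, currentOf, Nat.add_sub_cancel]
    calc _ = (H.va A)⁻¹ * (U n * H.va A) * (U n)⁻¹ * U (n + 1) := by group
      _ = _ := by rw [← (H.va_comm (U n)).eq]; group

theorem hom_ext_holonomy {H : RibbonStructure G} {N : ℕ} (hN : 1 ≤ N) {D D' : H.K N →ₐ[ℂ] A}
    (hU : ∀ ν, 1 ≤ ν → ν ≤ N → ampU D (H.Uu N ν) = ampU D' (H.Uu N ν))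
    (hs : ∀ μ < N, ∀ ξ, D (H.site (μ : ZMod N) ξ) = D' (H.site (μ : ZMod N) ξ)) : D = D' := by
  have : NeZero N := ⟨by omega⟩
  refine H.hom_ext (fun n => ?_) (fun n ξ => ?_)
  · obtain ⟨h1, h2, h3⟩ := posRep_spec hN n
    have hU0 : ∀ ν ≤ N, ampU D (H.Uu N ν) = ampU D' (H.Uu N ν) := fun ν hν => by
      rcases Nat.eq_zero_or_pos ν with rfl | h
      · exact (ampU_va D).trans (ampU_va D').symm
      · exact hU ν h hν
    have e := currentOf_holonomyOf (H := H) (fun k => H.Ju (k : ZMod N)) h1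
    have : ampU D (H.Ju ((posRep n : ℕ) : ZMod N)) = ampU D' (H.Ju ((posRep n : ℕ) : ZMod N)) := by
      rw [← e, currentOf]
      simp only [map_mul, map_inv, ampU_va]
      have e1 := hU0 (posRep n) h2
      have e2 := hU0 (posRep n - 1) (by omega)
      rw [Uu] at e1 e2
      rw [e1, e2]
    rw [h3] at this
    exact congrArg Units.val this
  · have := hs n.val (ZMod.val_lt n) ξ
    rwa [ZMod.natCast_zmod_val] at this

end RibbonStructure

end KHolonomy

/-! ### Concatenation of systems of holonomies -/

section Concat

variable {G : Type u} [Ring G] [HopfAlgebra ℂ G]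
variable {A : Type*} [Ring A] [Algebra ℂ A]

namespace RibbonStructure

variable {H : RibbonStructure G}

variable (H) in
/-- `R` with its second factor represented by `f`, as a unit of `G ⊗ A`. -/
def rf {f : G →ₗ[ℂ] A} (h : IsRep f) : (G ⊗[ℂ] A)ˣ := H.ru isRep_aux h.up (commuting_aux_up f)

theorem coe_rf {f : G →ₗ[ℂ] A} (h : IsRep f) : (H.rf h : G ⊗[ℂ] A) = H.rr (aux A) (up f) := rfl

theorem coe_rf_inv {f : G →ₗ[ℂ] A} (h : IsRep f) :
    (↑(H.rf h)⁻¹ : G ⊗[ℂ] A) = H.ri (aux A) (up f) := rfl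

theorem coe_l₁₃_rf {f : G →ₗ[ℂ] A} (h : IsRep f) :
    (l₁₃ (H.rf h) : G ⊗[ℂ] (G ⊗[ℂ] A)) = H.rr (slot₁ A) (upp f) := leg13_pr f _

theorem coe_l₂₃_rf {f : G →ₗ[ℂ] A} (h : IsRep f) :
    (l₂₃ (H.rf h) : G ⊗[ℂ] (G ⊗[ℂ] A)) = H.rr (slot₂ A) (upp f) := leg23_pr f _

section

variable {f : G →ₗ[ℂ] A} (h : IsRep f)
include h

theorem cm_rf : cm (H.rf h) = l₁₃ (H.rf h) * l₂₃ (H.rf h) := by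
  refine Units.ext ?_
  rw [Units.val_mul, coe_l₁₃_rf, coe_l₂₃_rf, ← H.rr_convolve_left isRep_slot₁ isRep_slot₂ h.upp
    commuting_slot₁_slot₂ (commuting_slot₁_upp f) (commuting_slot₂_upp f)]
  exact comulAux_pr f _

theorem yang_baxter_rf :
    H.r₁₂ A * l₁₃ (H.rf h) * l₂₃ (H.rf h) = l₂₃ (H.rf h) * l₁₃ (H.rf h) * H.r₁₂ A := by
  refine Units.ext ?_
  have := H.yang_baxter isRep_slot₁ isRep_slot₂ h.upp
    commuting_slot₁_slot₂ (commuting_slot₁_upp f) (commuting_slot₂_upp f)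
  simpa only [Units.val_mul, coe_l₁₃_rf, coe_l₂₃_rf, coe_r₁₂, mul_assoc] using this

/-- The product `R_{1f} R_{12}` is `R` with `Δ` applied to its second leg, now occupied by the
factor `2` and `f` jointly. A monodromy commutes with this joint action. -/
theorem rf_exch_last {X : (G ⊗[ℂ] A)ˣ}
    (hX : ∀ ξ, Commute (convolve (aux A) (up f) ξ) (X : G ⊗[ℂ] A)) :
    l₁₃ (H.rf h) * H.r₁₂ A * l₂₃ X = l₂₃ X * l₁₃ (H.rf h) * H.r₁₂ A := by
  refine Units.ext ?_
  have e := H.rr_convolve_right isRep_slot₁ isRep_slot₂ h.upp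
    commuting_slot₁_slot₂ (commuting_slot₁_upp f) (commuting_slot₂_upp f)
  simp only [Units.val_mul, coe_l₁₃_rf, coe_r₁₂, mul_assoc]
  rw [← e, ← mul_assoc, ← e]
  refine pr_intertwine (fun x => commute_slot₁_leg23 x _) (fun ξ => ?_) _
  rw [← leg23_convolve]
  exact (hX ξ).map leg23

/-- As for a monodromy, except that a shorter holonomy turns the joint action into `f` alone, so
that the factor `R'` disappears on the right. -/
theorem rf_exch {X : (G ⊗[ℂ] A)ˣ}
    (hX : ∀ ξ, convolve (aux A) (up f) ξ * (X : G ⊗[ℂ] A) = X * up f ξ) :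
    l₂₃ (H.rf h) * H.r₂₁ A * l₁₃ X = l₁₃ X * l₂₃ (H.rf h) := by
  refine Units.ext ?_
  have e := H.rr_convolve_right isRep_slot₂ isRep_slot₁ h.upp
    commuting_slot₁_slot₂.symm (commuting_slot₂_upp f) (commuting_slot₁_upp f)
  simp only [Units.val_mul, coe_l₂₃_rf, coe_r₂₁]
  rw [← e]
  refine pr_intertwine (fun x => commute_slot₂_leg13 x _) (fun ξ => ?_) _
  rw [← leg13_convolve, ← leg13_up]
  have := congrArg leg13 (hX ξ)
  rwa [map_mul, map_mul] at this

/-- The effect of `N_-` on a monodromy: the `R` in the middle of the twisted functoriality is moved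
to the far right, by one exchange with `X` and one Yang-Baxter move. -/
theorem funct_twist {X : (G ⊗[ℂ] A)ˣ}
    (hX : ∀ ξ, Commute (convolve (aux A) (up f) ξ) (X : G ⊗[ℂ] A))
    (hf : l₁₃ X * H.r₁₂ A * l₂₃ X = H.r₁₂ A * cm X) :
    l₁₃ (X * (H.rf h)⁻¹) * l₂₃ (X * (H.rf h)⁻¹) * H.r₁₂ A = H.r₁₂ A * cm (X * (H.rf h)⁻¹) := by
  have e1 := rf_exch_last (H := H) h hX
  have e2 := yang_baxter_rf (H := H) h
  have e3 := cm_rf (H := H) h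
  simp only [map_mul, map_inv, e3]
  generalize l₁₃ (H.rf h) = p at *
  generalize l₂₃ (H.rf h) = q at *
  calc _ = l₁₃ X * p⁻¹ * (l₂₃ X * p * H.r₁₂ A) * (H.r₁₂ A)⁻¹ * p⁻¹ * q⁻¹ * H.r₁₂ A := by group
    _ = (l₁₃ X * H.r₁₂ A * l₂₃ X) * (q * p * H.r₁₂ A)⁻¹ * H.r₁₂ A := by rw [← e1]; group
    _ = _ := by rw [hf, ← e2]; group

theorem rf_exch_twist {X : (G ⊗[ℂ] A)ˣ}
    (hX : ∀ ξ, Commute (convolve (aux A) (up f) ξ) (X : G ⊗[ℂ] A)) :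
    l₁₃ (H.rf h) * H.r₁₂ A * l₂₃ (X * (H.rf h)⁻¹)
      = l₂₃ (X * (H.rf h)⁻¹) * H.r₁₂ A * l₁₃ (H.rf h) := by
  have e1 := rf_exch_last (H := H) h hX
  have e2 := yang_baxter_rf (H := H) h
  simp only [map_mul, map_inv]
  generalize l₁₃ (H.rf h) = p at *
  generalize l₂₃ (H.rf h) = q at *
  calc _ = (p * H.r₁₂ A * l₂₃ X) * q⁻¹ := by group
    _ = l₂₃ X * q⁻¹ * (q * p * H.r₁₂ A) * q⁻¹ := by rw [e1]; group
    _ = _ := by rw [← e2]; group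

/-- The inverse of `R_{2f}` cancels the second factor `R'` in the exchange of a holonomy with the
monodromy. Hence `M N_-` exchanges like an ordinary longer holonomy. -/
theorem exch_twist {X Y : (G ⊗[ℂ] A)ˣ}
    (hY : ∀ ξ, convolve (aux A) (up f) ξ * (Y : G ⊗[ℂ] A) = Y * up f ξ)
    (hf : H.r₂₁ A * l₁₃ Y * l₂₃ X = l₂₃ X * H.r₂₁ A * l₁₃ Y) :
    H.r₂₁ A * l₁₃ Y * l₂₃ (X * (H.rf h)⁻¹) = l₂₃ (X * (H.rf h)⁻¹) * l₁₃ Y := by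
  have e1 := rf_exch (H := H) h hY
  simp only [map_mul, map_inv]
  generalize l₂₃ (H.rf h) = q at *
  calc _ = (H.r₂₁ A * l₁₃ Y * l₂₃ X) * q⁻¹ := by group
    _ = l₂₃ X * q⁻¹ * (q * H.r₂₁ A * l₁₃ Y) * q⁻¹ := by rw [hf]; group
    _ = _ := by rw [e1]; group

end

theorem self_exch_twist {X : (G ⊗[ℂ] A)ˣ} (hf : l₁₃ X * l₂₃ X * H.r₁₂ A = H.r₁₂ A * cm X) :
    H.r₂₁ A * l₁₃ X * l₂₃ X = l₂₃ X * l₁₃ X * H.r₂₁ A := by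
  have e := congrArg sw hf
  simp only [map_mul, sw_l₁₃, sw_l₂₃, sw_r₁₂] at e
  have e2 := H.r₁₂_mul_cm X
  calc _ = H.r₂₁ A * (l₁₃ X * l₂₃ X * H.r₁₂ A) * (H.r₁₂ A)⁻¹ := by group
    _ = H.r₂₁ A * sw (cm X) := by rw [hf, e2]; group
    _ = _ := by rw [e]

/-- Two systems of holonomies and sites commute with each other. -/
structure SystemsCommute (M N : ℕ) (Ua Ub : ℕ → (G ⊗[ℂ] A)ˣ) (fa fb : ℕ → G →ₗ[ℂ] A) : Prop where
  ff : ∀ n < M, ∀ m < N, Commuting (fa n) (fb m)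
  fU : ∀ n < M, ∀ ν ≤ N, ∀ ξ, Commute (up (fa n) ξ) (Ub ν : G ⊗[ℂ] A)
  Uf : ∀ ν ≤ M, ∀ m < N, ∀ ξ, Commute (up (fb m) ξ) (Ua ν : G ⊗[ℂ] A)
  UU : ∀ ν ≤ M, ∀ μ ≤ N, Commute (l₁₃ (Ua ν)) (l₂₃ (Ub μ))

variable (H) in
/-- The holonomies of the concatenation of two lattices. -/
def concatU (M N : ℕ) (Ua Ub : ℕ → (G ⊗[ℂ] A)ˣ) {a : G →ₗ[ℂ] A} (ha : IsRep a) (ν : ℕ) :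
    (G ⊗[ℂ] A)ˣ :=
  if ν < M then Ua ν
  else if ν + 1 < M + N then Ua M * (H.rf ha)⁻¹ * Ub (ν - M + 1)
  else Ua M * (H.rf ha)⁻¹ * Ub N * H.rf ha

/-- The site actions of the concatenation of two lattices. -/
def concatF (M : ℕ) (fa fb : ℕ → G →ₗ[ℂ] A) (μ : ℕ) : G →ₗ[ℂ] A :=
  if μ = 0 then convolve (fa 0) (fb 0) else if μ < M then fa μ else fb (μ - M + 1)

theorem up_convolve (f g : G →ₗ[ℂ] A) : up (convolve f g) = convolve (up f) (up g) :=
  map_convolve _ f g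

/-- The element `P = M^α N^α_-` carries a holonomy of the second lattice back to the site `0` of the
glued one. Each relation is reduced to relations of the two parts by moving `P` and `ρ` past pieces
of the other lattice. -/
theorem isHolonomySystem_concat {L M N : ℕ} (hL : L + 1 = M + N) (hM : 1 ≤ M) (hN : 1 ≤ N)
    {Ua Ub : ℕ → (G ⊗[ℂ] A)ˣ} {fa fb : ℕ → G →ₗ[ℂ] A} (ha : H.IsHolonomySystem M Ua fa)
    (hb : H.IsHolonomySystem N Ub fb) (hc : SystemsCommute M N Ua Ub fa fb) :
    H.IsHolonomySystem L (H.concatU M N Ua Ub (ha.rep 0 hM)) (concatF M fa fb) := by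
  have h0 := ha.rep 0 hM
  have hk0 := hb.rep 0 hN
  obtain ⟨ρ, hρ⟩ : ∃ ρ, ρ = H.rf h0 := ⟨_, rfl⟩
  obtain ⟨P, hP⟩ : ∃ P, P = Ua M * ρ⁻¹ := ⟨_, rfl⟩
  have u1 : ∀ ν, ν < M → H.concatU M N Ua Ub h0 ν = Ua ν := fun ν h => by simp [concatU, h]
  have u2 : ∀ κ, 1 ≤ κ → κ < N → H.concatU M N Ua Ub h0 (M - 1 + κ) = P * Ub κ := fun κ h h' => by
    rw [concatU, if_neg (by omega), if_pos (by omega), hP, hρ]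
    congr 2; omega
  have u3 : H.concatU M N Ua Ub h0 L = P * Ub N * ρ := by
    rw [concatU, if_neg (by omega), if_neg (by omega), hP, hρ]
  have f0 : concatF M fa fb 0 = convolve (fa 0) (fb 0) := if_pos rfl
  have f1 : ∀ μ, 1 ≤ μ → μ < M → concatF M fa fb μ = fa μ := fun μ h h' => by
    rw [concatF, if_neg (by omega), if_pos h']
  have f2 : ∀ κ, 1 ≤ κ → κ < N → concatF M fa fb (M - 1 + κ) = fb κ := fun κ h h' => by
    rw [concatF, if_neg (by omega), if_neg (by omega)]
    congr 1; omega
  have split : ∀ ν, ν < M ∨ ν ≥ L ∨ ∃ κ, 1 ≤ κ ∧ κ < N ∧ ν = M - 1 + κ := fun ν => by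
    rcases Nat.lt_or_ge ν M with h | h
    · exact Or.inl h
    · rcases Nat.lt_or_ge ν L with h' | h'
      · exact Or.inr (Or.inr ⟨ν - M + 1, by omega, by omega, by omega⟩)
      · exact Or.inr (Or.inl h')
  -- commutation with single pieces
  have ρa : ∀ κ, 1 ≤ κ → κ < M → ∀ ξ, Commute (up (fa κ) ξ) (ρ : G ⊗[ℂ] A) := fun κ h h' ξ => by
    rw [hρ, coe_rf]
    exact (H.commute_rr (fun x => commuting_aux_up _ x ξ)
      (fun x => (ha.comm 0 hM κ h' (by omega)).up x ξ)).symm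
  have ρb : ∀ κ < N, ∀ ξ, Commute (up (fb κ) ξ) (ρ : G ⊗[ℂ] A) := fun κ h' ξ => by
    rw [hρ, coe_rf]
    exact (H.commute_rr (fun x => commuting_aux_up _ x ξ)
      (fun x => (hc.ff 0 hM κ h').up x ξ)).symm
  have Pa : ∀ κ, 1 ≤ κ → κ < M → ∀ ξ, Commute (up (fa κ) ξ) (P : G ⊗[ℂ] A) := fun κ h h' ξ => by
    rw [hP, Units.val_mul]
    exact (ha.other M κ ξ hM le_rfl h h' (by omega)).mul_right (ρa κ h h' ξ).units_inv_right
  have Pb : ∀ κ < N, ∀ ξ, Commute (up (fb κ) ξ) (P : G ⊗[ℂ] A) := fun κ h' ξ => by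
    rw [hP, Units.val_mul]
    exact (hc.Uf M le_rfl κ h' ξ).mul_right (ρb κ h' ξ).units_inv_right
  -- intertwining of the site `0`
  have tP : ∀ ξ, convolve (aux A) (convolve (up (fa 0)) (up (fb 0))) ξ * (P : G ⊗[ℂ] A)
      = P * convolve (up (fa 0)) (convolve (aux A) (up (fb 0))) ξ := fun ξ => by
    rw [← convolve_assoc, ← convolve_assoc]
    refine convolve_intertwine (fun x => ?_) (Pb 0 hN) ξ
    rw [hP, Units.val_mul, ← mul_assoc, (ha.tail_last x).eq, mul_assoc, hρ, coe_rf_inv,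
      H.convolve_mul_ri isRep_aux h0.up (commuting_aux_up _), ← mul_assoc]
  have tρ : ∀ ξ, convolve (up (fa 0)) (convolve (aux A) (up (fb 0))) ξ * (ρ : G ⊗[ℂ] A)
      = ρ * convolve (aux A) (convolve (up (fa 0)) (up (fb 0))) ξ := fun ξ => by
    rw [← convolve_assoc, ← convolve_assoc]
    refine convolve_intertwine (fun x => ?_) (ρb 0 hN) ξ
    rw [hρ, coe_rf]
    exact (H.rr_mul_convolve isRep_aux h0.up (commuting_aux_up _) x).symm
  have tU : ∀ κ, 1 ≤ κ → κ < N → ∀ ξ,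
      convolve (up (fa 0)) (convolve (aux A) (up (fb 0))) ξ * (Ub κ : G ⊗[ℂ] A)
        = Ub κ * convolve (up (fa 0)) (up (fb 0)) ξ := fun κ h h' ξ =>
    convolve_intertwine (hc.fU 0 hM κ h'.le) (fun x => hb.tail κ x h h') ξ
  have tM : ∀ ξ,
      Commute (convolve (up (fa 0)) (convolve (aux A) (up (fb 0))) ξ) (Ub N : G ⊗[ℂ] A) := fun ξ =>
    convolve_intertwine (hc.fU 0 hM N le_rfl) hb.tail_last ξ
  -- exchange relations
  have PP : l₁₃ P * l₂₃ P * H.r₁₂ A = H.r₁₂ A * cm P := by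
    rw [hP, hρ]; exact funct_twist h0 ha.tail_last ha.funct_last
  have PP' := self_exch_twist PP
  have ρP : l₁₃ ρ * H.r₁₂ A * l₂₃ P = l₂₃ P * H.r₁₂ A * l₁₃ ρ := by
    rw [hP, hρ]; exact rf_exch_twist h0 ha.tail_last
  have ρP' : l₂₃ ρ * H.r₂₁ A * l₁₃ P = l₁₃ P * H.r₂₁ A * l₂₃ ρ := by
    simpa only [map_mul, sw_l₁₃, sw_l₂₃, sw_r₁₂] using congrArg sw ρP
  have UP : ∀ ν, 1 ≤ ν → ν < M → H.r₂₁ A * l₁₃ (Ua ν) * l₂₃ P = l₂₃ P * l₁₃ (Ua ν) := by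
    intro ν h h'
    rw [hP, hρ]
    exact exch_twist h0 (fun ξ => ha.tail ν ξ h h') (ha.exch_last ν h h')
  have Uρ : ∀ ν, 1 ≤ ν → ν < M → l₂₃ ρ * H.r₂₁ A * l₁₃ (Ua ν) = l₁₃ (Ua ν) * l₂₃ ρ := by
    intro ν h h'
    rw [hρ]
    exact rf_exch h0 (fun ξ => ha.tail ν ξ h h')
  have cmρ : cm ρ = l₁₃ ρ * l₂₃ ρ := by rw [hρ]; exact cm_rf h0
  have sUU : ∀ ν ≤ M, ∀ μ ≤ N, Commute (l₂₃ (Ua ν)) (l₁₃ (Ub μ)) := fun ν h μ h' => by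
    simpa only [sw_l₁₃, sw_l₂₃] using (hc.UU ν h μ h').map sw
  have fUb : ∀ κ ≤ N, ∀ ξ, Commute (upp (fa 0) ξ) (l₁₃ (Ub κ) : G ⊗[ℂ] (G ⊗[ℂ] A)) ∧
      Commute (upp (fa 0) ξ) (l₂₃ (Ub κ) : G ⊗[ℂ] (G ⊗[ℂ] A)) := fun κ h ξ => by
    constructor
    · rw [← leg13_up]; exact (hc.fU 0 hM κ h ξ).map leg13
    · rw [← leg23_up]; exact (hc.fU 0 hM κ h ξ).map leg23
  have ρ₂U : ∀ κ ≤ N, Commute (l₂₃ ρ) (l₁₃ (Ub κ)) := fun κ h => by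
    refine Units.ext ?_
    rw [Units.val_mul, Units.val_mul, hρ, coe_l₂₃_rf]
    exact H.commute_rr (fun x => commute_slot₂_leg13 x _) (fun x => (fUb κ h x).1)
  have ρ₁U : ∀ κ ≤ N, Commute (l₁₃ ρ) (l₂₃ (Ub κ)) := fun κ h => by
    refine Units.ext ?_
    rw [Units.val_mul, Units.val_mul, hρ, coe_l₁₃_rf]
    exact H.commute_rr (fun x => commute_slot₁_leg23 x _) (fun x => (fUb κ h x).2)
  have P₁U : ∀ κ ≤ N, Commute (l₁₃ P) (l₂₃ (Ub κ)) := fun κ h => by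
    rw [hP, map_mul, map_inv]
    exact (hc.UU M le_rfl κ h).mul_left (ρ₁U κ h).inv_left
  have P₂U : ∀ κ ≤ N, Commute (l₂₃ P) (l₁₃ (Ub κ)) := fun κ h => by
    rw [hP, map_mul, map_inv]
    exact (sUU M le_rfl κ h).mul_left (ρ₂U κ h).inv_left
  refine ⟨?_, ?_, ?_, ?_, ?_, ?_, ?_, ?_, ?_, ?_, ?_⟩
  · -- rep
    intro n hn
    rcases Nat.eq_zero_or_pos n with rfl | hn0
    · rw [f0]; exact h0.convolve hk0 (hc.ff 0 hM 0 hN)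
    · rcases split n with h | h | ⟨κ, h, h', rfl⟩
      · rw [f1 n hn0 h]; exact ha.rep n h
      · omega
      · rw [f2 κ h h']; exact hb.rep κ h'
  · -- comm
    have c0 : ∀ n, 1 ≤ n → n < L → Commuting (concatF M fa fb 0) (concatF M fa fb n) := by
      intro n hn hnL
      rw [f0]
      rcases split n with h | h | ⟨κ, h, h', rfl⟩
      · rw [f1 n hn h]
        exact (ha.comm 0 hM n h (by omega)).convolve_left (hc.ff n h 0 hN).symm
      · omega
      · rw [f2 κ h h']
        exact (hc.ff 0 hM κ h').convolve_left (hb.comm 0 hN κ h' (by omega))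
    intro n hn m hm hnm
    rcases Nat.eq_zero_or_pos n with rfl | hn0
    · exact c0 m (by omega) hm
    rcases Nat.eq_zero_or_pos m with rfl | hm0
    · exact (c0 n (by omega) hn).symm
    rcases split n with h | h | ⟨κ, h, h', rfl⟩
    · rw [f1 n hn0 h]
      rcases split m with k | k | ⟨l, k, k', rfl⟩
      · rw [f1 m hm0 k]; exact ha.comm n h m k hnm
      · omega
      · rw [f2 l k k']; exact hc.ff n h l k'
    · omega
    · rw [f2 κ h h']
      rcases split m with k | k | ⟨l, k, k', rfl⟩
      · rw [f1 m hm0 k]; exact (hc.ff m k κ h').symm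
      · omega
      · rw [f2 l k k']; exact hb.comm κ h' l k' (by omega)
  · -- zero
    rw [u1 0 hM, ha.zero]
  · -- tail
    intro ν ξ hν hνL
    rw [f0, up_convolve]
    rcases split ν with h | h | ⟨κ, h, h', rfl⟩
    · rw [u1 ν h, ← convolve_assoc]
      exact convolve_intertwine (fun x => ha.tail ν x hν h) (hc.Uf ν h.le 0 hN) ξ
    · omega
    · rw [u2 κ h h', Units.val_mul, ← mul_assoc, tP, mul_assoc, tU κ h h', mul_assoc]
  · -- tail_last
    intro ξ
    rw [f0, up_convolve, u3, Units.val_mul, Units.val_mul]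
    rw [Commute, SemiconjBy, ← mul_assoc, ← mul_assoc, tP, mul_assoc (P : G ⊗[ℂ] A), (tM ξ).eq]
    simp only [mul_assoc, tρ]
  · -- head
    intro ν ξ hν hνL
    rcases split ν with h | h | ⟨κ, h, h', rfl⟩
    · rw [u1 ν h, f1 ν hν h]; exact ha.head ν ξ hν h
    · omega
    · rw [u2 κ h h', f2 κ h h', Units.val_mul, ← mul_assoc, (Pb κ h' ξ).eq, mul_assoc,
        hb.head κ ξ h h', mul_assoc]
  · -- other
    intro ν μ ξ hν hνL hμ hμL hne
    rcases split μ with k | k | ⟨l, k, k', rfl⟩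
    · rw [f1 μ hμ k]
      rcases split ν with h | h | ⟨κ, h, h', rfl⟩
      · rw [u1 ν h]; exact ha.other ν μ ξ hν h.le hμ k hne
      · obtain rfl : ν = L := le_antisymm hνL h
        rw [u3, Units.val_mul, Units.val_mul]
        exact ((Pa μ hμ k ξ).mul_right (hc.fU μ k N le_rfl ξ)).mul_right (ρa μ hμ k ξ)
      · rw [u2 κ h h', Units.val_mul]
        exact (Pa μ hμ k ξ).mul_right (hc.fU μ k κ h'.le ξ)
    · omega
    · rw [f2 l k k']
      rcases split ν with h | h | ⟨κ, h, h', rfl⟩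
      · rw [u1 ν h]; exact hc.Uf ν h.le l k' ξ
      · obtain rfl : ν = L := le_antisymm hνL h
        rw [u3, Units.val_mul, Units.val_mul]
        exact ((Pb l k' ξ).mul_right (hb.other N l ξ hN le_rfl k k' (by omega))).mul_right
          (ρb l k' ξ)
      · rw [u2 κ h h', Units.val_mul]
        exact (Pb l k' ξ).mul_right (hb.other κ l ξ h h'.le k k' (by omega))
  · -- funct
    intro ν hν hνL
    rcases split ν with h | h | ⟨κ, h, h', rfl⟩
    · rw [u1 ν h]; exact ha.funct ν hν h
    · omega
    · rw [u2 κ h h', map_mul, map_mul, map_mul]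
      calc _ = l₁₃ P * (l₁₃ (Ub κ) * l₂₃ P) * l₂₃ (Ub κ) := by group
        _ = l₁₃ P * l₂₃ P * (l₁₃ (Ub κ) * l₂₃ (Ub κ)) := by rw [← (P₂U κ h'.le).eq]; group
        _ = (l₁₃ P * l₂₃ P * H.r₁₂ A) * cm (Ub κ) := by rw [hb.funct κ h h']; group
        _ = _ := by rw [PP]; group
  · -- funct_last
    rw [u3]
    simp only [map_mul, cmρ]
    calc _ = l₁₃ P * l₁₃ (Ub N) * (l₁₃ ρ * H.r₁₂ A * l₂₃ P) * l₂₃ (Ub N) * l₂₃ ρ := by group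
      _ = l₁₃ P * (l₁₃ (Ub N) * l₂₃ P) * H.r₁₂ A * (l₁₃ ρ * l₂₃ (Ub N)) * l₂₃ ρ := by
          rw [ρP]; group
      _ = l₁₃ P * l₂₃ P * (l₁₃ (Ub N) * H.r₁₂ A * l₂₃ (Ub N)) * l₁₃ ρ * l₂₃ ρ := by
          rw [← (P₂U N le_rfl).eq, (ρ₁U N le_rfl).eq]; group
      _ = (l₁₃ P * l₂₃ P * H.r₁₂ A) * cm (Ub N) * l₁₃ ρ * l₂₃ ρ := by rw [hb.funct_last]; group
      _ = _ := by rw [PP]; group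
  · -- exch
    intro ν μ hν hνμ hμL
    rcases split μ with k | k | ⟨l, k, k', rfl⟩
    · rw [u1 μ k, u1 ν (by omega)]; exact ha.exch ν μ hν hνμ k
    · omega
    · rw [u2 l k k']
      rcases split ν with h | h | ⟨κ, h, h', rfl⟩
      · rw [u1 ν h, map_mul]
        calc _ = (H.r₂₁ A * l₁₃ (Ua ν) * l₂₃ P) * l₂₃ (Ub l) := by group
          _ = l₂₃ P * (l₁₃ (Ua ν) * l₂₃ (Ub l)) := by rw [UP ν hν h]; group
          _ = _ := by rw [(hc.UU ν h.le l k'.le).eq]; group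
      · omega
      · rw [u2 κ h h', map_mul, map_mul]
        calc _ = H.r₂₁ A * l₁₃ P * (l₁₃ (Ub κ) * l₂₃ P) * l₂₃ (Ub l) := by group
          _ = (H.r₂₁ A * l₁₃ P * l₂₃ P) * l₁₃ (Ub κ) * l₂₃ (Ub l) := by
              rw [← (P₂U κ h'.le).eq]; group
          _ = l₂₃ P * l₁₃ P * (H.r₂₁ A * l₁₃ (Ub κ) * l₂₃ (Ub l)) := by rw [PP']; group
          _ = l₂₃ P * (l₁₃ P * l₂₃ (Ub l)) * l₁₃ (Ub κ) := by
              rw [hb.exch κ l h (by omega) k']; group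
          _ = _ := by rw [(P₁U l k'.le).eq]; group
  · -- exch_last
    intro ν hν hνL
    rw [u3]
    rcases split ν with h | h | ⟨κ, h, h', rfl⟩
    · rw [u1 ν h]
      simp only [map_mul]
      calc _ = (H.r₂₁ A * l₁₃ (Ua ν) * l₂₃ P) * l₂₃ (Ub N) * l₂₃ ρ := by group
        _ = l₂₃ P * (l₁₃ (Ua ν) * l₂₃ (Ub N)) * l₂₃ ρ := by rw [UP ν hν h]; group
        _ = l₂₃ P * l₂₃ (Ub N) * (l₁₃ (Ua ν) * l₂₃ ρ) := by
            rw [(hc.UU ν h.le N le_rfl).eq]; group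
        _ = _ := by rw [← Uρ ν hν h]; group
    · omega
    · rw [u2 κ h h']
      simp only [map_mul]
      calc _ = H.r₂₁ A * l₁₃ P * (l₁₃ (Ub κ) * l₂₃ P) * l₂₃ (Ub N) * l₂₃ ρ := by group
        _ = (H.r₂₁ A * l₁₃ P * l₂₃ P) * l₁₃ (Ub κ) * l₂₃ (Ub N) * l₂₃ ρ := by
            rw [← (P₂U κ h'.le).eq]; group
        _ = l₂₃ P * l₁₃ P * (H.r₂₁ A * l₁₃ (Ub κ) * l₂₃ (Ub N)) * l₂₃ ρ := by rw [PP']; group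
        _ = l₂₃ P * (l₁₃ P * l₂₃ (Ub N)) * H.r₂₁ A * (l₁₃ (Ub κ) * l₂₃ ρ) := by
            rw [hb.exch_last κ h h']; group
        _ = l₂₃ P * l₂₃ (Ub N) * (l₁₃ P * H.r₂₁ A * l₂₃ ρ) * l₁₃ (Ub κ) := by
            rw [(P₁U N le_rfl).eq, ← (ρ₂U κ h'.le).eq]; group
        _ = _ := by rw [← ρP']; group

end RibbonStructure

end Concat

/-! ### The coproduct `Λ_{M,N}` -/

section Coproduct

variable {G : Type u} [Ring G] [HopfAlgebra ℂ G]
variable {A : Type*} [Ring A] [Algebra ℂ A] {B : Type*} [Ring B] [Algebra ℂ B]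
variable {C : Type*} [Ring C] [Algebra ℂ C]

theorem commute_leg13_leg23 {φ : A →ₐ[ℂ] C} {ψ : B →ₐ[ℂ] C} (h : Commuting φ ψ)
    (X : G ⊗[ℂ] A) (Y : G ⊗[ℂ] B) : Commute (leg13 (amp G φ X)) (leg23 (amp G ψ Y)) := by
  induction X with
  | zero => simp
  | add x y hx hy => rw [map_add, map_add]; exact hx.add_left hy
  | tmul x a =>
    induction Y with
    | zero => simp
    | add x y hx hy => rw [map_add, map_add]; exact hx.add_right hy
    | tmul y b => simp [leg13, leg23, Commute, SemiconjBy, (h a b).eq]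

theorem commute_up_amp {φ : A →ₐ[ℂ] C} {ψ : B →ₐ[ℂ] C} (h : Commuting φ ψ) (f : G →ₗ[ℂ] A)
    (ξ : G) (Y : G ⊗[ℂ] B) : Commute (up (φ.toLinearMap ∘ₗ f) ξ) (amp G ψ Y) := by
  induction Y with
  | zero => simp
  | add x y hx hy => rw [map_add]; exact hx.add_right hy
  | tmul y b => simp [up_apply, Commute, SemiconjBy, (h (f ξ) b).eq]

namespace RibbonStructure

variable {H : RibbonStructure G}

theorem systemsCommute {φ : A →ₐ[ℂ] C} {ψ : B →ₐ[ℂ] C} (h : Commuting φ ψ) (M N : ℕ)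
    (Ua : ℕ → (G ⊗[ℂ] A)ˣ) (Ub : ℕ → (G ⊗[ℂ] B)ˣ) (fa : ℕ → G →ₗ[ℂ] A) (fb : ℕ → G →ₗ[ℂ] B) :
    SystemsCommute M N (fun n => ampU φ (Ua n)) (fun n => ampU ψ (Ub n))
      (fun n => φ.toLinearMap ∘ₗ fa n) (fun n => ψ.toLinearMap ∘ₗ fb n) where
  ff _ _ _ _ _ _ := h _ _
  fU _ _ _ _ ξ := commute_up_amp h _ ξ _
  Uf _ _ _ _ ξ := commute_up_amp h.symm _ ξ _
  UU _ _ _ _ := Units.ext (commute_leg13_leg23 h _ _)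

/-- In `v U_{k-1}⁻¹ U_k` the common prefix `M^α N^α_-` cancels once `k > M`. At `k = M` it survives
and meets `U^β_1 = J^β_1`, which uses `U^β_0 = v`. The last current inherits the final `ρ`. -/
theorem currentOf_concatU {L M N : ℕ} (hL : L + 1 = M + N) (hM : 1 ≤ M) (hN : 1 ≤ N)
    {Ua Ub : ℕ → (G ⊗[ℂ] A)ˣ} {a : G →ₗ[ℂ] A} (ha : IsRep a) (hb0 : Ub 0 = H.va A)
    {k : ℕ} (hk : 1 ≤ k) (hkL : k ≤ L) :
    H.currentOf (H.concatU M N Ua Ub ha) k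
      = (if k < M then H.currentOf Ua k
          else if k = M then H.currentOf Ua M * (H.rf ha)⁻¹ * H.currentOf Ub 1
          else H.currentOf Ub (k - M + 1)) * (if k = L then H.rf ha else 1) := by
  have v : ∀ X : (G ⊗[ℂ] A)ˣ, H.va A * X = X * H.va A := fun X => (H.va_comm X).eq
  have c1 : H.currentOf Ub 1 = Ub 1 := by simp [currentOf, hb0]
  rcases Nat.lt_trichotomy k M with h | rfl | h
  · rw [if_pos h, if_neg (by omega), mul_one, currentOf, currentOf, concatU, concatU, if_pos h,
      if_pos (by omega)]
  · rw [if_neg (by omega), if_pos rfl, c1, currentOf, currentOf, concatU, concatU,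
      if_pos (by omega), if_neg (by omega), Nat.sub_self, zero_add]
    by_cases h1 : k = L
    · obtain rfl : N = 1 := by omega
      rw [if_neg (by omega), if_pos h1]; group
    · rw [if_pos (by omega), if_neg h1]; group
  · rw [if_neg (by omega), if_neg (by omega), currentOf, currentOf, concatU, concatU,
      if_neg (by omega), if_pos (by omega), if_neg (by omega),
      (by omega : k - 1 - M + 1 = k - M + 1 - 1)]
    by_cases h1 : k = L
    · obtain rfl : N = k - M + 1 := by omega
      rw [if_neg (by omega), if_pos h1]; group
    · rw [if_pos (by omega), if_neg h1]; group

theorem ampU_rf (φ : A →ₐ[ℂ] C) {f : G →ₗ[ℂ] A} (h : IsRep f) :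
    ampU φ (H.rf h) = H.rf (h.comp φ) := Units.ext (amp_pr φ f _)

theorem ampU_concatU (φ : A →ₐ[ℂ] C) (M N : ℕ) (Ua Ub : ℕ → (G ⊗[ℂ] A)ˣ) {a : G →ₗ[ℂ] A}
    (ha : IsRep a) (ν : ℕ) :
    ampU φ (H.concatU M N Ua Ub ha ν)
      = H.concatU M N (fun n => ampU φ (Ua n)) (fun n => ampU φ (Ub n)) (ha.comp φ) ν := by
  unfold concatU
  split_ifs <;> simp only [map_mul, map_inv, ampU_rf]

theorem map_concatF (φ : A →ₐ[ℂ] C) (M : ℕ) (fa fb : ℕ → G →ₗ[ℂ] A) (μ : ℕ) :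
    φ.toLinearMap ∘ₗ concatF M fa fb μ
      = concatF M (fun n => φ.toLinearMap ∘ₗ fa n) (fun n => φ.toLinearMap ∘ₗ fb n) μ := by
  unfold concatF
  split_ifs
  · exact map_convolve φ _ _
  · rfl
  · rfl

theorem ampU_holonomyOf {J : ℕ → (G ⊗[ℂ] A)ˣ} {U : ℕ → (G ⊗[ℂ] C)ˣ} {L : ℕ} (D : A →ₐ[ℂ] C)
    (h0 : U 0 = H.va C) (hJ : ∀ k, 1 ≤ k → k ≤ L → ampU D (J k) = H.currentOf U k)
    {ν : ℕ} (hν : ν ≤ L) : ampU D (H.holonomyOf J ν) = U ν := by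
  induction ν with
  | zero => rw [h0]; exact ampU_va D
  | succ n ih =>
    rw [holonomyOf, map_mul, map_mul, map_inv, ampU_va, ih (by omega), hJ _ (by omega) hν,
      currentOf, Nat.add_sub_cancel]
    calc _ = (H.va C)⁻¹ * (U n * H.va C) * (U n)⁻¹ * U (n + 1) := by group
      _ = _ := by rw [← (H.va_comm (U n)).eq]; group

theorem ampU_currentOf (D : A →ₐ[ℂ] C) (U : ℕ → (G ⊗[ℂ] A)ˣ) (k : ℕ) :
    ampU D (H.currentOf U k) = H.currentOf (fun n => ampU D (U n)) k := by
  simp only [currentOf, map_mul, map_inv, ampU_va]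

end RibbonStructure

variable [Module.Finite ℂ G]

namespace RibbonStructure

variable {H : RibbonStructure G}

theorem currentOf_Uu {N k : ℕ} (hk : 1 ≤ k) :
    H.currentOf (H.Uu N) k = H.Ju ((k : ℕ) : ZMod N) := currentOf_holonomyOf _ hk

variable (H) in
/-- The site actions of `K_N`. -/
abbrev siteL (N : ℕ) (μ : ℕ) : G →ₗ[ℂ] H.K N := (H.site ((μ : ℕ) : ZMod N)).toLinearMap

theorem isRep_siteL (N μ : ℕ) : IsRep (H.siteL N μ) := IsRep.ofAlgHom _

/-- `D` takes the holonomies and sites of `K_L` to the concatenation of the images of those of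
`K_M` and `K_N`. -/
structure IsConcat {L M N : ℕ} (D : H.K L →ₐ[ℂ] C) (φ : H.K M →ₐ[ℂ] C) (ψ : H.K N →ₐ[ℂ] C) :
    Prop where
  length : L + 1 = M + N
  holonomy : ∀ ν ≤ L, ampU D (H.Uu L ν)
    = H.concatU M N (fun n => ampU φ (H.Uu M n)) (fun n => ampU ψ (H.Uu N n))
        ((isRep_siteL M 0).comp φ) ν
  site : ∀ μ < L, D.toLinearMap ∘ₗ H.siteL L μ
    = concatF M (fun n => φ.toLinearMap ∘ₗ H.siteL M n) (fun n => ψ.toLinearMap ∘ₗ H.siteL N n) μ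

theorem commuting_include : Commuting (Algebra.TensorProduct.includeLeft : A →ₐ[ℂ] A ⊗[ℂ] B)
    (Algebra.TensorProduct.includeRight : B →ₐ[ℂ] A ⊗[ℂ] B) := fun x y => by
  simp [Commute, SemiconjBy]

theorem Nminus_eq (M N : ℕ) : H.Nminus M N = (↑(H.rf ((isRep_siteL (H := H) M 0).comp
    (Algebra.TensorProduct.includeLeft : H.K M →ₐ[ℂ] H.K M ⊗[ℂ] H.K N)))⁻¹ :
      G ⊗[ℂ] (H.K M ⊗[ℂ] H.K N)) := by
  rw [Nminus, map_id_eq, left, amp_pr, coe_rf_inv, ri, siteL, Nat.cast_zero]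

theorem NminusInv_eq (M N : ℕ) : H.NminusInv M N = (↑(H.rf ((isRep_siteL (H := H) M 0).comp
    (Algebra.TensorProduct.includeLeft : H.K M →ₐ[ℂ] H.K M ⊗[ℂ] H.K N))) :
      G ⊗[ℂ] (H.K M ⊗[ℂ] H.K N)) := by
  rw [NminusInv, map_id_eq, left, amp_pr, coe_rf, rr, siteL, Nat.cast_zero]

theorem map_site_site (M N : ℕ) (Y : G ⊗[ℂ] G) :
    Algebra.TensorProduct.map (H.site (0 : ZMod M)) (H.site (0 : ZMod N)) Y
      = pr ((Algebra.TensorProduct.includeLeft : H.K M →ₐ[ℂ] H.K M ⊗[ℂ] H.K N).toLinearMap ∘ₗ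
            H.siteL M 0)
          ((Algebra.TensorProduct.includeRight : H.K N →ₐ[ℂ] H.K M ⊗[ℂ] H.K N).toLinearMap ∘ₗ
            H.siteL N 0) Y := by
  induction Y with
  | zero => simp
  | add x y hx hy => simp only [map_add, hx, hy]
  | tmul x y => simp

section

variable {L M N : ℕ} (hL : L + 1 = M + N) (hM : 1 ≤ M) (hN : 1 ≤ N)
include hL hM hN

theorem coproduct_current (k : ℕ) (hk : 1 ≤ k) (hkL : k ≤ L) :
    (if k < M then H.left M N (H.J (k : ZMod M))
      else if k = M then H.left M N (H.J (M : ZMod M)) * H.Nminus M N * H.right M N (H.J 1)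
      else H.right M N (H.J ((k - M + 1 : ℕ) : ZMod N))) * (if k = L then H.NminusInv M N else 1)
    = H.currentOf (H.concatU M N
        (fun n => ampU (Algebra.TensorProduct.includeLeft : H.K M →ₐ[ℂ] H.K M ⊗[ℂ] H.K N)
          (H.Uu M n))
        (fun n => ampU (Algebra.TensorProduct.includeRight : H.K N →ₐ[ℂ] H.K M ⊗[ℂ] H.K N)
          (H.Uu N n))
        ((isRep_siteL (H := H) M 0).comp
          (Algebra.TensorProduct.includeLeft : H.K M →ₐ[ℂ] H.K M ⊗[ℂ] H.K N))) k := by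
  rw [currentOf_concatU hL hM hN _ (ampU_va _) hk hkL, ← ampU_currentOf, ← ampU_currentOf,
    ← ampU_currentOf, ← ampU_currentOf, currentOf_Uu hk, currentOf_Uu hM, currentOf_Uu le_rfl,
    currentOf_Uu (by omega), Nminus_eq, NminusInv_eq, Nat.cast_one]
  split_ifs <;> rfl

theorem isCoproduct_iff (Λ : H.K L →ₐ[ℂ] H.K M ⊗[ℂ] H.K N) :
    H.IsCoproduct Λ ↔
      IsConcat Λ Algebra.TensorProduct.includeLeft Algebra.TensorProduct.includeRight := by
  -- The sites of a coproduct are listed as `1, …, L`, those of a system as `0, …, L - 1`; the last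
  -- site of the first list is the site `0` of the second.
  have z : ∀ K : ℕ, ((K : ℕ) : ZMod K) = ((0 : ℕ) : ZMod K) := fun K => by simp
  constructor
  · intro h
    refine ⟨hL, fun ν hν => ?_, fun μ hμ => ?_⟩
    · refine ampU_holonomyOf (L := L) Λ ?_ (fun k hk hkL => Units.ext ?_) hν
      · rw [concatU, if_pos (by omega)]; exact ampU_va _
      · rw [← coproduct_current hL hM hN k hk hkL, ← h.current k hk hkL]
        rfl
    · ext ξ
      unfold concatF
      rcases Nat.eq_zero_or_pos μ with rfl | h0
      · have := h.site L ξ (by omega) le_rfl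
        rw [z, if_pos rfl, map_site_site] at this
        rw [if_pos rfl]
        exact this
      · have := h.site μ ξ h0 hμ.le
        rw [if_neg (by omega)] at this
        rw [if_neg (by omega)]
        split_ifs at this ⊢ <;> exact this
  · intro h
    refine ⟨hL, fun k hk hkL => ?_, fun μ ξ h1 h2 => ?_⟩
    · rw [coproduct_current hL hM hN k hk hkL]
      have e : ampU Λ (H.Ju ((k : ℕ) : ZMod L)) = ampU Λ (H.currentOf (H.Uu L) k) := by
        rw [currentOf_Uu hk]
      rw [ampU_currentOf] at e
      refine (congrArg Units.val e).trans ?_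
      rw [currentOf, currentOf, h.holonomy k hkL, h.holonomy (k - 1) (by omega)]
    · rcases h2.eq_or_lt with rfl | h2'
      · rw [if_pos rfl, z, map_site_site]
        have := LinearMap.congr_fun (h.site 0 (by omega)) ξ
        rw [concatF, if_pos rfl] at this
        exact this
      · rw [if_neg (by omega)]
        have := LinearMap.congr_fun (h.site μ h2') ξ
        rw [concatF, if_neg (by omega)] at this
        split_ifs at this ⊢ <;> exact this

theorem exists_coproduct : ∃ Λ : H.K L →ₐ[ℂ] H.K M ⊗[ℂ] H.K N, H.IsCoproduct Λ := by
  have ha := (H.isHolonomySystem_K hM).map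
    (Algebra.TensorProduct.includeLeft : H.K M →ₐ[ℂ] H.K M ⊗[ℂ] H.K N)
  have hb := (H.isHolonomySystem_K hN).map
    (Algebra.TensorProduct.includeRight : H.K N →ₐ[ℂ] H.K M ⊗[ℂ] H.K N)
  have := isHolonomySystem_concat hL hM hN ha hb
    (systemsCommute commuting_include M N _ _ _ _)
  obtain ⟨Λ, h1, h2⟩ := this.exists_lift (by omega)
  exact ⟨Λ, (isCoproduct_iff hL hM hN Λ).mpr
    ⟨hL, h1, fun μ hμ => LinearMap.ext fun ξ => h2 μ hμ ξ⟩⟩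

theorem coproduct_unique {Λ Λ' : H.K L →ₐ[ℂ] H.K M ⊗[ℂ] H.K N} (h : H.IsCoproduct Λ)
    (h' : H.IsCoproduct Λ') : Λ = Λ' := by
  have h := (isCoproduct_iff hL hM hN Λ).mp h
  have h' := (isCoproduct_iff hL hM hN Λ').mp h'
  refine hom_ext_holonomy (by omega) (fun ν _ h2 => ?_) (fun μ hμ ξ => ?_)
  · rw [h.holonomy ν h2, h'.holonomy ν h2]
  · exact LinearMap.congr_fun ((h.site μ hμ).trans (h'.site μ hμ).symm) ξ

/-- Used with a tensor product of two representations as `Φ`: from here on only the two images in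
one algebra matter. -/
theorem IsCoproduct.isConcat {Λ : H.K L →ₐ[ℂ] H.K M ⊗[ℂ] H.K N} (h : H.IsCoproduct Λ)
    (Φ : H.K M ⊗[ℂ] H.K N →ₐ[ℂ] C) :
    IsConcat (Φ.comp Λ) (Φ.comp Algebra.TensorProduct.includeLeft)
      (Φ.comp Algebra.TensorProduct.includeRight) := by
  have h := (isCoproduct_iff hL hM hN Λ).mp h
  have e : ∀ {n : ℕ} (Ψ : H.K n →ₐ[ℂ] H.K M ⊗[ℂ] H.K N)
      (x : (G ⊗[ℂ] H.K n)ˣ), ampU (Φ.comp Ψ) x = ampU Φ (ampU Ψ x) :=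
    fun Ψ x => Units.ext (amp_comp Φ Ψ _)
  refine ⟨hL, fun ν hν => ?_, fun μ hμ => ?_⟩
  · simp only [e]
    rw [h.holonomy ν hν, ampU_concatU]
    rfl
  · have := congrArg (Φ.toLinearMap ∘ₗ ·) (h.site μ hμ)
    simp only [map_concatF] at this
    exact this

end

end RibbonStructure

end Coproduct

/-! ### The representation on `ℜ` -/

section Antipode

variable {G : Type u} [Ring G] [HopfAlgebra ℂ G]
variable {B : Type*} [Ring B] [Algebra ℂ B]

theorem mul_eq_one_symm_of_finite [Module.Finite ℂ B] {x y : B} (h : x * y = 1) : y * x = 1 := by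
  have hi : Function.Injective (LinearMap.mulLeft ℂ y) := fun a b hab => by
    have := congrArg (x * ·) hab
    simpa only [LinearMap.mulLeft_apply, ← mul_assoc, h, one_mul] using this
  obtain ⟨z, hz⟩ := (LinearMap.injective_iff_surjective.mp hi) 1
  rw [LinearMap.mulLeft_apply] at hz
  rw [left_inv_eq_right_inv h hz, hz]

theorem convolve_id_antipode : convolve (LinearMap.id : G →ₗ[ℂ] G) (antipode G) = triv G G :=
  congrArg WithConv.ofConv (LinearMap.id_mul_antipode (R := ℂ) (C := G))

theorem convolve_antipode_id : convolve (antipode G) (LinearMap.id : G →ₗ[ℂ] G) = triv G G :=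
  congrArg WithConv.ofConv (LinearMap.antipode_mul_id (R := ℂ) (C := G))

theorem convolve_comp_antipode (φ : G →ₐ[ℂ] B) :
    convolve φ.toLinearMap (φ.toLinearMap ∘ₗ antipode G) = triv G B := by
  have := map_convolve φ LinearMap.id (antipode G)
  rw [convolve_id_antipode, map_triv] at this
  exact this.symm

theorem convolve_antipode_comp (φ : G →ₐ[ℂ] B) :
    convolve (φ.toLinearMap ∘ₗ antipode G) φ.toLinearMap = triv G B := by
  have := map_convolve φ (antipode G) LinearMap.id
  rw [convolve_antipode_id, map_triv] at this
  exact this.symm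

/-- The embedding of `G` as the first factor of `G ⊗ G`. -/
abbrev inl : G →ₐ[ℂ] G ⊗[ℂ] G := Algebra.TensorProduct.includeLeft

/-- The embedding of `G` as the second factor of `G ⊗ G`. -/
abbrev inr : G →ₐ[ℂ] G ⊗[ℂ] G := Algebra.TensorProduct.includeRight

theorem pr_inl_inr (Y : G ⊗[ℂ] G) : pr inl.toLinearMap inr.toLinearMap Y = Y := by
  induction Y with
  | zero => simp
  | tmul x y => simp
  | add x y hx hy => simp only [map_add, hx, hy]

theorem commuting_inl_inr :
    Commuting (inl (G := G)).toLinearMap (inr (G := G)).toLinearMap := fun x y => by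
  simp [Commute, SemiconjBy]

/-- The identity `∑ (ξ¹ ⊗ 1) Δ'(S(ξ²)) = 1 ⊗ S(ξ)`. -/
theorem convolve_inl_flip_comul_antipode :
    convolve inl.toLinearMap (((flip G).comp (Δ G)).toLinearMap ∘ₗ antipode G)
      = (inr (G := G)).toLinearMap ∘ₗ antipode G := by
  have h : convolve (inr (G := G)).toLinearMap inl.toLinearMap
      = ((flip G).comp (Δ G)).toLinearMap := LinearMap.ext fun ξ => by
    rw [convolve_swap commuting_inl_inr, pr_inl_inr]; rfl
  -- Insert `ε(ξ) = ∑ S(ξ¹) ξ²` on the left, in the second tensor factor. After regrouping, `inr ∗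
  -- inl` is `Δ'`, which cancels against `Δ' ∘ S`.
  rw [← triv_convolve (convolve inl.toLinearMap _), ← convolve_antipode_comp inr, convolve_assoc,
    ← convolve_assoc inr.toLinearMap, h, convolve_comp_antipode, convolve_triv]

/-- Because `S` reverses products, `∑ z¹ S(z²) = ε(z)` appears in the middle of `∑ x z¹ S(z²) S(y)`.
-/
theorem pr_id_antipode_mul (X : G ⊗[ℂ] G) (z : G) :
    pr LinearMap.id (antipode G) (X * Δ G z)
      = ε G z • pr LinearMap.id (antipode G) X := by
  have key : ∀ (x y : G) (Y : G ⊗[ℂ] G), pr LinearMap.id (antipode G) ((x ⊗ₜ[ℂ] y) * Y)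
      = x * pr LinearMap.id (antipode G) Y * antipode G y := fun x y Y => by
    induction Y with
    | zero => simp
    | tmul a b => simp [HopfAlgebra.antipode_mul_antidistrib, mul_assoc]
    | add a b ha hb => simp only [mul_add, map_add, add_mul, ha, hb]
  induction X with
  | zero => simp
  | add x y hx hy => simp only [map_add, add_mul, smul_add, hx, hy]
  | tmul x y =>
    rw [key, ← convolve_apply, convolve_id_antipode, triv_apply, pr_tmul,
      Algebra.algebraMap_eq_smul_one]
    simp

namespace RibbonStructure

variable (H : RibbonStructure G)

/-- Apply `S` to the first factor of `(Δ ⊗ id)(R) = R₁₃ R₂₃` and multiply the first two factors: the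
left side collapses to `1`, the right side to `(S ⊗ id)(R) R`. -/
theorem antipode_left_R : pr (inl.toLinearMap ∘ₗ antipode G) inr.toLinearMap (H.R : G ⊗[ℂ] G)
    = (↑H.R⁻¹ : G ⊗[ℂ] G) := by
  have key : ∀ X Y : G ⊗[ℂ] G,
      pr₃ (inl.toLinearMap ∘ₗ antipode G) inl.toLinearMap inr.toLinearMap (leg13 X * leg23 Y)
        = pr (inl.toLinearMap ∘ₗ antipode G) inr.toLinearMap X * Y := fun X Y => by
    induction X with
    | zero => simp
    | add x y hx hy => simp only [map_add, add_mul, hx, hy]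
    | tmul x x' =>
      induction Y with
      | zero => simp
      | add x y hx hy => simp only [map_add, mul_add, hx, hy]
      | tmul y y' => simp [leg13, leg23]
  have h := congrArg
    (pr₃ (inl.toLinearMap ∘ₗ antipode G) inl.toLinearMap inr.toLinearMap) H.comul_id_R
  rw [key, pr₃_comulAux, convolve_antipode_comp] at h
  have h2 : pr (triv G (G ⊗[ℂ] G)) inr.toLinearMap (H.R : G ⊗[ℂ] G) = 1 :=
    H.rr_triv_left (IsRep.ofAlgHom inr)
  rw [h2] at h
  exact (Units.inv_eq_of_mul_eq_one_left h.symm).symm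

/-- The same argument in the second leg. It is applied to `R⁻¹`, whose coproduct rule `(id ⊗ Δ)(R⁻¹)
= R₁₂⁻¹ R₁₃⁻¹` has the order that `∑ x¹ S(x²) = ε(x)` requires. -/
theorem antipode_right_Rinv :
    pr inl.toLinearMap (inr.toLinearMap ∘ₗ antipode G) (↑H.R⁻¹ : G ⊗[ℂ] G)
      = (H.R : G ⊗[ℂ] G) := by
  have key : ∀ X Y : G ⊗[ℂ] G,
      pr₃ inl.toLinearMap inr.toLinearMap (inr.toLinearMap ∘ₗ antipode G) (leg12 X * leg13 Y)
        = X * pr inl.toLinearMap (inr.toLinearMap ∘ₗ antipode G) Y := fun X Y => by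
    induction X with
    | zero => simp
    | add x y hx hy => simp only [map_add, add_mul, hx, hy]
    | tmul x x' =>
      induction Y with
      | zero => simp
      | add x y hx hy => simp only [map_add, mul_add, hx, hy]
      | tmul y y' => simp [leg13, leg12]
  have hR : Algebra.TensorProduct.map (AlgHom.id ℂ G) (Δ G) (↑H.R⁻¹ : G ⊗[ℂ] G)
      = leg12 (↑H.R⁻¹ : G ⊗[ℂ] G) * leg13 (↑H.R⁻¹ : G ⊗[ℂ] G) := by
    refine left_inv_eq_right_inv
      (a := Algebra.TensorProduct.map (AlgHom.id ℂ G) (Δ G) (H.R : G ⊗[ℂ] G)) ?_ ?_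
    · rw [← map_mul, Units.inv_mul, map_one]
    · rw [H.id_comul_R, mul_assoc, ← mul_assoc (leg12 _), ← map_mul, Units.mul_inv, map_one,
        one_mul, ← map_mul, Units.mul_inv, map_one]
  have h := congrArg
    (pr₃ inl.toLinearMap inr.toLinearMap (inr.toLinearMap ∘ₗ antipode G)) hR
  rw [key, pr₃_comul, convolve_comp_antipode] at h
  have h2 : pr inl.toLinearMap (triv G (G ⊗[ℂ] G)) (↑H.R⁻¹ : G ⊗[ℂ] G) = 1 :=
    H.ri_triv_right (IsRep.ofAlgHom inl)
  rw [h2] at h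
  have h3 := congrArg ((H.R : G ⊗[ℂ] G) * ·) h
  simp only [Units.mul_inv_cancel_left, mul_one] at h3
  exact h3.symm

theorem antipode_antipode_R :
    TensorProduct.map (antipode G) (antipode G) (H.R : G ⊗[ℂ] G) = H.R := by
  have key : ∀ Y : G ⊗[ℂ] G, TensorProduct.map (antipode G) (antipode G) Y
      = pr inl.toLinearMap (inr.toLinearMap ∘ₗ antipode G)
        (pr (inl.toLinearMap ∘ₗ antipode G) inr.toLinearMap Y) := fun Y => by
    induction Y with
    | zero => simp
    | add x y hx hy => simp only [map_add, hx, hy]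
    | tmul y y' => simp
  rw [key, antipode_left_R, antipode_right_Rinv]

/-- `S(∑ S(r²) r¹) = ∑ S(r¹) S²(r²)`, and one `S` in each leg is removed by the invariance of `R`
under `S ⊗ S`. -/
theorem antipode_drinfeld :
    antipode G (drinfeld (H.R : G ⊗[ℂ] G)) = pr LinearMap.id (antipode G) (H.R : G ⊗[ℂ] G) := by
  have key : ∀ Y : G ⊗[ℂ] G, antipode G (drinfeld Y)
      = pr LinearMap.id (antipode G) (TensorProduct.map (antipode G) (antipode G) Y) := fun Y => by
    induction Y with
    | zero => simp [drinfeld]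
    | add x y hx hy =>
      rw [map_add, map_add, ← hx, ← hy]
      simp only [drinfeld, map_add]
    | tmul y y' => simp [drinfeld, HopfAlgebra.antipode_mul_antidistrib]
  rw [key, antipode_antipode_R]

/-- With `u = ∑ S(r²) r¹` the element is `S(u)`. The identity `v² = u S(u)` provides the left
inverse `v⁻² u`, which in finite dimension is also a right inverse. -/
theorem exists_inverse_pr_id_antipode [Module.Finite ℂ G] :
    ∃ w : G, pr LinearMap.id (antipode G) (H.R : G ⊗[ℂ] G) * w = 1 := by
  refine ⟨(↑(H.v * H.v)⁻¹ : G) * drinfeld (H.R : G ⊗[ℂ] G), mul_eq_one_symm_of_finite ?_⟩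
  rw [mul_assoc, ← antipode_drinfeld, ← H.v_sq, ← Units.val_mul, Units.inv_mul]

end RibbonStructure

end Antipode

/-! ### The operator `D(U)` on `ℜ`: functoriality, inverse and covariance -/

section Regular

variable {G : Type u} [Ring G] [HopfAlgebra ℂ G]
variable {A : Type*} [Ring A] [Algebra ℂ A]

theorem component_leg13_mul_leg23 (π₁ π₂ : Module.Dual ℂ G) (X Y : G ⊗[ℂ] A) :
    component π₂ (component π₁ (leg13 X * leg23 Y)) = component π₁ X * component π₂ Y := by
  induction X with
  | zero => simp
  | add x y hx hy => simp only [map_add, add_mul, hx, hy]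
  | tmul x a =>
    induction Y with
    | zero => simp
    | add x y hx hy => simp only [map_add, mul_add, hx, hy]
    | tmul y b => simp [leg13, leg23, component_tmul, smul_smul, mul_comm]

theorem component_leg12_mul_comulAux (π₁ π₂ : Module.Dual ℂ G) (Z : G ⊗[ℂ] G) (X : G ⊗[ℂ] A) :
    component π₂ (component π₁ (leg12 Z * comulAux X))
      = component (pr π₁ π₂ ∘ₗ LinearMap.mulLeft ℂ Z ∘ₗ (Δ G).toLinearMap) X := by
  induction X with
  | zero => simp
  | add x y hx hy => simp only [map_add, mul_add, hx, hy]
  | tmul x a =>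
    have key : ∀ W : G ⊗[ℂ] G, component π₂ (component π₁ (leg12 W * (1 ⊗ₜ[ℂ] (1 ⊗ₜ[ℂ] a))))
        = pr π₁ π₂ W • a := fun W => by
      induction W with
      | zero => simp
      | add x y hx hy => simp only [map_add, add_mul, add_smul, hx, hy]
      | tmul y y' => simp [leg12, component_tmul, smul_smul]
    rw [comulAux_tmul, convolve_apply, ← leg12_eq, ← mul_assoc, ← map_mul, key, component_tmul]
    rfl

theorem component_mul_inr (π : Module.Dual ℂ G) (X : G ⊗[ℂ] A) (a : A) :
    component π (X * (1 ⊗ₜ[ℂ] a)) = component π X * a := by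
  induction X with
  | zero => simp
  | add x y hx hy => simp only [map_add, add_mul, hx, hy]
  | tmul x b => simp [component_tmul]

theorem component_inr_mul (π : Module.Dual ℂ G) (X : G ⊗[ℂ] A) (a : A) :
    component π ((1 ⊗ₜ[ℂ] a) * X) = a * component π X := by
  induction X with
  | zero => simp
  | add x y hx hy => simp only [map_add, mul_add, hx, hy]
  | tmul x b => simp [component_tmul]

theorem component_tmul_mul (π : Module.Dual ℂ G) (x : G) (X : G ⊗[ℂ] A) (a : A) :
    component π ((x ⊗ₜ[ℂ] a) * X) = a * component (π ∘ₗ LinearMap.mulLeft ℂ x) X := by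
  induction X with
  | zero => simp
  | add x y hx hy => simp only [map_add, mul_add, hx, hy]
  | tmul x b => simp [component_tmul]

theorem component_mul_tmul (π : Module.Dual ℂ G) (x : G) (X : G ⊗[ℂ] A) (a : A) :
    component π (X * (x ⊗ₜ[ℂ] a)) = component (π ∘ₗ LinearMap.mulRight ℂ x) X * a := by
  induction X with
  | zero => simp
  | add x y hx hy => simp only [map_add, add_mul, hx, hy]
  | tmul x b => simp [component_tmul]

namespace RibbonStructure

variable (H : RibbonStructure G)

theorem starProd_apply (π₁ π₂ : Module.Dual ℂ G) (z : G) :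
    H.starProd π₁ π₂ z = pr π₁ π₂ ((H.R : G ⊗[ℂ] G) * Δ G z) := rfl

/-- Associativity of the twisted product amounts to `R₂₃ (id ⊗ Δ)(R) = R₁₂ (Δ ⊗ id)(R)`, which is
the Yang-Baxter equation once both coproducts are expanded. It is also the functoriality of `D(U)`.
-/
theorem starProd_assoc (π₁ π₂ : Module.Dual ℂ G) :
    H.starProd π₁ * H.starProd π₂ = H.starProd (H.starProd π₁ π₂) := by
  ext π₃ z
  have h1 : ∀ Y : G ⊗[ℂ] G, pr π₁ (H.starProd π₂ π₃) Y = pr₃ π₁ π₂ π₃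
      (leg23 (H.R : G ⊗[ℂ] G) * Algebra.TensorProduct.map (AlgHom.id ℂ G) (Δ G) Y) := fun Y => by
    induction Y with
    | zero => simp
    | add x y hx hy => simp only [map_add, mul_add, hx, hy]
    | tmul x y => simp [leg23, starProd_apply, pr₃]
  have h2 : ∀ Y : G ⊗[ℂ] G, pr (H.starProd π₁ π₂) π₃ Y = pr₃ π₁ π₂ π₃
      (leg12 (H.R : G ⊗[ℂ] G) * comulAux Y) := fun Y => by
    induction Y with
    | zero => simp
    | add x y hx hy => simp only [map_add, mul_add, hx, hy]
    | tmul x y =>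
      have key : ∀ W : G ⊗[ℂ] G, pr₃ π₁ π₂ π₃ (leg12 W * (1 ⊗ₜ[ℂ] (1 ⊗ₜ[ℂ] y)))
          = pr π₁ π₂ W * π₃ y := fun W => by
        induction W with
        | zero => simp
        | add x y hx hy => simp only [map_add, add_mul, hx, hy]
        | tmul y y' => simp [leg12, mul_assoc]
      rw [comulAux_tmul, convolve_apply, ← leg12_eq, ← mul_assoc, ← map_mul, key]
      rfl
  have hc : comulAux (Δ G z) = Algebra.TensorProduct.map (AlgHom.id ℂ G) (Δ G) (Δ G z) :=
    Coalgebra.coassoc_apply z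
  have hid : IsRep (LinearMap.id : G →ₗ[ℂ] G) := ⟨rfl, fun _ _ => rfl⟩
  have l13 : (leg13 (H.R : G ⊗[ℂ] G) : G ⊗[ℂ] (G ⊗[ℂ] G))
      = H.rr (slot₁ G) (upp LinearMap.id) := by
    rw [rr, ← leg13_pr]; exact congrArg _ (pr_inl_inr _).symm
  have l23 : (leg23 (H.R : G ⊗[ℂ] G) : G ⊗[ℂ] (G ⊗[ℂ] G))
      = H.rr (slot₂ G) (upp LinearMap.id) := by
    rw [rr, ← leg23_pr]; exact congrArg _ (pr_inl_inr _).symm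
  change pr π₁ (H.starProd π₂ π₃) ((H.R : G ⊗[ℂ] G) * Δ G z)
    = pr (H.starProd π₁ π₂) π₃ ((H.R : G ⊗[ℂ] G) * Δ G z)
  rw [h1, h2, map_mul (Algebra.TensorProduct.map (AlgHom.id ℂ G) (Δ G)),
    map_mul (comulAux (G := G) (A := G)), H.id_comul_R, H.comul_id_R, hc, l13, l23, leg12_R]
  have yb := congrArg (· * Algebra.TensorProduct.map (AlgHom.id ℂ G) (Δ G) (Δ G z))
    (H.yang_baxter isRep_slot₁ isRep_slot₂ hid.upp commuting_slot₁_slot₂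
      (commuting_slot₁_upp _) (commuting_slot₂_upp _))
  simp only [mul_assoc] at yb ⊢
  exact congrArg _ yb.symm

theorem starProd_counit : H.starProd (ε G).toLinearMap = 1 := by
  ext π z
  have key : ∀ Y : G ⊗[ℂ] G, pr (ε G).toLinearMap π Y = π (pr (triv G G) LinearMap.id Y) :=
    fun Y => by
      induction Y with
      | zero => simp
      | add x y hx hy => simp only [map_add, hx, hy]
      | tmul x y => simp [triv_apply, ← Algebra.smul_def]
  have hid : IsRep (LinearMap.id : G →ₗ[ℂ] G) := ⟨rfl, fun _ _ => rfl⟩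
  rw [starProd_apply, key, pr_mul isRep_triv hid (fun x y => commute_triv x y),
    ← convolve_apply, triv_convolve]
  have := H.rr_triv_left hid
  rw [rr] at this
  rw [this]
  simp

variable [Module.Finite ℂ G]

theorem sum_apply_basis (T : Module.Dual ℂ G) (x : G) :
    ∑ i, T (basis G i) * (basis G).coord i x = T x := by
  conv_rhs => rw [← (basis G).sum_repr x]
  simp only [map_sum, map_smul, smul_eq_mul, mul_comm, Module.Basis.coord_apply]

theorem sum_starProd (T : Module.Dual ℂ G) :
    ∑ i, T (basis G i) • H.starProd ((basis G).coord i) = H.starProd T := by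
  ext π₂ z
  simp only [LinearMap.sum_apply, LinearMap.smul_apply, starProd_apply, smul_eq_mul]
  have key : ∀ Y : G ⊗[ℂ] G, ∑ i, T (basis G i) * pr ((basis G).coord i) π₂ Y = pr T π₂ Y := by
    intro Y
    induction Y with
    | zero => simp
    | add x y hx hy => simp only [map_add, mul_add, Finset.sum_add_distrib, hx, hy]
    | tmul x y =>
      simp only [pr_tmul, ← mul_assoc, ← Finset.sum_mul]
      congr 1
      exact sum_apply_basis T x
  exact key _

theorem component_holonomyOp (π : Module.Dual ℂ G) :
    component π H.holonomyOp = H.starProd π := by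
  rw [holonomyOp, component_universal, sum_starProd]

/-- By associativity each component of the product is the twisted product with a single form. At `z`
that form is `π` of `∑ x S(y) w`, where `∑ x ⊗ y = R Δ(z)`. There `Δ(z)` collapses to `ε(z)` and `w`
cancels the rest, leaving `π(1) ε`, and `ε` is the left unit. -/
theorem holonomyOp_mul_eq_one {w : G}
    (hw : pr LinearMap.id (antipode G) (H.R : G ⊗[ℂ] G) * w = 1) :
    H.holonomyOp * (∑ i, (antipode G (basis G i) * w) ⊗ₜ[ℂ] H.starProd ((basis G).coord i))
      = 1 := by
  refine component_ext fun π => ?_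
  have h1 : ∀ i, component π (H.holonomyOp *
      ((antipode G (basis G i) * w) ⊗ₜ[ℂ] H.starProd ((basis G).coord i)))
      = H.starProd (H.starProd (π ∘ₗ LinearMap.mulRight ℂ (antipode G (basis G i) * w))
          ((basis G).coord i)) := fun i => by
    rw [component_mul_tmul, component_holonomyOp, starProd_assoc]
  have h2 : ∀ Y : G ⊗[ℂ] G,
      ∑ i, pr (π ∘ₗ LinearMap.mulRight ℂ (antipode G (basis G i) * w)) ((basis G).coord i) Y
        = π (pr LinearMap.id (antipode G) Y * w) := fun Y => by
    induction Y with
    | zero => simp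
    | add x y hx hy => simp only [map_add, add_mul, Finset.sum_add_distrib, hx, hy]
    | tmul x y =>
      simpa [mul_assoc] using sum_apply_basis
        (π ∘ₗ LinearMap.mulLeft ℂ x ∘ₗ LinearMap.mulRight ℂ w ∘ₗ antipode G) y
  have h3 : ∑ i, H.starProd (π ∘ₗ LinearMap.mulRight ℂ (antipode G (basis G i) * w))
          ((basis G).coord i) = π 1 • (ε G).toLinearMap := by
    ext z
    rw [LinearMap.sum_apply]
    simp only [starProd_apply]
    rw [h2, pr_id_antipode_mul, smul_mul_assoc, hw, map_smul]
    simp [mul_comm]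
  have h4 : ∀ T : Fin (Module.finrank ℂ G) → Module.Dual ℂ G,
      ∑ i, H.starProd (T i) = H.starProd (∑ i, T i) := fun T => by
    rw [← H.sum_starProd (∑ i, T i)]
    simp only [LinearMap.sum_apply, Finset.sum_smul]
    rw [Finset.sum_comm]
    exact Finset.sum_congr rfl fun i _ => (H.sum_starProd (T i)).symm
  have h5 : ∀ (c : ℂ) (T : Module.Dual ℂ G), H.starProd (c • T) = c • H.starProd T := fun c T => by
    rw [← H.sum_starProd (c • T), ← H.sum_starProd T]
    simp only [LinearMap.smul_apply, Finset.smul_sum, smul_smul, smul_eq_mul]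
  rw [Finset.mul_sum, map_sum]
  simp only [h1]
  rw [h4, h3, h5, starProd_counit, Algebra.TensorProduct.one_def, component_tmul]

theorem exists_holonomyUnit :
    ∃ U : (G ⊗[ℂ] Module.End ℂ (Module.Dual ℂ G))ˣ,
      (U : G ⊗[ℂ] Module.End ℂ (Module.Dual ℂ G)) = H.holonomyOp := by
  obtain ⟨w, hw⟩ := H.exists_inverse_pr_id_antipode
  have h := H.holonomyOp_mul_eq_one hw
  have h' := mul_eq_one_symm_of_finite (B := G ⊗[ℂ] Module.End ℂ (Module.Dual ℂ G)) h
  exact ⟨⟨_, _, h, h'⟩, rfl⟩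

/-- The operator `D(U)` as a unit. -/
def holonomyUnit : (G ⊗[ℂ] Module.End ℂ (Module.Dual ℂ G))ˣ := H.exists_holonomyUnit.choose

theorem coe_holonomyUnit :
    (H.holonomyUnit : G ⊗[ℂ] Module.End ℂ (Module.Dual ℂ G)) = H.holonomyOp :=
  H.exists_holonomyUnit.choose_spec

end RibbonStructure

theorem headOp_apply (ξ : G) (π : Module.Dual ℂ G) (z : G) : headOp ξ π z = π (z * ξ) := rfl

theorem tailOp_apply (ξ : G) (π : Module.Dual ℂ G) (z : G) :
    tailOp ξ π z = π (antipode G ξ * z) := rfl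

theorem isRep_headOp : IsRep (headOp (G := G)) :=
  ⟨by ext π z; simp [headOp_apply], fun x y => by ext π z; simp [headOp_apply, mul_assoc]⟩

theorem isRep_tailOp : IsRep (tailOp (G := G)) :=
  ⟨by ext π z; simp [tailOp_apply], fun x y => by
    ext π z; simp [tailOp_apply, HopfAlgebra.antipode_mul_antidistrib, mul_assoc]⟩

theorem commuting_tailOp_headOp : Commuting (tailOp (G := G)) (headOp (G := G)) := fun x y => by
  ext π z; simp [tailOp_apply, headOp_apply, mul_assoc]

namespace RibbonStructure

variable (H : RibbonStructure G) [Module.Finite ℂ G]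

theorem headOp_holonomyOp (ξ : G) :
    up headOp ξ * H.holonomyOp = H.holonomyOp * convolve (aux _) (up headOp) ξ := by
  refine component_ext fun π => ?_
  rw [up_apply, component_inr_mul, component_holonomyOp, convolve_apply]
  have key : ∀ (Y : G ⊗[ℂ] G) (π' : Module.Dual ℂ G) (z : G),
      component π (H.holonomyOp * pr (aux _) (up headOp) Y) π' z
        = pr π π' ((H.R : G ⊗[ℂ] G) * Δ G z * Y) := fun Y π' z => by
    induction Y with
    | zero => simp
    | add x y hx hy => simp only [map_add, mul_add, LinearMap.add_apply, hx, hy]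
    | tmul x y =>
      have e : pr (aux (Module.End ℂ (Module.Dual ℂ G))) (up headOp) (x ⊗ₜ[ℂ] y)
          = x ⊗ₜ[ℂ] headOp y := by simp [aux_apply, up_apply]
      rw [e, component_mul_tmul, component_holonomyOp, Module.End.mul_apply, starProd_apply]
      induction (H.R : G ⊗[ℂ] G) * Δ G z with
      | zero => simp
      | add a b ha hb => simp only [map_add, add_mul, ha, hb]
      | tmul a b => simp [headOp_apply]
  ext π' z
  rw [key, Module.End.mul_apply, headOp_apply, starProd_apply, map_mul (Δ G), mul_assoc]

/-- Since `R Δ(S(y) z) = Δ'(S(y)) R Δ(z)`, the tail action multiplies `R Δ(z)` from the left, and `∑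
(ξ¹ ⊗ 1) Δ'(S(ξ²)) = 1 ⊗ S(ξ)` leaves the action on the second leg alone. -/
theorem tailOp_holonomyOp (ξ : G) :
    convolve (aux _) (up tailOp) ξ * H.holonomyOp = H.holonomyOp * up tailOp ξ := by
  refine component_ext fun π => ?_
  rw [up_apply, component_mul_inr, component_holonomyOp, convolve_apply]
  have key : ∀ (Y : G ⊗[ℂ] G) (π' : Module.Dual ℂ G) (z : G),
      component π (pr (aux _) (up tailOp) Y * H.holonomyOp) π' z
        = pr π π' (pr inl.toLinearMap (((flip G).comp (Δ G)).toLinearMap ∘ₗ antipode G) Y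
          * ((H.R : G ⊗[ℂ] G) * Δ G z)) := fun Y π' z => by
    induction Y with
    | zero => simp
    | add x y hx hy => simp only [map_add, add_mul, LinearMap.add_apply, hx, hy]
    | tmul x y =>
      have e : pr (aux (Module.End ℂ (Module.Dual ℂ G))) (up tailOp) (x ⊗ₜ[ℂ] y)
          = x ⊗ₜ[ℂ] tailOp y := by simp [aux_apply, up_apply]
      have e2 : pr inl.toLinearMap (((flip G).comp (Δ G)).toLinearMap ∘ₗ antipode G) (x ⊗ₜ[ℂ] y)
          * ((H.R : G ⊗[ℂ] G) * Δ G z)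
          = (x ⊗ₜ[ℂ] 1) * ((H.R : G ⊗[ℂ] G) * Δ G (antipode G y * z)) := by
        rw [map_mul (Δ G), ← mul_assoc (H.R : G ⊗[ℂ] G), H.R_comul (antipode G y), pr_tmul]
        simp only [mul_assoc]
        rfl
      rw [e, component_tmul_mul, component_holonomyOp, Module.End.mul_apply, tailOp_apply,
        starProd_apply, e2]
      induction (H.R : G ⊗[ℂ] G) * Δ G (antipode G y * z) with
      | zero => simp
      | add a b ha hb => simp only [map_add, mul_add, ha, hb]
      | tmul a b => simp
  ext π' z
  rw [key, ← convolve_apply, convolve_inl_flip_comul_antipode, Module.End.mul_apply,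
    starProd_apply]
  induction (H.R : G ⊗[ℂ] G) * Δ G z with
  | zero => simp
  | add a b ha hb => simp only [map_add, mul_add, ha, hb]
  | tmul a b => simp [tailOp_apply]

/-- The holonomies of the representation on `ℜ`. -/
def regularU (n : ℕ) : (G ⊗[ℂ] Module.End ℂ (Module.Dual ℂ G))ˣ :=
  if n = 0 then H.va _ else if n = 1 then H.holonomyUnit else 1

variable (G) in
/-- The site actions of the representation on `ℜ`. -/
def regularF (n : ℕ) : G →ₗ[ℂ] Module.End ℂ (Module.Dual ℂ G) :=
  if n = 0 then tailOp else headOp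

/-- One free holonomy is a lattice of length `2` whose monodromy is `1`. The relations of the
monodromy are then trivial, and what remains is functoriality and covariance of `D(U)`. -/
theorem isHolonomySystem_regular : H.IsHolonomySystem 2 H.regularU (regularF G) where
  rep n _ := by
    unfold regularF
    split_ifs
    · exact isRep_tailOp
    · exact isRep_headOp
  comm n hn m hm hnm := by
    unfold regularF
    split_ifs
    · omega
    · exact commuting_tailOp_headOp
    · exact commuting_tailOp_headOp.symm
    · omega
  zero := rfl
  tail ν ξ h1 h2 := by
    obtain rfl : ν = 1 := by omega
    simp only [regularU, regularF, one_ne_zero, if_true, if_false, coe_holonomyUnit]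
    exact H.tailOp_holonomyOp ξ
  tail_last ξ := by simp [regularU]
  head ν ξ h1 h2 := by
    obtain rfl : ν = 1 := by omega
    simp only [regularU, regularF, one_ne_zero, if_true, if_false, coe_holonomyUnit]
    exact H.headOp_holonomyOp ξ
  other ν μ ξ h1 h2 h3 h4 h5 := by
    obtain rfl : ν = 2 := by omega
    simp [regularU]
  funct ν h1 h2 := by
    obtain rfl : ν = 1 := by omega
    refine Units.ext ?_
    simp only [regularU, one_ne_zero, if_true, if_false, Units.val_mul, coe_l₁₃, coe_l₂₃, coe_cm,
      coe_holonomyUnit, coe_r₁₂, ← leg12_R]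
    refine component_ext fun π₁ => component_ext fun π₂ => ?_
    rw [component_leg13_mul_leg23, component_leg12_mul_comulAux, component_holonomyOp,
      component_holonomyOp, component_holonomyOp, starProd_assoc]
    rfl
  funct_last := by simp [regularU]
  exch ν μ h1 h2 h3 := by omega
  exch_last ν h1 h2 := by simp [regularU]

end RibbonStructure

end Regular

/-! ### Lattice representations with values in an algebra -/

section LatticeHom

variable {G : Type u} [Ring G] [HopfAlgebra ℂ G]
variable {A : Type*} [Ring A] [Algebra ℂ A]

theorem up_triv : up (triv G A) = triv G (G ⊗[ℂ] A) := map_triv _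

theorem commute_lTensor {E : Type*} [AddCommGroup E] [Module ℂ E] {f : E →ₗ[ℂ] A} {X : A}
    (hf : ∀ x, Commute (f x) X) (Z : G ⊗[ℂ] E) :
    Commute (LinearMap.lTensor G f Z) ((1 : G) ⊗ₜ[ℂ] X) := by
  induction Z with
  | zero => simp
  | add x y hx hy => rw [map_add]; exact hx.add_left hy
  | tmul x y => simp [Commute, SemiconjBy, (hf y).eq]

theorem commute_up_inr {f : G →ₗ[ℂ] A} {X : A} (hf : ∀ x, Commute (f x) X) (ξ : G) :
    Commute (up f ξ) ((1 : G) ⊗ₜ[ℂ] X) := by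
  simp [Commute, SemiconjBy, up_apply, (hf ξ).eq]

theorem amp_mul_inr {C : Type*} [Ring C] [Algebra ℂ C] {D D' : C →ₐ[ℂ] A} {X : A}
    (h : ∀ x, D x * X = X * D' x) (Y : G ⊗[ℂ] C) :
    amp G D Y * (1 : G) ⊗ₜ[ℂ] X = (1 : G) ⊗ₜ[ℂ] X * amp G D' Y := by
  induction Y with
  | zero => simp
  | add x y hx hy => rw [map_add, map_add, add_mul, mul_add, hx, hy]
  | tmul x y => simp [h]

variable (G) in
/-- The endomorphisms of the carrier space of the representation of one holonomy. -/
abbrev EndDual : Type _ := Module.End ℂ (Module.Dual ℂ G)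

/-- The first `n` maps of the family are commuting unital homomorphisms. -/
structure IsFactorFamily (n : ℕ) (f : ℕ → EndDual G →ₗ[ℂ] A) : Prop where
  one : ∀ k < n, f k 1 = 1
  mul : ∀ k < n, ∀ x y, f k (x * y) = f k x * f k y
  comm : ∀ k < n, ∀ l < n, k ≠ l → Commuting (f k) (f l)

/-- The tensor product of the tail actions on the first `k` factors. -/
def tailProd (f : ℕ → EndDual G →ₗ[ℂ] A) : ℕ → (G →ₗ[ℂ] A)
  | 0 => triv G A
  | k + 1 => convolve (tailProd f k) (f k ∘ₗ tailOp)

/-- The family which consists of the first `m` members of `f`, followed by `g`. -/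
def appendFamily (m : ℕ) (f g : ℕ → EndDual G →ₗ[ℂ] A) (k : ℕ) : EndDual G →ₗ[ℂ] A :=
  if k < m then f k else g (k - m)

variable {f g : ℕ → EndDual G →ₗ[ℂ] A} {m n : ℕ}

theorem IsFactorFamily.isRep (h : IsFactorFamily n f) {k : ℕ} (hk : k < n) {q : G →ₗ[ℂ] EndDual G}
    (hq : IsRep q) : IsRep (f k ∘ₗ q) :=
  ⟨by simp [hq.one, h.one k hk], fun x y => by simp [hq.mul, h.mul k hk]⟩

theorem commuting_tailProd {X : Type*} {q : X → A} {k : ℕ} (h : ∀ l < k, Commuting (f l) q) :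
    Commuting (tailProd f k) q := by
  induction k with
  | zero => exact fun x y => commute_triv _ _
  | succ k ih =>
    exact (ih fun l hl => h l (by omega)).convolve_left fun x y => h k (by omega) _ y

theorem IsFactorFamily.isRep_tailProd (h : IsFactorFamily n f) {k : ℕ} (hk : k ≤ n) :
    IsRep (tailProd f k) := by
  induction k with
  | zero => exact isRep_triv
  | succ k ih =>
    exact (ih (by omega)).convolve (h.isRep (by omega) isRep_tailOp)
      (commuting_tailProd fun l hl x y => h.comm l (by omega) k (by omega) (by omega) _ _)

theorem tailProd_append_of_le {k : ℕ} (hk : k ≤ m) :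
    tailProd (appendFamily m f g) k = tailProd f k := by
  induction k with
  | zero => rfl
  | succ k ih => rw [tailProd, tailProd, ih (by omega), appendFamily, if_pos (by omega)]

theorem tailProd_append (k : ℕ) :
    tailProd (appendFamily m f g) (m + k) = convolve (tailProd f m) (tailProd g k) := by
  induction k with
  | zero => rw [add_zero, tailProd_append_of_le le_rfl, tailProd, convolve_triv]
  | succ k ih =>
    rw [← add_assoc, tailProd, ih, appendFamily, if_neg (by omega), Nat.add_sub_cancel_left,
      tailProd, convolve_assoc]

/-! ### Braiding an action `t` past two actions `i` and `j` -/

section Braiding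

variable {B : Type*} [Ring B] [Algebra ℂ B] (H : RibbonStructure G)
variable {a i j t : G →ₗ[ℂ] B} (ha : IsRep a) (hi : IsRep i) (hj : IsRep j) (ht : IsRep t)
  (hai : Commuting a i) (haj : Commuting a j) (hat : Commuting a t) (hij : Commuting i j)
  (hit : Commuting i t) (hjt : Commuting j t)

theorem RibbonStructure.commute_braiding {X : B} (hi : ∀ x, Commute (i x) X)
    (hj : ∀ x, Commute (j x) X) (ht : ∀ x, Commute (t x) X) :
    Commute (H.rr t j * H.ri i t) X :=
  (H.commute_rr ht hj).mul_left (H.commute_ri hi ht)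

include hi hj ht hij hit hjt in
-- `R_{tj}` interchanges `t` with its neighbour `j`, and `R_{it}⁻¹` then interchanges it with `i`.
theorem RibbonStructure.convolve_braiding (ξ : G) :
    convolve (convolve i j) t ξ * (H.rr t j * H.ri i t)
      = H.rr t j * H.ri i t * convolve t (convolve i j) ξ := by
  have h1 : convolve (convolve i j) t ξ * H.rr t j = H.rr t j * convolve i (convolve t j) ξ := by
    rw [convolve_assoc]
    exact convolve_intertwine (fun x => (H.commute_rr (fun y => (hit x y).symm)
      (fun y => (hij x y).symm)).symm) (fun x => (H.rr_mul_convolve ht hj hjt.symm x).symm) ξ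
  have h2 : convolve (convolve i t) j ξ * H.ri i t = H.ri i t * convolve (convolve t i) j ξ :=
    convolve_intertwine (fun x => H.convolve_mul_ri hi ht hit x)
      (fun x => (H.commute_ri (fun y => hij y x) (fun y => (hjt x y).symm)).symm) ξ
  rw [← mul_assoc, h1, mul_assoc, ← convolve_assoc, h2, convolve_assoc, mul_assoc]

include ha hi hj ht hai haj hat hij hit hjt in
-- As `Y` absorbs the auxiliary action into `t`, pulling `R_{tj}` to the left through `Y` creates an
-- `R_{aj}`, which cancels the given inverse. Likewise `R_{ia}` is absorbed when `R_{it}` is moved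
-- through `Y`. The opposite crossings in the braiding match the two different factors of the twist.
theorem RibbonStructure.holonomy_braiding {Y : B}
    (hY : ∀ ξ, convolve a t ξ * Y = Y * t ξ) (hYi : ∀ ξ, Commute (i ξ) Y)
    (hYj : ∀ ξ, Commute (j ξ) Y) :
    H.rr i a * H.ri a j * Y * (H.rr t j * H.ri i t) = H.rr t j * H.ri i t * Y := by
  have e1 : H.rr i t * H.rr i a * Y = Y * H.rr i t := by
    rw [← H.rr_convolve_right hi ha ht hai.symm hit hat]
    exact pr_intertwine (fun x => hYi x) hY _
  have e2 : H.rr a j * H.rr t j * Y = Y * H.rr t j := by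
    rw [← H.rr_convolve_left ha ht hj hat haj hjt.symm]
    exact pr_intertwine hY (fun x => hYj x) _
  have e3 : H.rr i a * H.rr t j = H.rr t j * H.rr i a :=
    H.commute_rr (fun x => (H.commute_rr (fun y => (hit x y).symm) (fun y => (hij x y).symm)).symm)
      (fun x => (H.commute_rr (fun y => (hat x y).symm) (fun y => (haj x y).symm)).symm)
  calc _ = H.rr i a * H.ri a j * (Y * H.rr t j) * H.ri i t := by simp only [mul_assoc]
    _ = H.rr i a * (H.ri a j * H.rr a j) * H.rr t j * Y * H.ri i t := by
      rw [← e2]; simp only [mul_assoc]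
    _ = (H.rr i a * H.rr t j) * Y * H.ri i t := by rw [H.ri_mul_rr ha hj haj, mul_one]
    _ = H.rr t j * ((H.ri i t * H.rr i t) * H.rr i a * Y) * H.ri i t := by
      rw [e3, H.ri_mul_rr hi ht hit, one_mul]; simp only [mul_assoc]
    _ = H.rr t j * H.ri i t * (H.rr i t * H.rr i a * Y) * H.ri i t := by simp only [mul_assoc]
    _ = H.rr t j * H.ri i t * Y * (H.rr i t * H.ri i t) := by rw [e1]; simp only [mul_assoc]
    _ = _ := by rw [H.rr_mul_ri hi ht hit, mul_one]

include ha hi hj ht hai haj hat hij hit hjt in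
-- `R_{ia} R_{ai}` commutes with the joint action of `a` and `i`, hence with `R_{at} R_{it}`, which
-- is `R` with this joint action in its first leg. So moving `R_{it}⁻¹` past it is paid for by a
-- conjugation with `R_{at}`.
theorem RibbonStructure.monodromy_braiding :
    H.rr i a * H.rr a i * (H.rr t j * H.ri i t)
      = H.rr t j * H.ri i t * (H.ri a t * (H.rr i a * H.rr a i) * H.rr a t) := by
  set X := H.rr i a * H.rr a i with hX
  have c1 : X * H.rr t j = H.rr t j * X := by
    have ci : ∀ x, Commute (i x) (H.rr t j) := fun x =>
      (H.commute_rr (fun y => (hit x y).symm) (fun y => (hij x y).symm)).symm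
    have ca : ∀ x, Commute (a x) (H.rr t j) := fun x =>
      (H.commute_rr (fun y => (hat x y).symm) (fun y => (haj x y).symm)).symm
    exact (H.commute_rr ci ca).mul_left (H.commute_rr ca ci)
  have c2 : H.rr a t * H.rr i t * X = X * (H.rr a t * H.rr i t) := by
    rw [← H.rr_convolve_left ha hi ht hai hat hit]
    refine pr_intertwine (fun x => ?_) (fun x => ?_) _
    · rw [hX, ← mul_assoc, ← H.rr_mul_convolve hi ha hai.symm, mul_assoc,
        ← H.rr_mul_convolve ha hi hai, mul_assoc]
    · have cr : Commute (H.rr i a) (t x) := H.commute_rr (fun y => hit y x) (fun y => hat y x)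
      have cr' : Commute (H.rr a i) (t x) := H.commute_rr (fun y => hat y x) (fun y => hit y x)
      exact (cr.mul_left cr').symm
  calc _ = H.rr t j * (X * H.ri i t) := by rw [← mul_assoc, c1, mul_assoc]
    _ = H.rr t j * (H.ri i t * (H.ri a t * H.rr a t) * H.rr i t * X * H.ri i t) := by
      rw [H.ri_mul_rr ha ht hat, mul_one, H.ri_mul_rr hi ht hit, one_mul]
    _ = H.rr t j * H.ri i t * H.ri a t * (H.rr a t * H.rr i t * X) * H.ri i t := by
      simp only [mul_assoc]
    _ = H.rr t j * H.ri i t * H.ri a t * X * H.rr a t * (H.rr i t * H.ri i t) := by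
      rw [c2]; simp only [mul_assoc]
    _ = _ := by rw [H.rr_mul_ri hi ht hit, mul_one]; simp only [mul_assoc]

include hi hj ht hit hjt in
theorem RibbonStructure.braiding_inverse :
    H.rr i t * H.ri t j * (H.rr t j * H.ri i t) = 1 := by
  rw [mul_assoc, ← mul_assoc (H.ri t j), H.ri_mul_rr ht hj hjt.symm, one_mul, H.rr_mul_ri hi ht hit]

end Braiding

namespace RibbonStructure

variable [Module.Finite ℂ G] (H : RibbonStructure G)

/-- `D` is given on holonomies and sites by the formulas for a lattice representation, where `f`
is the family of actions on the factors, `i` is the action that enters the monodromy and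
`b` is the action of `G` on the last factor. -/
structure IsLatticeHom (N : ℕ) (f : ℕ → EndDual G →ₗ[ℂ] A) (i b : G →ₗ[ℂ] A) (D : H.K N →ₐ[ℂ] A) :
    Prop where
  holonomy : ∀ k, k + 1 < N → amp G D (H.Uu N (k + 1))
    = H.ri (aux A) (up (tailProd f k)) * LinearMap.lTensor G (f k) H.holonomyOp
  monodromy : amp G D (H.Uu N N)
    = H.ri (aux A) (up (tailProd f (N - 1))) * (H.rr (up i) (aux A) * H.rr (aux A) (up i))
      * H.rr (aux A) (up (tailProd f (N - 1)))
  site : ∀ k, k + 1 < N → D.toLinearMap ∘ₗ H.siteL N (k + 1) = f k ∘ₗ headOp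
  site_zero : D.toLinearMap ∘ₗ H.siteL N 0 = convolve (tailProd f (N - 1)) b

variable {H} {L M N : ℕ} {i j b : G →ₗ[ℂ] A}

theorem IsLatticeHom.unique (hN : 1 ≤ N) {D D' : H.K N →ₐ[ℂ] A} (h : H.IsLatticeHom N f i b D)
    (h' : H.IsLatticeHom N f i b D') : D = D' := by
  refine hom_ext_holonomy hN (fun ν h1 h2 => Units.ext ?_) (fun μ hμ ξ => ?_)
  · rw [coe_ampU, coe_ampU]
    rcases Nat.lt_or_eq_of_le h2 with h3 | rfl
    · obtain ⟨k, rfl⟩ := Nat.exists_eq_add_of_le' h1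
      rw [h.holonomy k h3, h'.holonomy k h3]
    · rw [h.monodromy, h'.monodromy]
  · rcases Nat.eq_zero_or_pos μ with rfl | h1
    · exact LinearMap.congr_fun (h.site_zero.trans h'.site_zero.symm) ξ
    · obtain ⟨k, rfl⟩ := Nat.exists_eq_add_of_le' h1
      exact LinearMap.congr_fun ((h.site k hμ).trans (h'.site k hμ).symm) ξ

theorem IsLatticeHom.monodromy_triv {D : H.K N →ₐ[ℂ] A} (hf : IsFactorFamily (N - 1) f)
    (h : H.IsLatticeHom N f (triv G A) b D) : amp G D (H.Uu N N) = 1 := by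
  rw [h.monodromy, up_triv, H.rr_triv_left isRep_aux, H.rr_triv_right isRep_aux, mul_one, mul_one,
    H.ri_mul_rr isRep_aux (hf.isRep_tailProd le_rfl).up (commuting_aux_up _)]

theorem IsLatticeHom.tail_triv {D : H.K N →ₐ[ℂ] A} (h : H.IsLatticeHom N f i (triv G A) D) :
    D.toLinearMap ∘ₗ H.siteL N 0 = tailProd f (N - 1) := by
  rw [h.site_zero, convolve_triv]

section Concat

variable (hM : 1 ≤ M) (hN : 1 ≤ N) {D : H.K L →ₐ[ℂ] A} {φ : H.K M →ₐ[ℂ] A} {ψ : H.K N →ₐ[ℂ] A}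
  (hD : IsConcat D φ ψ)

include hM hD in
theorem IsConcat.amp_of_lt {ν : ℕ} (hν : ν < M) (hL : ν ≤ L) :
    amp G D (H.Uu L ν) = amp G φ (H.Uu M ν) := by
  have := congrArg Units.val (hD.holonomy ν hL)
  rwa [concatU, if_pos hν] at this

include hM hD in
theorem IsConcat.amp_of_ge {a : G →ₗ[ℂ] A} (ha : φ.toLinearMap ∘ₗ H.siteL M 0 = a) {k : ℕ}
    (hk : k + 1 < N) :
    amp G D (H.Uu L (M + k)) = amp G φ (H.Uu M M) * H.ri (aux A) (up a)
      * amp G ψ (H.Uu N (k + 1)) := by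
  subst ha
  have hL := hD.length
  have := congrArg Units.val (hD.holonomy (M + k) (by omega))
  rwa [concatU, if_neg (by omega), if_pos (by omega), Nat.add_sub_cancel_left] at this

include hM hN hD in
theorem IsConcat.amp_last {a : G →ₗ[ℂ] A} (ha : φ.toLinearMap ∘ₗ H.siteL M 0 = a) :
    amp G D (H.Uu L L) = amp G φ (H.Uu M M) * H.ri (aux A) (up a)
      * amp G ψ (H.Uu N N) * H.rr (aux A) (up a) := by
  subst ha
  have hL := hD.length
  have := congrArg Units.val (hD.holonomy L le_rfl)
  rwa [concatU, if_neg (by omega), if_neg (by omega)] at this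

include hM hD in
theorem IsConcat.site_of_lt {k : ℕ} (hk : k + 1 < M) (hL : k + 1 < L) :
    D.toLinearMap ∘ₗ H.siteL L (k + 1) = φ.toLinearMap ∘ₗ H.siteL M (k + 1) := by
  rw [hD.site _ hL, concatF, if_neg (by omega), if_pos hk]

include hM hD in
theorem IsConcat.site_of_ge {k : ℕ} (hk : k + 1 < N) :
    D.toLinearMap ∘ₗ H.siteL L (M + k) = ψ.toLinearMap ∘ₗ H.siteL N (k + 1) := by
  have hL := hD.length
  rw [hD.site _ (by omega), concatF, if_neg (by omega), if_neg (by omega), Nat.add_sub_cancel_left]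

include hM hN hD in
theorem IsConcat.site_zero :
    D.toLinearMap ∘ₗ H.siteL L 0
      = convolve (φ.toLinearMap ∘ₗ H.siteL M 0) (ψ.toLinearMap ∘ₗ H.siteL N 0) := by
  have hL := hD.length
  rw [hD.site _ (by omega), concatF, if_pos rfl]

variable (hf : IsFactorFamily (M - 1) f) (hg : IsFactorFamily (N - 1) g)
  (hfg : ∀ k < M - 1, ∀ l < N - 1, Commuting (f k) (g l))

include hM hN hD hf hg hfg

/-- For the vacuum on the left, `P` reduces to `R⁻¹` with its second leg acting by `ϑ_M`. This
merges with the `R⁻¹` of each holonomy on the right, because `(id ⊗ Δ)(R⁻¹)` factorizes. -/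
theorem IsConcat.isLatticeHom (hφ : H.IsLatticeHom M f (triv G A) (triv G A) φ)
    (hψ : H.IsLatticeHom N g i b ψ) : H.IsLatticeHom L (appendFamily (M - 1) f g) i b D := by
  have hL := hD.length
  have ht : IsRep (tailProd f (M - 1)) := hf.isRep_tailProd le_rfl
  have hc : ∀ k ≤ N - 1, Commuting (tailProd f (M - 1)) (tailProd g k) := fun k hk =>
    commuting_tailProd fun l hl => (commuting_tailProd fun l' hl' =>
      (hfg l hl l' (by omega)).symm).symm
  have ri_conv : ∀ k ≤ N - 1, H.ri (aux A) (up (convolve (tailProd f (M - 1)) (tailProd g k)))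
      = H.ri (aux A) (up (tailProd f (M - 1))) * H.ri (aux A) (up (tailProd g k)) := fun k hk => by
    rw [up_convolve, H.ri_convolve_right isRep_aux ht.up (hg.isRep_tailProd hk).up
      (commuting_aux_up _) (commuting_aux_up _) (hc k hk).up]
  have eL : L - 1 = M - 1 + (N - 1) := by omega
  refine ⟨fun k hk => ?_, ?_, fun k hk => ?_, ?_⟩
  · rcases Nat.lt_or_ge (k + 1) M with h1 | h1
    · rw [hD.amp_of_lt hM h1 (by omega), hφ.holonomy k h1, tailProd_append_of_le (by omega),
        appendFamily, if_pos (by omega)]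
    · obtain ⟨l, rfl⟩ := Nat.exists_eq_add_of_le (show M - 1 ≤ k by omega)
      rw [show M - 1 + l + 1 = M + l by omega, hD.amp_of_ge hM hφ.tail_triv (by omega),
        hφ.monodromy_triv hf, one_mul, hψ.holonomy l (by omega), tailProd_append,
        ri_conv l (by omega), appendFamily, if_neg (by omega), Nat.add_sub_cancel_left, mul_assoc]
  · rw [hD.amp_last hM hN hφ.tail_triv, hφ.monodromy_triv hf, one_mul, hψ.monodromy, eL,
      tailProd_append, ri_conv _ le_rfl, up_convolve, H.rr_convolve_right isRep_aux ht.up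
        (hg.isRep_tailProd le_rfl).up (commuting_aux_up _) (commuting_aux_up _) (hc _ le_rfl).up]
    simp only [mul_assoc]
  · rcases Nat.lt_or_ge (k + 1) M with h1 | h1
    · rw [hD.site_of_lt hM h1 hk, hφ.site k h1, appendFamily, if_pos (by omega)]
    · obtain ⟨l, rfl⟩ := Nat.exists_eq_add_of_le (show M - 1 ≤ k by omega)
      rw [show M - 1 + l + 1 = M + l by omega, hD.site_of_ge hM (by omega), hψ.site l (by omega),
        appendFamily, if_neg (by omega), Nat.add_sub_cancel_left]
  · rw [hD.site_zero hM hN, hφ.tail_triv, hψ.site_zero, eL, tailProd_append, convolve_assoc]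

/-- Conjugation with the braiding `R_{tj} R_{it}⁻¹` moves the last factor of the first lattice
past the second lattice. -/
theorem IsConcat.isLatticeHom_braided (hi : IsRep i) (hj : IsRep j) (hij : Commuting i j)
    (hfi : ∀ k < M - 1, Commuting (f k) i) (hfj : ∀ k < M - 1, Commuting (f k) j)
    (hgi : ∀ k < N - 1, Commuting (g k) i) (hgj : ∀ k < N - 1, Commuting (g k) j)
    (hψi : Commuting ψ i) (hψj : Commuting ψ j)
    (hφ : H.IsLatticeHom M f i (convolve i j) φ)
    (hψ : H.IsLatticeHom N g (triv G A) (triv G A) ψ) {D' : H.K L →ₐ[ℂ] A}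
    (hD' : ∀ x, D x * (H.rr (tailProd g (N - 1)) j * H.ri i (tailProd g (N - 1)))
      = H.rr (tailProd g (N - 1)) j * H.ri i (tailProd g (N - 1)) * D' x) :
    H.IsLatticeHom L (appendFamily (M - 1) f g) i (convolve i j) D' := by
  have hL := hD.length
  set s := tailProd f (M - 1) with hs
  set t := tailProd g (N - 1) with ht_def
  have hsr : IsRep s := hf.isRep_tailProd le_rfl
  have ht : IsRep t := hg.isRep_tailProd le_rfl
  have hit : Commuting i t := (commuting_tailProd fun l hl => hgi l hl).symm
  have hjt : Commuting j t := (commuting_tailProd fun l hl => hgj l hl).symm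
  have hft : ∀ k < M - 1, Commuting (f k) t := fun k hk =>
    (commuting_tailProd fun l hl => (hfg k hk l hl).symm).symm
  have hsi : Commuting s i := commuting_tailProd fun l hl => hfi l hl
  have hsj : Commuting s j := commuting_tailProd fun l hl => hfj l hl
  have hst : Commuting s t := commuting_tailProd fun l hl => hft l hl
  have hst' : ∀ k ≤ N - 1, Commuting s (tailProd g k) := fun k hk =>
    commuting_tailProd fun l hl => (commuting_tailProd fun l' hl' =>
      (hfg l hl l' (by omega)).symm).symm
  set P : A := H.rr t j * H.ri i t with hP
  have ca : ∀ k : G →ₗ[ℂ] A, Commuting (aux A) (up k) := commuting_aux_up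
  have hPup : (1 : G) ⊗ₜ[ℂ] P = H.rr (up t) (up j) * H.ri (up i) (up t) := by
    have : (1 : G) ⊗ₜ[ℂ] P
        = (Algebra.TensorProduct.includeRight : A →ₐ[ℂ] G ⊗[ℂ] A) (H.rr t j * H.ri i t) := rfl
    rw [this, map_mul, map_rr, map_ri]
    rfl
  -- `P` is invertible, so `D'` is determined by the intertwining relation, and every claim about
  -- `D'` becomes one about moving `P` through `D`.
  have cancel : ∀ X Y : G ⊗[ℂ] A, (1 : G) ⊗ₜ[ℂ] P * X = (1 : G) ⊗ₜ[ℂ] P * Y → X = Y := by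
    intro X Y h
    have h' := congrArg (((1 : G) ⊗ₜ[ℂ] (H.rr i t * H.ri t j)) * ·) h
    simp only [← mul_assoc (_ ⊗ₜ[ℂ] _), Algebra.TensorProduct.tmul_mul_tmul, mul_one] at h'
    rw [hP, H.braiding_inverse hi hj ht hit hjt, ← Algebra.TensorProduct.one_def, one_mul,
      one_mul] at h'
    exact h'
  have cancel' : ∀ X Y : A, P * X = P * Y → X = Y := by
    intro X Y h
    have h' := congrArg ((H.rr i t * H.ri t j) * ·) h
    simpa only [← mul_assoc, hP, H.braiding_inverse hi hj ht hit hjt, one_mul] using h'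
  have amp_eq : ∀ (X : G ⊗[ℂ] H.K L) (Y : G ⊗[ℂ] A),
      amp G D X * (1 : G) ⊗ₜ[ℂ] P = (1 : G) ⊗ₜ[ℂ] P * Y → amp G D' X = Y := fun X Y h =>
    cancel _ _ ((amp_mul_inr hD' X).symm.trans h)
  have map_eq : ∀ (x : H.K L) (y : A), D x * P = P * y → D' x = y := fun x y h =>
    cancel' _ _ ((hD' x).symm.trans h)
  -- Factors of the first lattice commute with `i`, `j` and `t`, and therefore with `P`.
  have cs : ∀ (k : ℕ), k ≤ M - 1 → ∀ Y, Commute (pr (aux A) (up (tailProd f k)) Y) ((1 : G) ⊗ₜ[ℂ] P) :=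
    fun k hk Y => commute_pr (fun x => commute_aux_inr x P)
      (fun x => commute_up_inr (fun ξ => (commuting_tailProd (k := k) (q := fun _ : Unit => P)
        (fun l hl y _ => (H.commute_braiding (fun x => (hfi l (by omega) y x).symm)
          (fun x => (hfj l (by omega) y x).symm) (fun x => (hft l (by omega) y x).symm)).symm))
        ξ ()) x) Y
  have csi : H.ri (aux A) (up s) * (1 : G) ⊗ₜ[ℂ] P = (1 : G) ⊗ₜ[ℂ] P * H.ri (aux A) (up s) :=
    (cs _ le_rfl _).eq
  have csr : H.rr (aux A) (up s) * (1 : G) ⊗ₜ[ℂ] P = (1 : G) ⊗ₜ[ℂ] P * H.rr (aux A) (up s) :=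
    (cs _ le_rfl _).eq
  have hφM : amp G φ (H.Uu M M) = H.ri (aux A) (up s)
      * (H.rr (up i) (aux A) * H.rr (aux A) (up i)) * H.rr (aux A) (up s) := hφ.monodromy
  have hφs : φ.toLinearMap ∘ₗ H.siteL M 0 = convolve s (convolve i j) := hφ.site_zero
  have hψs : ψ.toLinearMap ∘ₗ H.siteL N 0 = t := hψ.tail_triv
  have happ : ∀ l, tailProd (appendFamily (M - 1) f g) (M - 1 + l) = convolve s (tailProd g l) :=
    fun l => tailProd_append l
  have ri_a : H.ri (aux A) (up (convolve s (convolve i j)))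
      = H.ri (aux A) (up s) * (H.ri (aux A) (up i) * H.ri (aux A) (up j)) := by
    rw [up_convolve, up_convolve, H.ri_convolve_right isRep_aux hsr.up
      (hi.up.convolve hj.up hij.up) (ca _) ((ca _).convolve_right (ca _))
      (hsi.up.convolve_right hsj.up), H.ri_convolve_right isRep_aux hi.up hj.up (ca _) (ca _)
      hij.up]
  have hapL : tailProd (appendFamily (M - 1) f g) (L - 1) = convolve s t := by
    rw [show L - 1 = M - 1 + (N - 1) by omega]
    exact happ _
  refine ⟨fun k hk => amp_eq _ _ ?_, amp_eq _ _ ?_, fun k hk => LinearMap.ext fun ξ =>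
    map_eq _ _ ?_, LinearMap.ext fun ξ => map_eq _ _ ?_⟩
  · rcases Nat.lt_or_ge (k + 1) M with h1 | h1
    · rw [hD.amp_of_lt hM h1 (by omega), hφ.holonomy k h1, tailProd_append_of_le (by omega),
        appendFamily, if_pos (by omega)]
      exact (cs k (by omega) _).mul_left (commute_lTensor (fun x =>
        (H.commute_braiding (fun y => (hfi k (by omega) x y).symm)
          (fun y => (hfj k (by omega) x y).symm) (fun y => (hft k (by omega) x y).symm)).symm) _)
    · obtain ⟨l, rfl⟩ := Nat.exists_eq_add_of_le (show M - 1 ≤ k by omega)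
      have hY : ∀ ξ, convolve (aux A) (up t) ξ * amp G ψ (H.Uu N (l + 1))
          = amp G ψ (H.Uu N (l + 1)) * up t ξ := fun ξ => by
        have := ((H.isHolonomySystem_K hN).map ψ).tail (l + 1) ξ (by omega) (by omega)
        rwa [hψs] at this
      have hYc : ∀ {q : G →ₗ[ℂ] A}, Commuting ψ q → ∀ ξ,
          Commute (up q ξ) (amp G ψ (H.Uu N (l + 1))) := fun hq ξ =>
        (commute_lTensor (f := ψ.toLinearMap) (fun x => hq x ξ) _).symm
      have key := H.holonomy_braiding isRep_aux hi.up hj.up ht.up (ca i) (ca j) (ca t) hij.up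
        hit.up hjt.up hY (hYc hψi) (hYc hψj)
      rw [← hPup] at key
      -- In `φ(M) N_-` the right half of the monodromy cancels against the `s` and `i` parts of
      -- `N_-`. Of `R_{ia} R_{ai}` only `R_{ia}` survives, and the `j` part of `N_-` leaves
      -- `R_{aj}⁻¹`.
      have e : amp G D (H.Uu L (M + l))
          = H.ri (aux A) (up s) * (H.rr (up i) (aux A) * H.ri (aux A) (up j) * amp G ψ (H.Uu N (l + 1))) := by
        rw [hD.amp_of_ge hM hφs (by omega), hφM, ri_a]
        calc _ = H.ri (aux A) (up s) * H.rr (up i) (aux A) * (H.rr (aux A) (up i) * (H.rr (aux A) (up s) * H.ri (aux A) (up s))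
              * H.ri (aux A) (up i)) * H.ri (aux A) (up j) * amp G ψ (H.Uu N (l + 1)) := by
              simp only [mul_assoc]
          _ = _ := by
            rw [H.rr_mul_ri isRep_aux hsr.up (ca _), mul_one, H.rr_mul_ri isRep_aux hi.up (ca _),
              mul_one]
            simp only [mul_assoc]
      rw [show M - 1 + l + 1 = M + l by omega, e, mul_assoc, key, ← mul_assoc,
        csi, happ, up_convolve, H.ri_convolve_right isRep_aux hsr.up
        (hg.isRep_tailProd (by omega)).up (ca _) (ca _) (hst' l (by omega)).up, mul_assoc,
        hψ.holonomy l (by omega), appendFamily, if_neg (by omega), Nat.add_sub_cancel_left,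
        mul_assoc]
  -- The vacuum has monodromy `1`, so `N_-` meets its inverse and the glued monodromy is the one of
  -- the first lattice; conjugation by `P` then supplies the missing `R_{at}`.
  · have e : amp G D (H.Uu L L) = amp G φ (H.Uu M M) := by
      rw [hD.amp_last hM hN hφs, hψ.monodromy_triv hg, mul_one, mul_assoc,
        H.ri_mul_rr isRep_aux (hsr.convolve (hi.convolve hj hij)
          (hsi.convolve_right hsj)).up (ca _), mul_one]
    have key := H.monodromy_braiding isRep_aux hi.up hj.up ht.up (ca i) (ca j) (ca t) hij.up
        hit.up hjt.up
    rw [← hPup] at key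
    rw [e, hφM, hapL, up_convolve, H.ri_convolve_right isRep_aux hsr.up ht.up (ca _)
      (ca _) hst.up, H.rr_convolve_right isRep_aux hsr.up ht.up (ca _) (ca _) hst.up,
      mul_assoc, csr, mul_assoc, ← mul_assoc _ _ (H.rr (aux A) (up s)), key]
    simp only [← mul_assoc]
    rw [csi]
  · rcases Nat.lt_or_ge (k + 1) M with h1 | h1
    · have e : D (H.siteL L (k + 1) ξ) = f k (headOp ξ) :=
        LinearMap.congr_fun ((hD.site_of_lt hM h1 hk).trans (hφ.site k h1)) ξ
      rw [e, appendFamily, if_pos (by omega)]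
      exact (H.commute_braiding (fun y => (hfi k (by omega) _ y).symm)
          (fun y => (hfj k (by omega) _ y).symm) (fun y => (hft k (by omega) _ y).symm)).symm
    · obtain ⟨l, rfl⟩ := Nat.exists_eq_add_of_le (show M - 1 ≤ k by omega)
      have e : D (H.siteL L (M + l) ξ) = g l (headOp ξ) :=
        LinearMap.congr_fun ((hD.site_of_ge hM (k := l) (by omega)).trans
          (hψ.site l (by omega))) ξ
      rw [show M - 1 + l + 1 = M + l by omega, e, appendFamily, if_neg (by omega), Nat.add_sub_cancel_left]
      have hc := ((H.isHolonomySystem_K hN).map ψ).comm 0 (by omega) (l + 1) (by omega) (by omega)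
      rw [hψs, hψ.site l (by omega)] at hc
      exact (H.commute_braiding (fun y => (hgi l (by omega) _ y).symm)
          (fun y => (hgj l (by omega) _ y).symm) (fun y => hc y ξ)).symm
  · have e : D (H.siteL L 0 ξ) = convolve (convolve s (convolve i j)) t ξ := by
      rw [← hφs, ← hψs]
      exact LinearMap.congr_fun (hD.site_zero hM hN) ξ
    rw [e, hapL, convolve_assoc, convolve_assoc s]
    exact convolve_intertwine (fun x => (H.commute_braiding (fun y => (hsi x y).symm)
      (fun y => (hsj x y).symm) (fun y => (hst x y).symm)).symm)
      (fun x => H.convolve_braiding hi hj ht hij hit hjt x) ξ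

end Concat

end RibbonStructure

end LatticeHom

/-! ### Lattice representations of short lattices -/

section ShortLattices

variable {G : Type u} [Ring G] [HopfAlgebra ℂ G]
variable {A : Type*} [Ring A] [Algebra ℂ A] {B : Type*} [Ring B] [Algebra ℂ B]

theorem map_tailProd (χ : A →ₐ[ℂ] B) (f : ℕ → EndDual G →ₗ[ℂ] A) (k : ℕ) :
    χ.toLinearMap ∘ₗ tailProd f k = tailProd (fun l => χ.toLinearMap ∘ₗ f l) k := by
  induction k with
  | zero => exact map_triv χ
  | succ k ih => rw [tailProd, tailProd, map_convolve, ih]; rfl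

theorem tailProd_congr {f g : ℕ → EndDual G →ₗ[ℂ] A} {k : ℕ} (h : ∀ l < k, f l = g l) :
    tailProd f k = tailProd g k := by
  induction k with
  | zero => rfl
  | succ k ih => rw [tailProd, tailProd, ih fun l hl => h l (by omega), h k (by omega)]

theorem IsFactorFamily.map {n : ℕ} {f : ℕ → EndDual G →ₗ[ℂ] A} (h : IsFactorFamily n f)
    (χ : A →ₐ[ℂ] B) : IsFactorFamily n fun l => χ.toLinearMap ∘ₗ f l where
  one k hk := by simp [h.one k hk]
  mul k hk x y := by simp [h.mul k hk]
  comm k hk l hl hkl x y := (h.comm k hk l hl hkl x y).map χ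

theorem amp_lTensor (χ : A →ₐ[ℂ] B) {E : Type*} [AddCommGroup E] [Module ℂ E] (f : E →ₗ[ℂ] A)
    (Z : G ⊗[ℂ] E) : amp G χ (LinearMap.lTensor G f Z)
      = LinearMap.lTensor G (χ.toLinearMap ∘ₗ f) Z := by
  induction Z with
  | zero => simp
  | add x y hx hy => simp only [map_add, hx, hy]
  | tmul x y => simp

variable [Module.Finite ℂ G]

namespace RibbonStructure

variable {H : RibbonStructure G}

theorem IsLatticeHom.map {N : ℕ} {f : ℕ → EndDual G →ₗ[ℂ] A} {i b : G →ₗ[ℂ] A}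
    {D : H.K N →ₐ[ℂ] A} (h : H.IsLatticeHom N f i b D) (χ : A →ₐ[ℂ] B) :
    H.IsLatticeHom N (fun l => χ.toLinearMap ∘ₗ f l) (χ.toLinearMap ∘ₗ i) (χ.toLinearMap ∘ₗ b)
      (χ.comp D) where
  holonomy k hk := by
    rw [amp_comp, h.holonomy k hk, map_mul, amp_lTensor, map_ri, amp_comp_aux, amp_comp_up,
      map_tailProd]
  monodromy := by
    rw [amp_comp, h.monodromy, map_mul, map_mul, map_mul, map_ri, map_rr, map_rr, map_rr,
      amp_comp_aux, amp_comp_up, map_tailProd, amp_comp_up]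
  site k hk := by
    rw [LinearMap.comp_assoc, ← h.site k hk]; rfl
  site_zero := by
    rw [← map_tailProd, ← map_convolve, ← h.site_zero]; rfl

theorem IsLatticeHom.congr {N : ℕ} {f g : ℕ → EndDual G →ₗ[ℂ] A} {i b : G →ₗ[ℂ] A}
    {D : H.K N →ₐ[ℂ] A} (h : H.IsLatticeHom N f i b D) (hfg : ∀ k, k + 1 < N → f k = g k) :
    H.IsLatticeHom N g i b D where
  holonomy k hk := by
    rw [h.holonomy k hk, tailProd_congr fun l hl => hfg l (by omega), hfg k hk]
  monodromy := by
    rw [h.monodromy, tailProd_congr fun l hl => hfg l (by omega)]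
  site k hk := by rw [h.site k hk, hfg k hk]
  site_zero := by rw [h.site_zero, tailProd_congr fun l hl => hfg l (by omega)]

variable (H)

/-- Here `ϑ_1 = ε`, so the prefactor of `D(U_1)` is `1`, and with a trivial action `i` the monodromy
is `1` as well: the formulas are those of the representation on `ℜ`. -/
theorem exists_isLatticeHom_two (χ : EndDual G →ₐ[ℂ] A) {f : ℕ → EndDual G →ₗ[ℂ] A}
    (hf : f 0 = χ.toLinearMap) :
    ∃ D : H.K 2 →ₐ[ℂ] A, H.IsLatticeHom 2 f (triv G A) (triv G A) D := by
  obtain ⟨D, hU, hs⟩ := H.isHolonomySystem_regular.exists_lift (by norm_num)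
  have e : tailProd f 1 = χ.toLinearMap ∘ₗ tailOp := by
    rw [tailProd, tailProd, triv_convolve, hf]
  have hr : IsRep (χ.toLinearMap ∘ₗ tailOp (G := G)) := isRep_tailOp.comp χ
  refine ⟨χ.comp D, fun k hk => ?_, ?_, fun k hk => LinearMap.ext fun ξ => ?_,
    LinearMap.ext fun ξ => ?_⟩
  · obtain rfl : k = 0 := by omega
    have h := congrArg Units.val (hU 1 (by norm_num))
    rw [coe_ampU, regularU, if_neg one_ne_zero, if_pos rfl, coe_holonomyUnit] at h
    rw [amp_comp, zero_add, h, tailProd, up_triv, H.ri_triv_right isRep_aux, one_mul, hf]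
    rfl
  · have h := congrArg Units.val (hU 2 le_rfl)
    rw [coe_ampU, regularU, if_neg two_ne_zero, if_neg (by norm_num), Units.val_one] at h
    rw [amp_comp, h, map_one, up_triv, H.rr_triv_left isRep_aux, H.rr_triv_right isRep_aux,
      mul_one, mul_one, e, H.ri_mul_rr isRep_aux hr.up (commuting_aux_up _)]
  · obtain rfl : k = 0 := by omega
    have h := hs 1 (by norm_num) ξ
    rw [hf]
    exact congrArg χ h
  · have h := hs 0 (by norm_num) ξ
    rw [convolve_triv, e]
    exact congrArg χ h

/-- Two Yang-Baxter moves carry `R_{12}` to the front. This is the twisted functoriality of the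
monodromy `R'R`. -/
theorem funct_monodromy {a₁ a₂ i : G →ₗ[ℂ] B} (h₁ : IsRep a₁) (h₂ : IsRep a₂) (hi : IsRep i)
    (h₁₂ : Commuting a₁ a₂) (h₁i : Commuting a₁ i) (h₂i : Commuting a₂ i) :
    H.rr i a₁ * H.rr a₁ i * H.rr a₁ a₂ * (H.rr i a₂ * H.rr a₂ i)
      = H.rr a₁ a₂ * (H.rr i a₂ * H.rr i a₁ * (H.rr a₁ i * H.rr a₂ i)) := by
  have y1 := H.yang_baxter h₁ hi h₂ h₁i h₁₂ h₂i.symm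
  have y2 := H.yang_baxter hi h₁ h₂ h₁i.symm h₂i.symm h₁₂
  calc _ = H.rr i a₁ * (H.rr a₁ i * (H.rr a₁ a₂ * H.rr i a₂)) * H.rr a₂ i := by
        simp only [mul_assoc]
    _ = (H.rr i a₁ * (H.rr i a₂ * H.rr a₁ a₂)) * H.rr a₁ i * H.rr a₂ i := by
        rw [y1]; simp only [mul_assoc]
    _ = _ := by rw [y2]; simp only [mul_assoc]

/-- At length `1` only two exchange relations survive: twisted functoriality, and commutation with
the action of the site `0`. The latter holds because `R'R` commutes with coproducts and does not
involve `j`. -/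
theorem exists_isLatticeHom_one {i j : G →ₗ[ℂ] A} (hi : IsRep i) (hj : IsRep j)
    (hij : Commuting i j) (f : ℕ → EndDual G →ₗ[ℂ] A) :
    ∃ D : H.K 1 →ₐ[ℂ] A, H.IsLatticeHom 1 f i (convolve i j) D := by
  have ca : ∀ k : G →ₗ[ℂ] A, Commuting (aux A) (up k) := commuting_aux_up
  let X : (G ⊗[ℂ] A)ˣ := H.ru hi.up isRep_aux (ca i).symm * H.ru isRep_aux hi.up (ca i)
  have hX : (X : G ⊗[ℂ] A) = H.rr (up i) (aux A) * H.rr (aux A) (up i) := rfl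
  have sys : H.IsHolonomySystem 1 (fun n => if n = 0 then H.va A else X)
      (fun _ => convolve i j) := by
    refine ⟨fun _ _ => hi.convolve hj hij, fun n hn m hm => by omega, rfl,
      fun ν ξ h1 h2 => by omega, fun ξ => ?_, fun ν ξ h1 h2 => by omega,
      fun ν μ ξ h1 h2 h3 h4 => by omega, fun ν h1 h2 => by omega, ?_,
      fun ν μ h1 h2 h3 => by omega, fun ν h1 h2 => by omega⟩
    · rw [if_neg one_ne_zero, hX, up_convolve, ← convolve_assoc]
      refine commute_convolve (fun x => ?_) (fun x => ?_) ξ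
      · change _ * _ = _ * _
        rw [← mul_assoc, ← H.rr_mul_convolve hi.up isRep_aux (ca i).symm, mul_assoc,
          ← H.rr_mul_convolve isRep_aux hi.up (ca i), mul_assoc]
      · have c1 : ∀ y, Commute (up i y) (up j x) := fun y => hij.up y x
        have c2 : ∀ y, Commute (aux A y) (up j x) := fun y => ca j y x
        exact ((H.commute_rr c1 c2).mul_left (H.commute_rr c2 c1)).symm
    · refine Units.ext ?_
      rw [if_neg one_ne_zero]
      simp only [Units.val_mul, coe_l₁₃, coe_l₂₃, coe_cm, coe_r₁₂, hX]
      have e13 : leg13 (H.rr (up i) (aux A) * H.rr (aux A) (up i))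
          = H.rr (upp i) (slot₁ A) * H.rr (slot₁ A) (upp i) := by
        rw [map_mul, map_rr, map_rr]; rfl
      have e23 : leg23 (H.rr (up i) (aux A) * H.rr (aux A) (up i))
          = H.rr (upp i) (slot₂ A) * H.rr (slot₂ A) (upp i) := by
        rw [map_mul, map_rr, map_rr]; rfl
      have ec : comulAux (H.rr (up i) (aux A) * H.rr (aux A) (up i))
          = H.rr (upp i) (slot₂ A) * H.rr (upp i) (slot₁ A)
            * (H.rr (slot₁ A) (upp i) * H.rr (slot₂ A) (upp i)) := by
        have e1 : (comulAux (A := A)).toLinearMap ∘ₗ up i = upp i :=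
          LinearMap.ext fun x => comulAux_up i x
        have e2 : (comulAux (A := A)).toLinearMap ∘ₗ aux (G := G) A
            = convolve (slot₁ A) (slot₂ A) := LinearMap.ext fun x => comulAux_aux x
        rw [map_mul, map_rr, map_rr, e1, e2, H.rr_convolve_right hi.upp isRep_slot₁ isRep_slot₂
            (commuting_slot₁_upp i).symm (commuting_slot₂_upp i).symm commuting_slot₁_slot₂,
          H.rr_convolve_left isRep_slot₁ isRep_slot₂ hi.upp commuting_slot₁_slot₂
            (commuting_slot₁_upp i) (commuting_slot₂_upp i)]
      rw [e13, e23, ec]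
      exact H.funct_monodromy isRep_slot₁ isRep_slot₂ hi.upp commuting_slot₁_slot₂
        (commuting_slot₁_upp i) (commuting_slot₂_upp i)
  obtain ⟨D, hU, hs⟩ := sys.exists_lift le_rfl
  refine ⟨D, fun k hk => by omega, ?_, fun k hk => by omega, LinearMap.ext fun ξ => ?_⟩
  · have h := congrArg Units.val (hU 1 le_rfl)
    rw [coe_ampU, if_neg one_ne_zero, hX] at h
    rw [h, Nat.sub_self, tailProd, up_triv, H.ri_triv_right isRep_aux,
      H.rr_triv_right isRep_aux, one_mul, mul_one]
  · rw [Nat.sub_self, tailProd, triv_convolve]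
    exact hs 0 one_pos ξ

end RibbonStructure

end ShortLattices

/-! ### Operators on one factor of a tensor power -/

section Factors

variable {X : Type*} [AddCommGroup X] [Module ℂ X] {κ κ' κ'' : Type*} [DecidableEq κ]
  [DecidableEq κ'] [DecidableEq κ'']

/-- The operator which acts on the factor `k` of a tensor power. -/
def piFactor (k : κ) : Module.End ℂ X →ₗ[ℂ] Module.End ℂ (⨂[ℂ] _ : κ, X) :=
  (PiTensorProduct.mapMultilinear ℂ (fun _ : κ => X) (fun _ => X)).toLinearMap
    (fun _ => LinearMap.id) k

theorem piFactor_tprod (k : κ) (T : Module.End ℂ X) (x : κ → X) :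
    piFactor k T (PiTensorProduct.tprod ℂ x)
      = PiTensorProduct.tprod ℂ (Function.update x k (T (x k))) := by
  have : piFactor k T (PiTensorProduct.tprod ℂ x)
      = PiTensorProduct.map (Function.update (fun _ => LinearMap.id) k T)
        (PiTensorProduct.tprod ℂ x) := rfl
  rw [this, PiTensorProduct.map_tprod]
  congr 1
  funext l
  rcases eq_or_ne l k with rfl | h
  · simp
  · simp [h]

theorem piFactor_one (k : κ) : piFactor k (1 : Module.End ℂ X) = 1 := by
  ext x
  simp [piFactor_tprod]

theorem piFactor_mul (k : κ) (S T : Module.End ℂ X) :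
    piFactor k (S * T) = piFactor k S * piFactor k T := by
  ext x
  simp [piFactor_tprod]

theorem piFactor_comm {k l : κ} (h : k ≠ l) (S T : Module.End ℂ X) :
    Commute (piFactor k S) (piFactor l T) := by
  refine PiTensorProduct.ext (MultilinearMap.ext fun x => ?_)
  simp [piFactor_tprod, h, h.symm, Function.update_comm h]

/-- The concatenation of tensor powers. -/
def piConcat (σ : κ ⊕ κ' ≃ κ'') :
    (⨂[ℂ] _ : κ, X) ⊗[ℂ] (⨂[ℂ] _ : κ', X) ≃ₗ[ℂ] ⨂[ℂ] _ : κ'', X :=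
  (PiTensorProduct.tmulEquiv ℂ X).trans (PiTensorProduct.reindex ℂ (fun _ => X) σ)

theorem piConcat_tprod (σ : κ ⊕ κ' ≃ κ'') (x : κ → X) (y : κ' → X) :
    piConcat σ (PiTensorProduct.tprod ℂ x ⊗ₜ[ℂ] PiTensorProduct.tprod ℂ y)
      = PiTensorProduct.tprod ℂ (Sum.elim x y ∘ σ.symm) := by
  rw [piConcat, LinearEquiv.trans_apply, PiTensorProduct.tmulEquiv_apply,
    PiTensorProduct.reindex_tprod]
  rfl

theorem piConcat_piFactor_left (σ : κ ⊕ κ' ≃ κ'') (k : κ) (T : Module.End ℂ X)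
    (s : ⨂[ℂ] _ : κ, X) (t : ⨂[ℂ] _ : κ', X) :
    piConcat σ (piFactor k T s ⊗ₜ[ℂ] t) = piFactor (σ (Sum.inl k)) T (piConcat σ (s ⊗ₜ[ℂ] t)) := by
  induction s using PiTensorProduct.induction_on with
  | add s s' h h' => simp only [map_add, TensorProduct.add_tmul, h, h']
  | smul_tprod c x =>
    induction t using PiTensorProduct.induction_on with
    | add t t' h h' => simp only [map_add, TensorProduct.tmul_add, h, h']
    | smul_tprod d y =>
      simp only [map_smul, ← TensorProduct.smul_tmul', TensorProduct.tmul_smul, piFactor_tprod,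
        piConcat_tprod]
      congr 3
      rw [Sum.elim_update_left, Function.update_comp_equiv]
      simp

theorem piConcat_piFactor_right (σ : κ ⊕ κ' ≃ κ'') (k : κ') (T : Module.End ℂ X)
    (s : ⨂[ℂ] _ : κ, X) (t : ⨂[ℂ] _ : κ', X) :
    piConcat σ (s ⊗ₜ[ℂ] piFactor k T t) = piFactor (σ (Sum.inr k)) T (piConcat σ (s ⊗ₜ[ℂ] t)) := by
  induction s using PiTensorProduct.induction_on with
  | add s s' h h' => simp only [map_add, TensorProduct.add_tmul, h, h']
  | smul_tprod c x =>
    induction t using PiTensorProduct.induction_on with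
    | add t t' h h' => simp only [map_add, TensorProduct.tmul_add, h, h']
    | smul_tprod d y =>
      simp only [map_smul, ← TensorProduct.smul_tmul', TensorProduct.tmul_smul, piFactor_tprod,
        piConcat_tprod]
      congr 3
      rw [Sum.elim_update_right, Function.update_comp_equiv]
      simp

end Factors

/-! ### Lattice representations as lattice homomorphisms -/

section Transport

/-- Endomorphisms of a tensor product of vector spaces form a ring. -/
instance instRingEndTensorProduct {V V' : Type*} [AddCommMonoid V] [Module ℂ V] [AddCommMonoid V']
    [Module ℂ V'] : Ring (Module.End ℂ (V ⊗[ℂ] V')) := Algebra.semiringToRing ℂ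

variable {G : Type u} [Ring G] [HopfAlgebra ℂ G] [Module.Finite ℂ G]
variable {VI VJ : Type*} [AddCommGroup VI] [Module ℂ VI] [AddCommGroup VJ] [Module ℂ VJ]

variable (G VI VJ) in
/-- The actions on the factors `ℜ` of `W_N^{IJ}`. -/
def factorFamily (N k : ℕ) : EndDual G →ₗ[ℂ] Module.End ℂ (W G N VI VJ) :=
  if h : k < N - 1 then onFactor N VI VJ ⟨k, h⟩ else 0

theorem factorFamily_of_lt {N k : ℕ} (h : k < N - 1) :
    factorFamily G VI VJ N k = onFactor N VI VJ ⟨k, h⟩ := dif_pos h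

theorem onFactor_tmul {N : ℕ} (k : Fin (N - 1)) (T : EndDual G)
    (s : ⨂[ℂ] _ : Fin (N - 1), Module.Dual ℂ G) (w : VI ⊗[ℂ] VJ) :
    onFactor N VI VJ k T (s ⊗ₜ[ℂ] w) = piFactor k T s ⊗ₜ[ℂ] w := rfl

theorem onFactor_eq {N : ℕ} (k : Fin (N - 1)) (T : EndDual G) :
    onFactor N VI VJ k T = Module.End.rTensorAlgHom ℂ _ (VI ⊗[ℂ] VJ) (piFactor k T) := rfl

theorem onLast_tmul {N : ℕ} (T : Module.End ℂ (VI ⊗[ℂ] VJ))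
    (s : ⨂[ℂ] _ : Fin (N - 1), Module.Dual ℂ G) (w : VI ⊗[ℂ] VJ) :
    onLast (G := G) N T (s ⊗ₜ[ℂ] w) = s ⊗ₜ[ℂ] T w := rfl

theorem isFactorFamily_factorFamily (N : ℕ) :
    IsFactorFamily (N - 1) (factorFamily G VI VJ N) where
  one k hk := by rw [factorFamily_of_lt hk, onFactor_eq, piFactor_one, map_one]
  mul k hk x y := by
    simp only [factorFamily_of_lt hk, onFactor_eq]
    rw [piFactor_mul, map_mul]
  comm k hk l hl hkl x y := by
    simp only [factorFamily_of_lt hk, factorFamily_of_lt hl, onFactor_eq]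
    exact (piFactor_comm (by simpa using hkl) x y).map _

theorem commuting_factorFamily_onLast {N k : ℕ} (hk : k < N - 1) :
    Commuting (factorFamily G VI VJ N k) (onLast (G := G) (VI := VI) (VJ := VJ) N) := fun x y => by
  rw [factorFamily_of_lt hk]
  exact TensorProduct.ext' fun s w => by
    simp only [Module.End.mul_apply, onLast_tmul, onFactor_tmul]

theorem theta_eq {N : ℕ} : ∀ (k : ℕ) (h : k ≤ N - 1),
    theta N VI VJ k h = tailProd (factorFamily G VI VJ N) k
  | 0, _ => rfl
  | k + 1, h => by rw [theta, tailProd, theta_eq k, factorFamily_of_lt h]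

/-- The action of `G` on the factor `V^I` of `W_N^{IJ}`. -/
def firstAct (N : ℕ) (τI : G →ₐ[ℂ] Module.End ℂ VI) : G →ₐ[ℂ] Module.End ℂ (W G N VI VJ) :=
  (onLast N).comp ((Module.End.rTensorAlgHom ℂ VI VJ).comp τI)

/-- The action of `G` on the factor `V^J` of `W_N^{IJ}`. -/
def secondAct (N : ℕ) (τJ : G →ₐ[ℂ] Module.End ℂ VJ) : G →ₐ[ℂ] Module.End ℂ (W G N VI VJ) :=
  (onLast N).comp ((Module.End.lTensorAlgHom ℂ VJ VI).comp τJ)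

theorem commuting_firstAct_secondAct (N : ℕ) (τI : G →ₐ[ℂ] Module.End ℂ VI)
    (τJ : G →ₐ[ℂ] Module.End ℂ VJ) :
    Commuting (firstAct (VJ := VJ) N τI).toLinearMap (secondAct (VI := VI) N τJ).toLinearMap :=
  fun x y => by
    refine Commute.map (x := Module.End.rTensorAlgHom ℂ VI VJ (τI x))
      (y := Module.End.lTensorAlgHom ℂ VJ VI (τJ y)) ?_ (onLast N)
    exact TensorProduct.ext' fun _ _ => rfl

theorem onLast_comp_boxRep (N : ℕ) (τI : G →ₐ[ℂ] Module.End ℂ VI)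
    (τJ : G →ₐ[ℂ] Module.End ℂ VJ) :
    (onLast N).toLinearMap ∘ₗ (boxRep τI τJ).toLinearMap
      = convolve (firstAct (VJ := VJ) N τI).toLinearMap
        (secondAct (VI := VI) N τJ).toLinearMap := by
  have key : ∀ Y : G ⊗[ℂ] G, Module.endTensorEndAlgHom (R := ℂ) (S := ℂ) (A := ℂ) (M := VI) (N := VJ)
      (Algebra.TensorProduct.map τI τJ Y)
      = pr ((Module.End.rTensorAlgHom ℂ VI VJ).comp τI).toLinearMap
        ((Module.End.lTensorAlgHom ℂ VJ VI).comp τJ).toLinearMap Y := fun Y => by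
    induction Y with
    | zero => simp
    | add x y hx hy => simp only [map_add, hx, hy]
    | tmul x y =>
      rw [pr_tmul]
      exact TensorProduct.ext' fun _ _ => rfl
  ext1 ξ
  exact (congrArg (onLast N) (key (Δ G ξ))).trans (map_pr (onLast N) _ _ _)

namespace RibbonStructure

variable (H : RibbonStructure G)

theorem map_monodromyOp (N : ℕ) (τI : G →ₐ[ℂ] Module.End ℂ VI) :
    amp G (onLast N) (H.monodromyOp (VJ := VJ) τI)
      = H.rr (up (firstAct (VJ := VJ) N τI).toLinearMap) (aux _)
        * H.rr (aux _) (up (firstAct N τI).toLinearMap) := by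
  rw [monodromyOp, ← amp_comp, monodromy, map_id_eq, pr_mul isRep_aux (IsRep.ofAlgHom _).up
    (commuting_aux_up _), pr_flip (commuting_aux_up _).symm]
  rfl

variable {H} in
-- Replaces the concrete tensor spaces by commuting actions in one algebra, so that algebra
-- homomorphisms, in particular conjugations by isomorphisms of spaces, can be applied.
theorem isLatticeRep_iff {N : ℕ} (hN : 1 ≤ N) (τI : G →ₐ[ℂ] Module.End ℂ VI)
    (τJ : G →ₐ[ℂ] Module.End ℂ VJ) (D : H.K N →ₐ[ℂ] Module.End ℂ (W G N VI VJ)) :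
    H.IsLatticeRep τI τJ D ↔ H.IsLatticeHom N (factorFamily G VI VJ N) (firstAct N τI).toLinearMap
      (convolve (firstAct N τI).toLinearMap (secondAct N τJ).toLinearMap) D := by
  constructor
  · intro h
    refine ⟨fun k hk => ?_, ?_, fun k hk => LinearMap.ext fun ξ => ?_, LinearMap.ext fun ξ => ?_⟩
    · have e := h.holonomy ⟨k, by omega⟩
      rw [H.U_eq N (by omega), lTensor_eq, theta_eq] at e
      rw [factorFamily_of_lt (by omega)]
      exact e
    · have e := h.monodromy
      rw [M, H.U_eq N hN, lTensor_eq, lTensor_eq, theta_eq, map_monodromyOp] at e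
      exact e
    · rw [factorFamily_of_lt (by omega)]
      exact h.site ⟨k, by omega⟩ ξ
    · have e := h.site_zero ξ
      rw [onLast_comp_boxRep, theta_eq] at e
      rw [← e, siteL, Nat.cast_zero]
      rfl
  · intro h
    refine ⟨fun k => ?_, ?_, fun k ξ => ?_, fun ξ => ?_⟩
    · have e := h.holonomy k (by omega)
      rw [factorFamily_of_lt k.2] at e
      rw [H.U_eq N (by omega), lTensor_eq, theta_eq]
      exact e
    · have e := h.monodromy
      rw [M, H.U_eq N hN, lTensor_eq, lTensor_eq, theta_eq, map_monodromyOp]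
      exact e
    · have e := LinearMap.congr_fun (h.site k (by omega)) ξ
      rw [factorFamily_of_lt k.2] at e
      exact e
    · have e := LinearMap.congr_fun h.site_zero ξ
      rw [onLast_comp_boxRep, theta_eq, ← e, siteL, Nat.cast_zero]
      rfl

end RibbonStructure

end Transport

/-! ### Tensor products of lattice representations -/

section Concatenation

variable {G : Type u} [Ring G] [HopfAlgebra ℂ G]

/-- The conjugate of a homomorphism by a unit. -/
def conjBy {A C : Type*} [Ring A] [Algebra ℂ A] [Ring C] [Algebra ℂ C] (Ψ : Aˣ) (D : C →ₐ[ℂ] A) :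
    C →ₐ[ℂ] A :=
  AlgHom.ofLinearMap (LinearMap.mulLeft ℂ (↑Ψ⁻¹ : A) ∘ₗ LinearMap.mulRight ℂ (Ψ : A) ∘ₗ
    D.toLinearMap) (by simp) (fun x y => by simp [mul_assoc])

theorem mul_conjBy {A C : Type*} [Ring A] [Algebra ℂ A] [Ring C] [Algebra ℂ C] (Ψ : Aˣ)
    (D : C →ₐ[ℂ] A) (x : C) : D x * Ψ = Ψ * conjBy Ψ D x := by
  simp [conjBy]

variable {V V' Y Y' : Type*} [AddCommMonoid V] [Module ℂ V] [AddCommMonoid V'] [Module ℂ V']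
  [AddCommMonoid Y] [Module ℂ Y] [AddCommMonoid Y'] [Module ℂ Y']

theorem conj_eq_iff (e : V ⊗[ℂ] V' ≃ₗ[ℂ] Y ⊗[ℂ] Y') (Z : Module.End ℂ (V ⊗[ℂ] V')) (T : Module.End ℂ (Y ⊗[ℂ] Y')) :
    e.conjAlgEquiv ℂ Z = T ↔ ∀ p q, e (Z (p ⊗ₜ[ℂ] q)) = T (e (p ⊗ₜ[ℂ] q)) := by
  constructor
  · rintro rfl p q
    simp [LinearEquiv.conjAlgEquiv_apply]
  · intro h
    have h2 : e.toLinearMap ∘ₗ Z = T ∘ₗ e.toLinearMap := TensorProduct.ext' h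
    refine LinearMap.ext fun x => ?_
    simpa [LinearEquiv.conjAlgEquiv_apply] using LinearMap.congr_fun h2 (e.symm x)

/-- Operators on the first factor, regarded as operators on a space isomorphic to the tensor
product. -/
def viaLeft (e : V ⊗[ℂ] V' ≃ₗ[ℂ] Y ⊗[ℂ] Y') : Module.End ℂ V →ₐ[ℂ] Module.End ℂ (Y ⊗[ℂ] Y') :=
  (e.conjAlgEquiv ℂ).toAlgHom.comp (Module.End.rTensorAlgHom ℂ V V')

/-- Operators on the second factor, regarded as operators on a space isomorphic to the tensor
product. -/
def viaRight (e : V ⊗[ℂ] V' ≃ₗ[ℂ] Y ⊗[ℂ] Y') : Module.End ℂ V' →ₐ[ℂ] Module.End ℂ (Y ⊗[ℂ] Y') :=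
  (e.conjAlgEquiv ℂ).toAlgHom.comp (Module.End.lTensorAlgHom ℂ V' V)

theorem viaLeft_eq_iff (e : V ⊗[ℂ] V' ≃ₗ[ℂ] Y ⊗[ℂ] Y') (Z : Module.End ℂ V) (T : Module.End ℂ (Y ⊗[ℂ] Y')) :
    viaLeft e Z = T ↔ ∀ p q, e (Z p ⊗ₜ[ℂ] q) = T (e (p ⊗ₜ[ℂ] q)) :=
  conj_eq_iff e _ T

theorem viaRight_eq_iff (e : V ⊗[ℂ] V' ≃ₗ[ℂ] Y ⊗[ℂ] Y') (Z : Module.End ℂ V') (T : Module.End ℂ (Y ⊗[ℂ] Y')) :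
    viaRight e Z = T ↔ ∀ p q, e (p ⊗ₜ[ℂ] Z q) = T (e (p ⊗ₜ[ℂ] q)) :=
  conj_eq_iff e _ T

theorem commuting_viaLeft_viaRight (e : V ⊗[ℂ] V' ≃ₗ[ℂ] Y ⊗[ℂ] Y') :
    Commuting (viaLeft e) (viaRight e) := fun x y => by
  refine Commute.map (x := Module.End.rTensorAlgHom ℂ V V' x)
      (y := Module.End.lTensorAlgHom ℂ V' V y) ?_ (e.conjAlgEquiv ℂ)
  exact TensorProduct.ext' fun _ _ => rfl

variable [Module.Finite ℂ G] {H : RibbonStructure G} {L M N : ℕ}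

namespace RibbonStructure

theorem isConcat_tensorRep (hL : L + 1 = M + N) (hM : 1 ≤ M) (hN : 1 ≤ N)
    {Λ : H.K L →ₐ[ℂ] H.K M ⊗[ℂ] H.K N} (h : H.IsCoproduct Λ) (D : H.K M →ₐ[ℂ] Module.End ℂ V)
    (D' : H.K N →ₐ[ℂ] Module.End ℂ V') (e : V ⊗[ℂ] V' ≃ₗ[ℂ] Y ⊗[ℂ] Y') :
    IsConcat ((e.conjAlgEquiv ℂ).toAlgHom.comp (tensorRep Λ D D')) ((viaLeft e).comp D)
      ((viaRight e).comp D') := by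
  have := h.isConcat hL hM hN ((e.conjAlgEquiv ℂ).toAlgHom.comp
    ((Module.endTensorEndAlgHom (R := ℂ) (S := ℂ) (A := ℂ) (M := V) (N := V')).comp
      (Algebra.TensorProduct.map D D')))
  have e1 : (viaLeft e).comp D = (((e.conjAlgEquiv ℂ).toAlgHom.comp
      ((Module.endTensorEndAlgHom (R := ℂ) (S := ℂ) (A := ℂ) (M := V) (N := V')).comp
        (Algebra.TensorProduct.map D D'))).comp Algebra.TensorProduct.includeLeft) :=
    AlgHom.ext fun x => congrArg (e.conjAlgEquiv ℂ) (by
      have e0 : Algebra.TensorProduct.map D D' (x ⊗ₜ[ℂ] 1) = D x ⊗ₜ[ℂ] 1 := by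
        simp
      refine Eq.trans ?_ (congrArg (Module.endTensorEndAlgHom (R := ℂ) (S := ℂ) (A := ℂ)) e0.symm)
      exact TensorProduct.ext' fun _ _ => rfl)
  have e2 : (viaRight e).comp D' = (((e.conjAlgEquiv ℂ).toAlgHom.comp
      ((Module.endTensorEndAlgHom (R := ℂ) (S := ℂ) (A := ℂ) (M := V) (N := V')).comp
        (Algebra.TensorProduct.map D D'))).comp Algebra.TensorProduct.includeRight) :=
    AlgHom.ext fun x => congrArg (e.conjAlgEquiv ℂ) (by
      have e0 : Algebra.TensorProduct.map D D' (1 ⊗ₜ[ℂ] x) = 1 ⊗ₜ[ℂ] D' x := by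
        simp
      refine Eq.trans ?_ (congrArg (Module.endTensorEndAlgHom (R := ℂ) (S := ℂ) (A := ℂ)) e0.symm)
      exact TensorProduct.ext' fun _ _ => rfl)
  rw [e1, e2]
  exact this

end RibbonStructure

theorem repIso_of_conj {K : Type*} [Ring K] [Algebra ℂ K] (e : V ⊗[ℂ] V' ≃ₗ[ℂ] Y ⊗[ℂ] Y')
    {T : K →ₐ[ℂ] Module.End ℂ (V ⊗[ℂ] V')} {D : K →ₐ[ℂ] Module.End ℂ (Y ⊗[ℂ] Y')} (Ψ : (Module.End ℂ (Y ⊗[ℂ] Y'))ˣ)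
    (h : ∀ x, e.conjAlgEquiv ℂ (T x) * Ψ = Ψ * D x) : RepIso D T := by
  refine ⟨(LinearMap.GeneralLinearGroup.toLinearEquiv Ψ).trans e.symm, fun x w => ?_⟩
  have := LinearMap.congr_fun (h x) w
  apply e.injective
  simpa [LinearEquiv.conjAlgEquiv_apply] using this.symm

variable {VI VJ Vo Vo' : Type*} [AddCommGroup VI] [Module ℂ VI] [AddCommGroup VJ] [Module ℂ VJ]
  [AddCommGroup Vo] [Module ℂ Vo] [AddCommGroup Vo'] [Module ℂ Vo']

/-- The numbering of the factors of a concatenation. -/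
def factorEquiv (hL : L + 1 = M + N) (hM : 1 ≤ M) (hN : 1 ≤ N) :
    Fin (M - 1) ⊕ Fin (N - 1) ≃ Fin (L - 1) :=
  finSumFinEquiv.trans (finCongr (by omega))

variable (G) in
/-- The space `W_N` with a one-dimensional last factor is a tensor power. -/
def dropLast (N : ℕ) (l : Vo ⊗[ℂ] Vo ≃ₗ[ℂ] ℂ) :
    W G N Vo Vo ≃ₗ[ℂ] ⨂[ℂ] _ : Fin (N - 1), Module.Dual ℂ G :=
  (LinearEquiv.lTensor _ l).trans (TensorProduct.rid ℂ _)

theorem dropLast_tmul (l : Vo ⊗[ℂ] Vo ≃ₗ[ℂ] ℂ) (s : ⨂[ℂ] _ : Fin (N - 1), Module.Dual ℂ G)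
    (p : Vo ⊗[ℂ] Vo) : dropLast G N l (s ⊗ₜ[ℂ] p) = l p • s := rfl

theorem dropLast_onFactor (l : Vo ⊗[ℂ] Vo ≃ₗ[ℂ] ℂ) (k : Fin (N - 1)) (T : EndDual G)
    (w : W G N Vo Vo) : dropLast G N l (onFactor N Vo Vo k T w) = piFactor k T (dropLast G N l w) := by
  induction w using TensorProduct.induction_on with
  | zero => simp
  | add x y hx hy => simp only [map_add, hx, hy]
  | tmul s p => rw [onFactor_tmul, dropLast_tmul, dropLast_tmul, map_smul]

variable (hL : L + 1 = M + N) (hM : 1 ≤ M) (hN : 1 ≤ N) (l : Vo ⊗[ℂ] Vo ≃ₗ[ℂ] ℂ)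

variable (G VI VJ) in
/-- `W_M^{00} ⊗ W_N^{IJ} ≃ W_{M+N-1}^{IJ}`. -/
def vacuumLeft : W G M Vo Vo ⊗[ℂ] W G N VI VJ ≃ₗ[ℂ] W G L VI VJ :=
  (TensorProduct.congr (dropLast G M l) (LinearEquiv.refl ℂ _)).trans
    ((TensorProduct.assoc ℂ _ _ _).symm.trans
      (TensorProduct.congr (piConcat (factorEquiv hL hM hN)) (LinearEquiv.refl ℂ _)))

variable (G VI VJ) in
/-- `W_M^{IJ} ⊗ W_N^{00} ≃ W_{M+N-1}^{IJ}`. -/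
def vacuumRight : W G M VI VJ ⊗[ℂ] W G N Vo Vo ≃ₗ[ℂ] W G L VI VJ :=
  (TensorProduct.congr (LinearEquiv.refl ℂ _) (dropLast G N l)).trans
    ((TensorProduct.rightComm ℂ _ _ _).trans
      (TensorProduct.congr (piConcat (factorEquiv hL hM hN)) (LinearEquiv.refl ℂ _)))

theorem vacuumLeft_tmul (p : W G M Vo Vo) (t : ⨂[ℂ] _ : Fin (N - 1), Module.Dual ℂ G)
    (w : VI ⊗[ℂ] VJ) : vacuumLeft G VI VJ hL hM hN l (p ⊗ₜ[ℂ] (t ⊗ₜ[ℂ] w))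
      = piConcat (factorEquiv hL hM hN) (dropLast G M l p ⊗ₜ[ℂ] t) ⊗ₜ[ℂ] w := rfl

theorem vacuumRight_tmul (q : W G N Vo Vo) (s : ⨂[ℂ] _ : Fin (M - 1), Module.Dual ℂ G)
    (w : VI ⊗[ℂ] VJ) : vacuumRight G VI VJ hL hM hN l ((s ⊗ₜ[ℂ] w) ⊗ₜ[ℂ] q)
      = piConcat (factorEquiv hL hM hN) (s ⊗ₜ[ℂ] dropLast G N l q) ⊗ₜ[ℂ] w := rfl

theorem vacuumLeft_onFactor_left (k : Fin (M - 1)) (T : EndDual G) :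
    viaLeft (vacuumLeft G VI VJ hL hM hN l) (onFactor M Vo Vo k T)
      = onFactor L VI VJ (factorEquiv hL hM hN (Sum.inl k)) T := by
  refine (viaLeft_eq_iff _ _ _).mpr fun p q => ?_
  induction q using TensorProduct.induction_on with
  | zero => simp
  | add x y hx hy => simp only [TensorProduct.tmul_add, map_add, hx, hy]
  | tmul t w =>
    rw [vacuumLeft_tmul, vacuumLeft_tmul, onFactor_tmul, dropLast_onFactor, piConcat_piFactor_left]

theorem vacuumLeft_onFactor_right (k : Fin (N - 1)) (T : EndDual G) :
    viaRight (vacuumLeft G VI VJ hL hM hN l) (onFactor N VI VJ k T)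
      = onFactor L VI VJ (factorEquiv hL hM hN (Sum.inr k)) T := by
  refine (viaRight_eq_iff _ _ _).mpr fun p q => ?_
  induction q using TensorProduct.induction_on with
  | zero => simp
  | add x y hx hy => simp only [TensorProduct.tmul_add, map_add, hx, hy]
  | tmul t w =>
    rw [onFactor_tmul, vacuumLeft_tmul, vacuumLeft_tmul, onFactor_tmul, piConcat_piFactor_right]

theorem vacuumLeft_onLast (Z : Module.End ℂ (VI ⊗[ℂ] VJ)) :
    viaRight (vacuumLeft G VI VJ hL hM hN l) (onLast N Z) = onLast L Z := by
  refine (viaRight_eq_iff _ _ _).mpr fun p q => ?_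
  induction q using TensorProduct.induction_on with
  | zero => simp
  | add x y hx hy => simp only [TensorProduct.tmul_add, map_add, hx, hy]
  | tmul t w => rw [onLast_tmul, vacuumLeft_tmul, vacuumLeft_tmul, onLast_tmul]

theorem vacuumRight_onFactor_left (k : Fin (M - 1)) (T : EndDual G) :
    viaLeft (vacuumRight G VI VJ hL hM hN l) (onFactor M VI VJ k T)
      = onFactor L VI VJ (factorEquiv hL hM hN (Sum.inl k)) T := by
  refine (viaLeft_eq_iff _ _ _).mpr fun p q => ?_
  induction p using TensorProduct.induction_on with
  | zero => simp
  | add x y hx hy => simp only [TensorProduct.add_tmul, map_add, hx, hy]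
  | tmul t w =>
    rw [onFactor_tmul, vacuumRight_tmul, vacuumRight_tmul, onFactor_tmul, piConcat_piFactor_left]

theorem vacuumRight_onFactor_right (k : Fin (N - 1)) (T : EndDual G) :
    viaRight (vacuumRight G VI VJ hL hM hN l) (onFactor N Vo Vo k T)
      = onFactor L VI VJ (factorEquiv hL hM hN (Sum.inr k)) T := by
  refine (viaRight_eq_iff _ _ _).mpr fun p q => ?_
  induction p using TensorProduct.induction_on with
  | zero => simp
  | add x y hx hy => simp only [TensorProduct.add_tmul, map_add, hx, hy]
  | tmul t w =>
    rw [vacuumRight_tmul, vacuumRight_tmul, onFactor_tmul, dropLast_onFactor,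
      piConcat_piFactor_right]

theorem vacuumRight_onLast (Z : Module.End ℂ (VI ⊗[ℂ] VJ)) :
    viaLeft (vacuumRight G VI VJ hL hM hN l) (onLast M Z) = onLast L Z := by
  refine (viaLeft_eq_iff _ _ _).mpr fun p q => ?_
  induction p using TensorProduct.induction_on with
  | zero => simp
  | add x y hx hy => simp only [TensorProduct.add_tmul, map_add, hx, hy]
  | tmul t w => rw [onLast_tmul, vacuumRight_tmul, vacuumRight_tmul, onLast_tmul]

include hM hN in
theorem appendFamily_factorFamily {VI' VJ' : Type*} [AddCommGroup VI'] [Module ℂ VI']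
    [AddCommGroup VJ'] [Module ℂ VJ'] {χ : Module.End ℂ (W G M VI VJ) →ₐ[ℂ] Module.End ℂ (W G L Vo Vo')}
    {χ' : Module.End ℂ (W G N VI' VJ') →ₐ[ℂ] Module.End ℂ (W G L Vo Vo')}
    (h : ∀ k T, χ (onFactor M VI VJ k T) = onFactor L Vo Vo' (factorEquiv hL hM hN (Sum.inl k)) T)
    (h' : ∀ k T, χ' (onFactor N VI' VJ' k T)
      = onFactor L Vo Vo' (factorEquiv hL hM hN (Sum.inr k)) T) {k : ℕ} (hk : k + 1 < L) :
    appendFamily (M - 1) (fun l => χ.toLinearMap ∘ₗ factorFamily G VI VJ M l)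
      (fun l => χ'.toLinearMap ∘ₗ factorFamily G VI' VJ' N l) k = factorFamily G Vo Vo' L k := by
  rw [factorFamily_of_lt (by omega), appendFamily]
  split_ifs with h1
  · rw [factorFamily_of_lt h1]
    exact LinearMap.ext fun T => h ⟨k, h1⟩ T
  · rw [factorFamily_of_lt (by omega)]
    refine LinearMap.ext fun T => (h' ⟨k - (M - 1), by omega⟩ T).trans ?_
    congr 2
    refine Fin.ext ?_
    simp [factorEquiv]
    omega

theorem IsTrivialRep.firstAct_eq {τ : G →ₐ[ℂ] Module.End ℂ VI} (h : IsTrivialRep τ) (N : ℕ) :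
    (firstAct (VJ := VJ) N τ).toLinearMap = triv G (Module.End ℂ (W G N VI VJ)) :=
  LinearMap.ext fun ξ => by
    have e : τ ξ = algebraMap ℂ _ (ε G ξ) := LinearMap.ext fun w => h.2 ξ w
    simp only [firstAct, AlgHom.toLinearMap_apply, AlgHom.comp_apply, e, AlgHom.commutes]
    rfl

theorem IsTrivialRep.secondAct_eq {τ : G →ₐ[ℂ] Module.End ℂ VJ} (h : IsTrivialRep τ) (N : ℕ) :
    (secondAct (VI := VI) N τ).toLinearMap = triv G (Module.End ℂ (W G N VI VJ)) :=
  LinearMap.ext fun ξ => by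
    have e : τ ξ = algebraMap ℂ _ (ε G ξ) := LinearMap.ext fun w => h.2 ξ w
    simp only [secondAct, AlgHom.toLinearMap_apply, AlgHom.comp_apply, e, AlgHom.commutes]
    rfl

theorem IsTrivialRep.exists_equiv {τ : G →ₐ[ℂ] Module.End ℂ Vo} (h : IsTrivialRep τ) :
    Nonempty (Vo ⊗[ℂ] Vo ≃ₗ[ℂ] ℂ) := by
  -- The value `1` of `finrank` excludes infinite dimension, where it would be `0` by convention.
  have : Module.Finite ℂ Vo := Module.finite_of_finrank_pos (by rw [h.1]; exact one_pos)
  obtain ⟨l⟩ := FiniteDimensional.nonempty_linearEquiv_of_finrank_eq (R := ℂ) (M := Vo) (M' := ℂ)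
    (by rw [h.1, Module.finrank_self])
  exact ⟨(TensorProduct.congr l l).trans (TensorProduct.lid ℂ ℂ)⟩

namespace RibbonStructure

variable {τI : G →ₐ[ℂ] Module.End ℂ VI} {τJ : G →ₐ[ℂ] Module.End ℂ VJ}
  {τo : G →ₐ[ℂ] Module.End ℂ Vo}

theorem IsLatticeRep.vacuum (ho : IsTrivialRep τo) (hN : 1 ≤ N)
    {D : H.K N →ₐ[ℂ] Module.End ℂ (W G N Vo Vo)} (hD : H.IsLatticeRep τo τo D) :
    H.IsLatticeHom N (factorFamily G Vo Vo N) (triv G _) (triv G _) D := by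
  have := (isLatticeRep_iff hN _ _ _).mp hD
  rwa [ho.firstAct_eq, ho.secondAct_eq, triv_convolve] at this

theorem IsLatticeRep.vacuum_tensor (ho : IsTrivialRep τo)
    {Λ : H.K L →ₐ[ℂ] H.K M ⊗[ℂ] H.K N} (h : H.IsCoproduct Λ)
    {D : H.K M →ₐ[ℂ] Module.End ℂ (W G M Vo Vo)} (hD : H.IsLatticeRep τo τo D)
    {D' : H.K N →ₐ[ℂ] Module.End ℂ (W G N VI VJ)} (hD' : H.IsLatticeRep τI τJ D') :
    H.IsLatticeRep τI τJ (((vacuumLeft G VI VJ hL hM hN l).conjAlgEquiv ℂ).toAlgHom.comp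
      (tensorRep Λ D D')) := by
  set e := vacuumLeft G VI VJ hL hM hN l with he
  have h1 := (hD.vacuum ho hM).map (viaLeft e)
  have h2 := ((isLatticeRep_iff hN _ _ _).mp hD').map (viaRight e)
  have ei : (viaRight e).toLinearMap ∘ₗ (firstAct N τI).toLinearMap
      = (firstAct L τI).toLinearMap := LinearMap.ext fun ξ => vacuumLeft_onLast hL hM hN l _
  have ej : (viaRight e).toLinearMap ∘ₗ (secondAct N τJ).toLinearMap
      = (secondAct L τJ).toLinearMap := LinearMap.ext fun ξ => vacuumLeft_onLast hL hM hN l _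
  rw [map_triv] at h1
  rw [map_convolve, ei, ej] at h2
  refine (isLatticeRep_iff (by omega) _ _ _).mpr (IsLatticeHom.congr
    ((isConcat_tensorRep hL hM hN h D D' e).isLatticeHom hM hN
      ((isFactorFamily_factorFamily M).map _) ((isFactorFamily_factorFamily N).map _)
      (fun _ _ _ _ x y => commuting_viaLeft_viaRight e _ _) h1 h2) fun k hk =>
    appendFamily_factorFamily hL hM hN (vacuumLeft_onFactor_left hL hM hN l)
      (vacuumLeft_onFactor_right hL hM hN l) hk)

theorem IsLatticeRep.tensor_vacuum (ho : IsTrivialRep τo)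
    {Λ : H.K L →ₐ[ℂ] H.K M ⊗[ℂ] H.K N} (h : H.IsCoproduct Λ)
    {D : H.K M →ₐ[ℂ] Module.End ℂ (W G M VI VJ)} (hD : H.IsLatticeRep τI τJ D)
    {D' : H.K N →ₐ[ℂ] Module.End ℂ (W G N Vo Vo)} (hD' : H.IsLatticeRep τo τo D') :
    ∃ Ψ : (Module.End ℂ (W G L VI VJ))ˣ, H.IsLatticeRep τI τJ (conjBy Ψ
      (((vacuumRight G VI VJ hL hM hN l).conjAlgEquiv ℂ).toAlgHom.comp (tensorRep Λ D D'))) := by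
  set e := vacuumRight G VI VJ hL hM hN l with he
  have h1 := ((isLatticeRep_iff hM _ _ _).mp hD).map (viaLeft e)
  have h2 := (hD'.vacuum ho hN).map (viaRight e)
  have ei : (viaLeft e).toLinearMap ∘ₗ (firstAct M τI).toLinearMap
      = (firstAct L τI).toLinearMap := LinearMap.ext fun ξ => vacuumRight_onLast hL hM hN l _
  have ej : (viaLeft e).toLinearMap ∘ₗ (secondAct M τJ).toLinearMap
      = (secondAct L τJ).toLinearMap := LinearMap.ext fun ξ => vacuumRight_onLast hL hM hN l _
  rw [map_triv] at h2
  rw [map_convolve, ei, ej] at h1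
  set g := fun k => (viaRight e).toLinearMap ∘ₗ factorFamily G Vo Vo N k with hg
  have hgF : IsFactorFamily (N - 1) g := (isFactorFamily_factorFamily N).map _
  have hi : IsRep (firstAct (G := G) (VJ := VJ) L τI).toLinearMap := IsRep.ofAlgHom _
  have hj : IsRep (secondAct (G := G) (VI := VI) L τJ).toLinearMap := IsRep.ofAlgHom _
  have ht : IsRep (tailProd g (N - 1)) := hgF.isRep_tailProd le_rfl
  have hri : Commuting (viaRight e) (firstAct (VJ := VJ) L τI).toLinearMap := fun x y => by
    rw [← ei]; exact (commuting_viaLeft_viaRight e _ _).symm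
  have hrj : Commuting (viaRight e) (secondAct (VI := VI) L τJ).toLinearMap := fun x y => by
    rw [← ej]; exact (commuting_viaLeft_viaRight e _ _).symm
  have hgi : ∀ k < N - 1, Commuting (g k) (firstAct (VJ := VJ) L τI).toLinearMap :=
    fun k _ x y => hri _ y
  have hgj : ∀ k < N - 1, Commuting (g k) (secondAct (VI := VI) L τJ).toLinearMap :=
    fun k _ x y => hrj _ y
  -- The braiding of the factors `ℜ` of the vacuum, taken together, past `V^J` and `V^I`.
  let Ψ : (Module.End ℂ (W G L VI VJ))ˣ :=
    H.ru ht hj (commuting_tailProd hgj) * (H.ru hi ht (commuting_tailProd hgi).symm)⁻¹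
  have hΨ := mul_conjBy Ψ ((e.conjAlgEquiv ℂ).toAlgHom.comp (tensorRep Λ D D'))
  refine ⟨Ψ, (isLatticeRep_iff (by omega) _ _ _).mpr (IsLatticeHom.congr
    ((isConcat_tensorRep hL hM hN h D D' e).isLatticeHom_braided hM hN
      ((isFactorFamily_factorFamily M).map (viaLeft e)) hgF
      (fun _ _ _ _ x y => commuting_viaLeft_viaRight e _ _) hi hj
      (commuting_firstAct_secondAct L τI τJ) (fun k hk x y => ?_) (fun k hk x y => ?_) hgi hgj
      (fun x y => hri _ y) (fun x y => hrj _ y) h1 h2 hΨ) fun k hk =>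
    appendFamily_factorFamily hL hM hN (vacuumRight_onFactor_left hL hM hN l)
      (vacuumRight_onFactor_right hL hM hN l) hk)⟩
  · rw [← ei]
    exact (commuting_factorFamily_onLast hk x _).map (viaLeft e)
  · rw [← ej]
    exact (commuting_factorFamily_onLast hk x _).map (viaLeft e)

variable (H) in
-- Gluing the vacuum representation of `K_2` to the left of `D^{IJ}_N` adds one factor `ℜ` and gives
-- `D^{IJ}_{N+1}`. A trivial representation of `G` is needed to form this vacuum.
theorem exists_isLatticeRep (ho : IsTrivialRep τo) (τI : G →ₐ[ℂ] Module.End ℂ VI)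
    (τJ : G →ₐ[ℂ] Module.End ℂ VJ) (hN : 1 ≤ N) :
    ∃ D : H.K N →ₐ[ℂ] Module.End ℂ (W G N VI VJ), H.IsLatticeRep τI τJ D := by
  obtain ⟨l⟩ := ho.exists_equiv
  induction N, hN using Nat.le_induction with
  | base =>
    obtain ⟨D, hD⟩ := H.exists_isLatticeHom_one (IsRep.ofAlgHom (firstAct (VJ := VJ) 1 τI))
      (IsRep.ofAlgHom (secondAct (VI := VI) 1 τJ)) (commuting_firstAct_secondAct 1 τI τJ)
      (factorFamily G VI VJ 1)
    exact ⟨D, (isLatticeRep_iff le_rfl _ _ _).mpr hD⟩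
  | succ N hN ih =>
    obtain ⟨D', hD'⟩ := ih
    have hF := isFactorFamily_factorFamily (G := G) (VI := Vo) (VJ := Vo) 2
    obtain ⟨D, hD⟩ := H.exists_isLatticeHom_two (AlgHom.ofLinearMap (factorFamily G Vo Vo 2 0)
      (hF.one 0 (by norm_num)) (hF.mul 0 (by norm_num))) (f := factorFamily G Vo Vo 2) rfl
    have hD2 : H.IsLatticeRep τo τo D := by
      rw [isLatticeRep_iff (by norm_num), ho.firstAct_eq, ho.secondAct_eq, triv_convolve]
      exact hD
    obtain ⟨Λ, hΛ⟩ := exists_coproduct (H := H) (L := N + 1) (M := 2) (N := N) (by omega)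
      (by norm_num) hN
    exact ⟨_, IsLatticeRep.vacuum_tensor (by omega) (by norm_num) hN l ho hΛ hD2 hD'⟩

theorem IsLatticeRep.unique (hN : 1 ≤ N) {D D' : H.K N →ₐ[ℂ] Module.End ℂ (W G N VI VJ)}
    (h : H.IsLatticeRep τI τJ D) (h' : H.IsLatticeRep τI τJ D') : D = D' :=
  IsLatticeHom.unique hN ((isLatticeRep_iff hN _ _ _).mp h) ((isLatticeRep_iff hN _ _ _).mp h')

end RibbonStructure

end Concatenation

end

end LatticeCurrent

theorem mainTheorem6 {G : Type*} [Ring G] [HopfAlgebra ℂ G] [Module.Finite ℂ G]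
    [IsSemisimpleRing G] (H : LatticeCurrent.RibbonStructure G)
    {ι : Type*} [Fintype ι] [DecidableEq ι] {V : ι → Type*} [∀ i, AddCommGroup (V i)]
    [∀ i, Module ℂ (V i)] (τ : ∀ i, G →ₐ[ℂ] Module.End ℂ (V i)) (hτ : LatticeCurrent.IsIrrepSystem τ)
    (hS : IsUnit (H.sMatrix τ))
    (o : ι) (ho : LatticeCurrent.IsTrivialRep (τ o)) :
    (∀ M N : ℕ, 1 ≤ M → 1 ≤ N →
      ∃! Λ : H.K (M + N - 1) →ₐ[ℂ] H.K M ⊗[ℂ] H.K N, H.IsCoproduct Λ) ∧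
    (∀ N : ℕ, 1 ≤ N → ∀ I J : ι,
      ∃! D : H.K N →ₐ[ℂ] Module.End ℂ (LatticeCurrent.W G N (V I) (V J)),
        H.IsLatticeRep (τ I) (τ J) D) ∧
    (∀ M N : ℕ, 1 ≤ M → 1 ≤ N →
      ∀ (Λ : H.K (M + N - 1) →ₐ[ℂ] H.K M ⊗[ℂ] H.K N)
        (Λ' : H.K (M + N - 1) →ₐ[ℂ] H.K N ⊗[ℂ] H.K M),
        H.IsCoproduct Λ → H.IsCoproduct Λ' →
      ∀ (I J : ι)
        (D : H.K (M + N - 1) →ₐ[ℂ] Module.End ℂ (LatticeCurrent.W G (M + N - 1) (V I) (V J)))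
        (DM : H.K M →ₐ[ℂ] Module.End ℂ (LatticeCurrent.W G M (V I) (V J)))
        (DN : H.K N →ₐ[ℂ] Module.End ℂ (LatticeCurrent.W G N (V o) (V o))),
        H.IsLatticeRep (τ I) (τ J) D → H.IsLatticeRep (τ I) (τ J) DM →
        H.IsLatticeRep (τ o) (τ o) DN →
        LatticeCurrent.RepIso D (LatticeCurrent.RibbonStructure.tensorRep Λ DM DN) ∧
        LatticeCurrent.RepIso D (LatticeCurrent.RibbonStructure.tensorRep Λ' DN DM)) := by
  open LatticeCurrent LatticeCurrent.RibbonStructure in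
  refine ⟨fun M N hM hN => ?_, fun N hN I J => ?_,
    fun M N hM hN Λ Λ' hΛ hΛ' I J D DM DN hD hDM hDN => ?_⟩
  · obtain ⟨Λ, hΛ⟩ := exists_coproduct (H := H) (L := M + N - 1) (by omega) hM hN
    exact ⟨Λ, hΛ, fun Λ' hΛ' => coproduct_unique (by omega) hM hN hΛ' hΛ⟩
  · obtain ⟨D, hD⟩ := H.exists_isLatticeRep ho (τ I) (τ J) hN
    exact ⟨D, hD, fun D' hD' => hD'.unique hN hD⟩
  · obtain ⟨l⟩ := ho.exists_equiv
    have hL : M + N - 1 + 1 = M + N := by omega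
    have hL' : M + N - 1 + 1 = N + M := by omega
    constructor
    · obtain ⟨Ψ, hΨ⟩ := hDM.tensor_vacuum hL hM hN l ho hΛ hDN
      -- After reordering the tensor factors, the two representations still differ by the braiding
      -- `Ψ`.
      refine repIso_of_conj (vacuumRight G (V I) (V J) hL hM hN l) Ψ fun x => ?_
      rw [hD.unique (by omega) hΨ]
      exact mul_conjBy Ψ (((vacuumRight G (V I) (V J) hL hM hN l).conjAlgEquiv ℂ).toAlgHom.comp
        (tensorRep Λ DM DN)) x
    · have h := hDN.vacuum_tensor hL' hN hM l ho hΛ' hDM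
      -- With the vacuum on the left the reordering alone is an isomorphism, so the intertwiner is
      -- `1`.
      refine repIso_of_conj (vacuumLeft G (V I) (V J) hL' hN hM l) 1 fun x => ?_
      rw [hD.unique (by omega) h, Units.val_one, mul_one, one_mul]
      rfl
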